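/- Let $Q$ be a Hausdorff $d$-dimensional manifold of class $C^{r+1}$, $2\le r\le\infty$, and let $a_t$ (a Riemannian metric on $Q$), $b_t$ (a 1-form on $Q$) and $V(t,q)$ (a function) depend on the time $t\in\mathbb R$ and be of class $C^r$ jointly in $(t,q)\in\mathbb R\times Q$. Let $M=\mathbb R\times Q\times\mathbb R$, with points $(t,q,y)$, carry the Brinkmann metric $$g=a_t-dt\otimes(dy-b_t)-(dy-b_t)\otimes dt-2V\,dt\otimes dt ,$$ and let $H(t,q,p)=\tfrac12 a_t^{-1}(p-b_t,p-b_t)+V(t,q)$. *Rosen coordinates* on an open set $U\subset M$ are a homeomorphism $(t,q,y)\mapsto(t,q',y')$ of $U$ onto an open subset of $\mathbb R\times Q'\times\mathbb R$, where $Q'$ is a $d$-dimensional manifold, which preserves $t$, satisfies $\partial_{y'}=\partial_y$, is at least $C^1$ together with its inverse, and brings $g$ to the form $$g=a'_t-dt\otimes dy'-dy'\otimes dt$$ with $a'_t$ a time-dependent Riemannian metric on $Q'$ (i.e. $a'$ depends on $(t,q')$ only). They are *of class $C^k$* if the map and its inverse are $C^k$ (with $Q'$ of class $C^k$) and $a'$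 is $C^{k-1}$. For an open interval $I$, Rosen coordinates *on $I$* are those with $U=I\times Q\times\mathbb R$ and with image $I\times Q'\times\mathbb R$; they are *global* if $I=\mathbb R$. A function $u$ on $I\times Q$ of class $C^k$, $k\ge1$, is a *solution on $I$* if $\partial_tu+H(t,q,\partial_qu)=0$ there. Its *base characteristics* are the curves $t\mapsto q(t)$ with $\dot q=a_t^{-1}(\cdot,\partial_qu-b_t)$. They are *defined on $I$* (*complete*, if $I=\mathbb R$) if through every point of $I\times Q$ there passes one that is defined on all of $I$, and every base characteristic over an open subinterval of $I$ extends to one over $I$. (1) Every point of $M$ has an open neighbourhood with Rosen coordinates of class $C^{r-1}$ (hence with a $C^{r-2}$ space metric $a'$), taking values in $\mathbb R\times\mathbb R^d\times\mathbb R$, whose coordinate $y'$ is $C^r$. (2) Global case. If $1\le k\le r+1$ and there are global Rosen coordinates of class $C^k$, then there is a global $C^k$ solution of the Hamilton–Jacobi equation whose base characteristics are complete. If $2\le k\le r+1$, there are global Rosen coordinates of class $C^{k-1}$ (with a $C^{k-2}$ space metric) whose coordinate $y'$ is $C^k$ if and only if there is a global $C^k$ solution of the Hamilton–Jacobi equation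 whose base characteristics are complete. (3) Time-local case. Let $t_0\in\mathbb R$. The two assertions of (2) hold with "there are Rosen coordinates on some open interval containing $t_0$" in place of "there are global Rosen coordinates", and "there is a solution on some open interval $I$ containing $t_0$ whose base characteristics are defined on $I$" in place of "there is a global solution whose base characteristics are complete". -/

import Mathlib

open scoped Manifold ContDiff

universe u

noncomputable section

/-- A time dependent symmetric 2-tensor (for instance a metric) on the leaves `{t} × Q`. -/
abbrev TimeBilin (d : ℕ) (Q : Type*) [TopologicalSpace Q]
    [ChartedSpace (EuclideanSpace ℝ (Fin d)) Q] : Type _ :=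
  ℝ → (q : Q) → TangentSpace (𝓡 d) q →L[ℝ] TangentSpace (𝓡 d) q →L[ℝ] ℝ

/-- A time dependent 1-form on the leaves `{t} × Q`. -/
abbrev TimeForm (d : ℕ) (Q : Type*) [TopologicalSpace Q]
    [ChartedSpace (EuclideanSpace ℝ (Fin d)) Q] : Type _ :=
  ℝ → (q : Q) → TangentSpace (𝓡 d) q →L[ℝ] ℝ

/-- `a` is a time dependent Riemannian metric of class `C^m`, defined over the set `S` of events
`(t, q)`. Regularity is joint regularity in `(t, q)`: since `a` is symmetric, its components in
local coordinates are `C^m` exactly when the quadratic function `(t, v) ↦ a_t(v, v)` on `ℝ × TQ`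
is `C^m`. -/
structure IsTimeMetricOn {d : ℕ} {Q : Type*} [TopologicalSpace Q]
    [ChartedSpace (EuclideanSpace ℝ (Fin d)) Q] [IsManifold (𝓡 d) 1 Q]
    (m : ℕ∞) (a : TimeBilin d Q) (S : Set (ℝ × Q)) : Prop where
  symm : ∀ t q, (t, q) ∈ S → ∀ v w, a t q v w = a t q w v
  pos : ∀ t q, (t, q) ∈ S → ∀ v, v ≠ 0 → 0 < a t q v v
  contMDiffOn : ContMDiffOn (𝓘(ℝ, ℝ).prod (𝓡 d).tangent) 𝓘(ℝ, ℝ) (m : WithTop ℕ∞)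
    (fun p : ℝ × TangentBundle (𝓡 d) Q => a p.1 p.2.proj p.2.snd p.2.snd)
    {p | (p.1, p.2.proj) ∈ S}

/-- The data `a_t`, `b_t`, `V`, all of class `C^r` jointly in `(t, q) ∈ ℝ × Q`, which define the
Brinkmann metric on `ℝ × Q × ℝ` and the Lagrangian `a_t(v, v) / 2 + b_t(v) - V`. -/
structure BrinkmannData (d : ℕ) (Q : Type*) [TopologicalSpace Q]
    [ChartedSpace (EuclideanSpace ℝ (Fin d)) Q] [IsManifold (𝓡 d) 1 Q] (r : ℕ∞) where
  a : TimeBilin d Q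
  b : TimeForm d Q
  V : ℝ → Q → ℝ
  isMetric : IsTimeMetricOn r a Set.univ
  contMDiff_b : ContMDiff (𝓘(ℝ, ℝ).prod (𝓡 d).tangent) 𝓘(ℝ, ℝ) (r : WithTop ℕ∞)
    (fun p : ℝ × TangentBundle (𝓡 d) Q => b p.1 p.2.proj p.2.snd)
  contMDiff_V : ContMDiff (𝓘(ℝ, ℝ).prod (𝓡 d)) 𝓘(ℝ, ℝ) (r : WithTop ℕ∞)
    (fun p : ℝ × Q => V p.1 p.2)

/-- The model with corners of the spacetime `ℝ × Q × ℝ`, with points `(t, q, y)`. -/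
abbrev spacetimeModel (d : ℕ) :=
  𝓘(ℝ, ℝ).prod ((𝓡 d).prod 𝓘(ℝ, ℝ))

/-- The Rosen metric `a'_t - dt ⊗ dy' - dy' ⊗ dt` at the point `(t, q', y')`, evaluated on two
tangent vectors of `ℝ × Q' × ℝ`. -/
def rosenMetric {d : ℕ} {Q : Type*} [TopologicalSpace Q]
    [ChartedSpace (EuclideanSpace ℝ (Fin d)) Q] (a : TimeBilin d Q) (x : ℝ × Q × ℝ)
    (X Y : ℝ × TangentSpace (𝓡 d) x.2.1 × ℝ) : ℝ :=
  a x.1 x.2.1 X.2.1 Y.2.1 - X.1 * Y.2.2 - X.2.2 * Y.1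

namespace BrinkmannData

variable {d : ℕ} {Q : Type*} [TopologicalSpace Q]
  [ChartedSpace (EuclideanSpace ℝ (Fin d)) Q] [IsManifold (𝓡 d) 1 Q] {r : ℕ∞}

/-- The Brinkmann metric
`g = a_t - dt ⊗ (dy - b_t) - (dy - b_t) ⊗ dt - 2 V dt ⊗ dt` at the point `(t, q, y)`. -/
def metric (D : BrinkmannData d Q r) (x : ℝ × Q × ℝ)
    (X Y : ℝ × TangentSpace (𝓡 d) x.2.1 × ℝ) : ℝ :=
  D.a x.1 x.2.1 X.2.1 Y.2.1
    - X.1 * (Y.2.2 - D.b x.1 x.2.1 Y.2.1)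
    - (X.2.2 - D.b x.1 x.2.1 X.2.1) * Y.1
    - 2 * D.V x.1 x.2.1 * (X.1 * Y.1)

/-- The vector `a_t⁻¹(·, p)`, that is, the vector `v` with `a_t(v, ·) = p`. -/
def sharp (D : BrinkmannData d Q r) (t : ℝ) (q : Q) (p : TangentSpace (𝓡 d) q →L[ℝ] ℝ) :
    TangentSpace (𝓡 d) q :=
  (D.a t q).inverse p

/-- The Hamiltonian `H(t, q, p) = a_t⁻¹(p - b_t, p - b_t) / 2 + V(t, q)`. -/
def hamiltonian (D : BrinkmannData d Q r) (t : ℝ) (q : Q)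
    (p : TangentSpace (𝓡 d) q →L[ℝ] ℝ) : ℝ :=
  1 / 2 * (p - D.b t q) (D.sharp t q (p - D.b t q)) + D.V t q

/-- The partial differential `∂u/∂q`, a covector on `Q`. -/
def dq (u : ℝ → Q → ℝ) (t : ℝ) (q : Q) : TangentSpace (𝓡 d) q →L[ℝ] ℝ :=
  mfderiv (𝓡 d) 𝓘(ℝ, ℝ) (u t) q

/-- `u` is a classical solution of class `C^k` of the Hamilton-Jacobi equation
`∂u/∂t + H(t, q, ∂u/∂q) = 0` on `I × Q`. -/
structure IsHJSolutionOn (D : BrinkmannData d Q r) (k : ℕ∞) (I : Set ℝ) (u : ℝ → Q → ℝ) :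
    Prop where
  contMDiffOn : ContMDiffOn (𝓘(ℝ, ℝ).prod (𝓡 d)) 𝓘(ℝ, ℝ) (k : WithTop ℕ∞)
    (fun p : ℝ × Q => u p.1 p.2) (I ×ˢ Set.univ)
  equation : ∀ t ∈ I, ∀ q, deriv (fun s => u s q) t + D.hamiltonian t q (dq u t q) = 0

/-- `γ` is, over the open set of times `J`, a base characteristic of `u`: a solution of
`q̇ = ∂H/∂p (t, q, ∂u/∂q) = a_t⁻¹(·, ∂u/∂q - b_t)`. -/
def IsBaseCharacteristicOn (D : BrinkmannData d Q r) (u : ℝ → Q → ℝ) (J : Set ℝ)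
    (γ : ℝ → Q) : Prop :=
  ∀ t ∈ J, HasMFDerivAt 𝓘(ℝ, ℝ) (𝓡 d) γ t
    (ContinuousLinearMap.toSpanSingleton ℝ
      (D.sharp t (γ t) (dq u t (γ t) - D.b t (γ t)) : TangentSpace (𝓡 d) (γ t)))

/-- All base characteristics of `u` are defined on the whole of `I`: through every event of
`I × Q` there passes one that is defined on `I`, and every base characteristic over an open
subinterval of `I` extends to one over `I`. For `I = ℝ` this is completeness. -/
def CharacteristicsDefinedOn (D : BrinkmannData d Q r) (I : Set ℝ) (u : ℝ → Q → ℝ) : Prop :=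
  (∀ t ∈ I, ∀ q, ∃ γ, D.IsBaseCharacteristicOn u I γ ∧ γ t = q) ∧
  (∀ J ⊆ I, IsOpen J → J.OrdConnected → ∀ γ, D.IsBaseCharacteristicOn u J γ →
    ∃ γ', D.IsBaseCharacteristicOn u I γ' ∧ Set.EqOn γ' γ J)

/-- There is a `C^k` solution of the Hamilton-Jacobi equation on `I × Q` whose base
characteristics are all defined on the whole of `I`. -/
def HasHJSolution (D : BrinkmannData d Q r) (k : ℕ∞) (I : Set ℝ) : Prop :=
  ∃ u, D.IsHJSolutionOn k I u ∧ D.CharacteristicsDefinedOn I u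

/-- `Φ : (t, q, y) ↦ (t, q', y')`, from an open subset of the spacetime onto an open subset of
`ℝ × Q' × ℝ`, puts the Brinkmann metric in the Rosen form with space metric `a'`, and
`∂/∂y' = ∂/∂y`. The change of coordinates is `C^k` in both directions, its component `y'` is
moreover `C^l`, and `a'` is `C^(k-1)`. -/
structure IsRosen (D : BrinkmannData d Q r) (k l : ℕ∞) {Q' : Type*} [TopologicalSpace Q']
    [ChartedSpace (EuclideanSpace ℝ (Fin d)) Q'] [IsManifold (𝓡 d) 1 Q']
    (Φ : OpenPartialHomeomorph (ℝ × Q × ℝ) (ℝ × Q' × ℝ)) (a' : TimeBilin d Q') : Prop where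
  contMDiffOn : ContMDiffOn (spacetimeModel d) (spacetimeModel d) (k : WithTop ℕ∞) Φ Φ.source
  contMDiffOn_symm :
    ContMDiffOn (spacetimeModel d) (spacetimeModel d) (k : WithTop ℕ∞) Φ.symm Φ.target
  contMDiffOn_y : ContMDiffOn (spacetimeModel d) 𝓘(ℝ, ℝ) (l : WithTop ℕ∞)
    (fun x => (Φ x).2.2) Φ.source
  time : ∀ x ∈ Φ.source, (Φ x).1 = x.1
  killing : ∀ x ∈ Φ.source,
    mfderiv (spacetimeModel d) (spacetimeModel d) Φ x
      ((0, 0, 1) : ℝ × TangentSpace (𝓡 d) x.2.1 × ℝ) =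
      ((0, 0, 1) : ℝ × TangentSpace (𝓡 d) (Φ x).2.1 × ℝ)
  isMetric : IsTimeMetricOn (k - 1) a' ((fun x' => (x'.1, x'.2.1)) '' Φ.target)
  metric_eq : ∀ x ∈ Φ.source, ∀ X Y : ℝ × TangentSpace (𝓡 d) x.2.1 × ℝ,
    D.metric x X Y = rosenMetric a' (Φ x)
      (mfderiv (spacetimeModel d) (spacetimeModel d) Φ x X)
      (mfderiv (spacetimeModel d) (spacetimeModel d) Φ x Y)

/-- Rosen coordinates on the whole part `I × Q × ℝ` of the spacetime: a `d`-dimensional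
manifold `Q'` and a diffeomorphism of `I × Q × ℝ` onto `I × Q' × ℝ` which puts the metric in
Rosen form. -/
def HasRosen {Q : Type u} [TopologicalSpace Q]
    [ChartedSpace (EuclideanSpace ℝ (Fin d)) Q] [IsManifold (𝓡 d) 1 Q]
    (D : BrinkmannData d Q r) (k l : ℕ∞) (I : Set ℝ) : Prop :=
  ∃ (Q' : Type u) (_ : TopologicalSpace Q') (_ : ChartedSpace (EuclideanSpace ℝ (Fin d)) Q')
    (_ : IsManifold (𝓡 d) 1 Q') (_ : IsManifold (𝓡 d) (k : WithTop ℕ∞) Q')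
    (Φ : OpenPartialHomeomorph (ℝ × Q × ℝ) (ℝ × Q' × ℝ)) (a' : TimeBilin d Q'),
    Φ.source = {x | x.1 ∈ I} ∧ Φ.target = {x | x.1 ∈ I} ∧ D.IsRosen k l Φ a'

end BrinkmannData

/-- `P I` holds for some open interval `I` containing `t₀`. -/
def TimeLocally (t₀ : ℝ) (P : Set ℝ → Prop) : Prop :=
  ∃ I : Set ℝ, IsOpen I ∧ I.OrdConnected ∧ t₀ ∈ I ∧ P I

end

/-!
Rosen coordinates `(t, q', y')` and solutions `u` of the Hamilton–Jacobi equation determine each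
other through `y' = y - u(t, q)`.

In Rosen coordinates the hypersurfaces `y' = const` are null, because the metric restricts to them
as `a'_t`, which vanishes on `∂_t`. Since `∂_{y'} = ∂_y`, such a hypersurface is the graph of a
function `y = u(t, q) + const`, and a graph is null exactly when `∂_t u + H(t, q, ∂_q u) = 0`. The
vector field `∂_t` of the Rosen coordinates is the null direction of these graphs, so the curves
`q' = const` project to the base characteristics of `u`: these are complete because the
coordinates cover `I × Q' × ℝ`.

Conversely, let `u` be a solution and let `(t, q')` be coordinates on the events which straighten
its base characteristics to the curves `q' = const`. Completing the square in the Brinkmann metric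
and using the equation shows that `(t, q', y - u(t, q))` are Rosen coordinates. If the base
characteristics are defined on `I`, the flow of their velocity field yields such coordinates on
`I × Q`, with `Q' = Q` the space of events at a fixed time. Near a given event, where no solution is
given, the method of characteristics provides one together with its straightening: one starts the
Hamiltonian flow from vanishing momenta. One derivative is gained there, since the differential of
the solution `u` is `p dq - H dt` along the flow.
-/

open Set Filter Topology

/-! ### Smooth dependence of solutions of differential equations on initial conditions -/

section Implicit

/-- At class `C^∞` the library only gives regularity of the implicit function at the base point:
regularity nearby follows by applying the theorem again at the nearby points of the graph. -/
theorem exists_implicitFunction_eventually_contDiffAt {P Y Z : Type*}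
    [NormedAddCommGroup P] [NormedSpace ℝ P] [CompleteSpace P]
    [NormedAddCommGroup Y] [NormedSpace ℝ Y] [CompleteSpace Y]
    [NormedAddCommGroup Z] [NormedSpace ℝ Z] [CompleteSpace Z] {n : ℕ∞} (hn : 1 ≤ n)
    {S : P × Y → Z} (hS : ContDiff ℝ n S) {u : P × Y} (hu : S u = 0)
    (hinv : (fderiv ℝ S u ∘L .inr ℝ P Y).IsInvertible) :
    ∃ ψ : P → Y, ψ u.1 = u.2 ∧
      (∀ᶠ p in 𝓝 u.1, ContDiffAt ℝ n ψ p ∧ S (p, ψ p) = 0) ∧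
      ∀ᶠ w in 𝓝 u, S w = 0 → ψ w.1 = w.2 := by
  have hn₀ : (n : WithTop ℕ∞) ≠ 0 := by exact_mod_cast (zero_lt_one.trans_le hn).ne'
  have hinv_near : ∀ᶠ w in 𝓝 u, (fderiv ℝ S w ∘L .inr ℝ P Y).IsInvertible := by
    obtain ⟨e, he⟩ := hinv
    have hcont : Continuous fun w => fderiv ℝ S w ∘L .inr ℝ P Y :=
      (hS.continuous_fderiv hn₀).clm_comp continuous_const
    exact hcont.continuousAt (he ▸ ContinuousLinearEquiv.nhds e)
  set ψ := (hS.contDiffAt (x := u)).implicitFunction hn₀ hinv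
  have hψu : ψ u.1 = u.2 := (hS.contDiffAt (x := u)).implicitFunction_apply_self hn₀ hinv
  have hψC1 : ∀ᶠ p in 𝓝 u.1, ContDiffAt ℝ 1 ψ p :=
    (((hS.contDiffAt (x := u)).contDiffAt_implicitFunction hn₀ hinv).of_le
      (by exact_mod_cast hn)).eventually (by simp)
  have hψzero : ∀ᶠ p in 𝓝 u.1, S (p, ψ p) = 0 :=
    hu ▸ (hS.contDiffAt (x := u)).eventually_apply_implicitFunction hn₀ hinv
  have hgraph : Tendsto (fun p => (p, ψ p)) (𝓝 u.1) (𝓝 u) := by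
    have : ContinuousAt (fun p => (p, ψ p)) u.1 :=
      continuousAt_id.prodMk hψC1.self_of_nhds.continuousAt
    rwa [ContinuousAt, hψu] at this
  refine ⟨ψ, hψu, ?_, ?_⟩
  · filter_upwards [hψC1, hψzero.eventually_nhds, hgraph.eventually hinv_near]
      with p hpC1 hpzero hpinv
    refine ⟨?_, hpzero.self_of_nhds⟩
    refine ((hS.contDiffAt (x := (p, ψ p))).contDiffAt_implicitFunction hn₀
      hpinv).congr_of_eventuallyEq ?_
    have hgraph_p : ContinuousAt (fun p => (p, ψ p)) p :=
      continuousAt_id.prodMk hpC1.continuousAt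
    filter_upwards [hpzero, hgraph_p.eventually ((hS.contDiffAt
      (x := (p, ψ p))).eventually_apply_eq_iff_implicitFunction hn₀ hpinv)] with q hqzero hq
    exact (hq.1 (hqzero.trans hpzero.self_of_nhds.symm)).symm
  · filter_upwards [(hS.contDiffAt (x := u)).eventually_apply_eq_iff_implicitFunction hn₀ hinv]
      with w hw hwzero
    exact hw.1 (hwzero.trans hu.symm)

end Implicit

section Postcomposition

variable {K : Type*} [TopologicalSpace K] [CompactSpace K]

/-- Pointwise application of a continuous family of continuous linear maps to a continuous
function, as a bounded bilinear map. It expresses the derivative of postcomposition. -/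
noncomputable def pointwiseApplyCLM (K : Type*) [TopologicalSpace K] [CompactSpace K]
    (F G : Type*) [NormedAddCommGroup F] [NormedSpace ℝ F] [NormedAddCommGroup G]
    [NormedSpace ℝ G] : C(K, F →L[ℝ] G) →L[ℝ] C(K, F) →L[ℝ] C(K, G) :=
  LinearMap.mkContinuous₂
    (LinearMap.mk₂ ℝ
      (fun (A : C(K, F →L[ℝ] G)) (h : C(K, F)) =>
        (⟨fun s => A s (h s), A.continuous.clm_apply h.continuous⟩ : C(K, G)))
      (fun _ _ _ => by ext; simp) (fun _ _ _ => by ext; simp)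
      (fun _ _ _ => by ext; simp) (fun _ _ _ => by ext; simp))
    1 (fun A h => by
      refine (ContinuousMap.norm_le _ (by positivity)).2 fun s => ?_
      rw [one_mul]
      exact ((A s).le_opNorm _).trans (by gcongr <;> exact ContinuousMap.norm_coe_le_norm _ s))

lemma hasFDerivAt_continuousMap_comp {F G : Type*} [NormedAddCommGroup F] [NormedSpace ℝ F]
    [NormedAddCommGroup G] [NormedSpace ℝ G] {f : C(F, G)} {f' : C(F, F →L[ℝ] G)}
    (hf : ∀ x, HasFDerivAt f (f' x) x) (γ : C(K, F)) :
    HasFDerivAt (fun γ : C(K, F) => f.comp γ) (pointwiseApplyCLM K F G (f'.comp γ)) γ := by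
  rw [hasFDerivAt_iff_isLittleO_nhds_zero, Asymptotics.isLittleO_iff]
  intro ε hε
  have hcont : Continuous fun γ : C(K, F) => f'.comp γ := ContinuousMap.continuous_postcomp f'
  obtain ⟨δ, hδ, hball⟩ := Metric.mem_nhds_iff.1
    (hcont.continuousAt.preimage_mem_nhds (Metric.ball_mem_nhds (f'.comp γ) hε))
  filter_upwards [Metric.ball_mem_nhds (0 : C(K, F)) hδ] with h hh
  rw [mem_ball_zero_iff] at hh
  rw [ContinuousMap.norm_le _ (by positivity)]
  intro s
  have hderiv_close : ∀ y ∈ segment ℝ (γ s) (γ s + h s), ‖f' y - f' (γ s)‖ ≤ ε := by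
    intro y hy
    rw [segment_eq_image'] at hy
    obtain ⟨θ, hθ, rfl⟩ := hy
    have hθh : ‖θ • h‖ < δ := by
      rw [norm_smul, Real.norm_of_nonneg hθ.1]
      exact (mul_le_of_le_one_left (norm_nonneg _) hθ.2).trans_lt hh
    have hmem : f'.comp (γ + θ • h) ∈ Metric.ball (f'.comp γ) ε :=
      hball (by simpa [dist_eq_norm] using hθh)
    simpa [dist_eq_norm] using
      (ContinuousMap.dist_apply_le_dist s).trans (Metric.mem_ball.1 hmem).le
  have hmvt := (convex_segment (𝕜 := ℝ) (γ s)
    (γ s + h s)).norm_image_sub_le_of_norm_hasFDerivWithin_le' (fun x _ => (hf x).hasFDerivWithinAt)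
    hderiv_close (left_mem_segment ℝ _ _) (right_mem_segment ℝ _ _)
  rw [add_sub_cancel_left] at hmvt
  exact hmvt.trans (mul_le_mul_of_nonneg_left (h.norm_coe_le_norm s) hε.le)

theorem contDiff_continuousMap_comp {F G : Type u} [NormedAddCommGroup F] [NormedSpace ℝ F]
    [NormedAddCommGroup G] [NormedSpace ℝ G] {n : ℕ∞} {f : C(F, G)} (hf : ContDiff ℝ n f) :
    ContDiff ℝ n (fun γ : C(K, F) => f.comp γ) := by
  suffices H : ∀ m : ℕ, ∀ (G : Type u) [NormedAddCommGroup G] [NormedSpace ℝ G] (f : C(F, G)),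
      ContDiff ℝ m f → ContDiff ℝ m (fun γ : C(K, F) => f.comp γ) from
    contDiff_iff_forall_nat_le.2 fun m hm => H m G f (hf.of_le (by exact_mod_cast hm))
  intro m
  induction m with
  | zero => exact fun G _ _ f _ => contDiff_zero.2 (ContinuousMap.continuous_postcomp f)
  | succ m ih =>
    intro G _ _ f hf
    push_cast at hf ⊢
    obtain ⟨f', hf', hderiv⟩ := contDiff_succ_iff_hasFDerivAt.1 hf
    let f'C : C(F, F →L[ℝ] G) := ⟨f', hf'.continuous⟩
    refine contDiff_succ_iff_hasFDerivAt.2 ⟨fun γ => pointwiseApplyCLM K F G (f'C.comp γ), ?_,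
      hasFDerivAt_continuousMap_comp (f' := f'C) hderiv⟩
    exact (pointwiseApplyCLM K F G).contDiff.comp (ih _ f'C hf')

end Postcomposition

section Flow

open intervalIntegral

variable {F : Type u} [NormedAddCommGroup F] [NormedSpace ℝ F]

/-- The interval `[-1, 1]`, on which integral curves are parametrized after rescaling time; being
symmetric, it makes the time `0` an interior point. -/
abbrev SymmInterval : Type := Icc (-1 : ℝ) 1

/-- A function on `[-1, 1]`, extended to the real line by constants. -/
noncomputable def extendSymm (γ : C(SymmInterval, F)) (s : ℝ) : F :=
  γ (projIcc (-1) 1 (by norm_num) s)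

omit [NormedSpace ℝ F] in
lemma continuous_extendSymm (γ : C(SymmInterval, F)) : Continuous (extendSymm γ) :=
  γ.continuous.comp continuous_projIcc

omit [NormedSpace ℝ F] in
lemma extendSymm_of_mem (γ : C(SymmInterval, F)) {s : ℝ} (hs : s ∈ Icc (-1 : ℝ) 1) :
    extendSymm γ s = γ ⟨s, hs⟩ := by
  rw [extendSymm, projIcc_of_mem]

/-- The primitive vanishing at `0` of a continuous curve parametrized by `[-1, 1]`. -/
noncomputable def primitiveCLM (F : Type*) [NormedAddCommGroup F] [NormedSpace ℝ F] :
    C(SymmInterval, F) →L[ℝ] C(SymmInterval, F) :=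
  LinearMap.mkContinuous
    { toFun := fun γ => ⟨fun s => ∫ σ in (0 : ℝ)..s, extendSymm γ σ,
        (continuous_primitive (fun _ _ => (continuous_extendSymm γ).intervalIntegrable _ _)
          0).comp continuous_subtype_val⟩
      map_add' := fun γ δ => by
        ext s
        exact integral_add ((continuous_extendSymm γ).intervalIntegrable _ _)
          ((continuous_extendSymm δ).intervalIntegrable _ _)
      map_smul' := fun c γ => by
        ext s
        exact integral_smul c _ }
    1 (fun γ => by
      refine (ContinuousMap.norm_le _ (by positivity)).2 fun s => ?_
      refine (norm_integral_le_of_norm_le_const (fun σ _ => γ.norm_coe_le_norm _)).trans ?_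
      rw [sub_zero, one_mul]
      exact mul_le_of_le_one_right (norm_nonneg _) (abs_le.2 s.2))

lemma primitiveCLM_apply (γ : C(SymmInterval, F)) (s : SymmInterval) :
    primitiveCLM F γ s = ∫ σ in (0 : ℝ)..s, extendSymm γ σ := rfl

/-- The map whose zeros `((t, z), γ)` are the rescaled integral curves `γ s = x (t s)`, `x' = X x`,
`x 0 = z`. -/
noncomputable def scaledPicard (X : C(F, F)) (w : (ℝ × F) × C(SymmInterval, F)) :
    C(SymmInterval, F) :=
  w.2 - ContinuousMap.const _ w.1.2 - w.1.1 • primitiveCLM F (X.comp w.2)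

variable {X : C(F, F)}

lemma scaledPicard_eq_zero_iff {t : ℝ} {z : F} {γ : C(SymmInterval, F)} :
    scaledPicard X ((t, z), γ) = 0 ↔
      ∀ s : SymmInterval, γ s = z + t • ∫ σ in (0 : ℝ)..s, X (extendSymm γ σ) := by
  rw [ContinuousMap.ext_iff]
  refine forall_congr' fun s => ?_
  simp only [scaledPicard, ContinuousMap.sub_apply, ContinuousMap.const_apply,
    ContinuousMap.smul_apply, ContinuousMap.zero_apply, primitiveCLM_apply]
  rw [sub_eq_zero, sub_eq_iff_eq_add']
  rfl

lemma contDiff_scaledPicard {n : ℕ∞} (hX : ContDiff ℝ n X) : ContDiff ℝ n (scaledPicard X) := by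
  have hcomp : ContDiff ℝ n fun w : (ℝ × F) × C(SymmInterval, F) => X.comp w.2 :=
    (contDiff_continuousMap_comp hX).comp contDiff_snd
  have hconst : ContDiff ℝ n fun w : (ℝ × F) × C(SymmInterval, F) =>
      ContinuousMap.const SymmInterval w.1.2 :=
    (ContinuousLinearMap.const ℝ SymmInterval : F →L[ℝ] C(SymmInterval, F)).contDiff.comp
      contDiff_fst.snd
  exact (contDiff_snd.sub hconst).sub
    (contDiff_fst.fst.smul ((primitiveCLM F).contDiff.comp hcomp))

lemma fderiv_scaledPicard_zero_comp_inr (hX : ContDiff ℝ 1 X) (z : F)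
    (γ : C(SymmInterval, F)) :
    fderiv ℝ (scaledPicard X) ((0, z), γ) ∘L .inr ℝ (ℝ × F) C(SymmInterval, F) = .id ℝ _ := by
  have hderiv := (((contDiff_scaledPicard (n := 1) hX).differentiable one_ne_zero
    ((0, z), γ)).hasFDerivAt).comp γ (hasFDerivAt_prodMk_right (𝕜 := ℝ) (0, z) γ)
  refine hderiv.unique ?_
  have hzero : (scaledPicard X ∘ fun γ => ((0, z), γ)) =
      fun γ : C(SymmInterval, F) => γ - ContinuousMap.const _ z := by
    funext γ
    simp [scaledPicard]
  rw [hzero]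
  exact (hasFDerivAt_id γ).sub_const _

/-- Multiplication by a number of `[-1, 1]`, as a map of `[-1, 1]` to itself. -/
def symmScale (s : SymmInterval) : C(SymmInterval, SymmInterval) :=
  ⟨fun σ => ⟨s * σ, abs_le.1 (by
    rw [abs_mul]; exact mul_le_one₀ (abs_le.2 s.2) (abs_nonneg _) (abs_le.2 σ.2))⟩, by fun_prop⟩

lemma scaledPicard_comp_symmScale {t : ℝ} {z : F} {γ : C(SymmInterval, F)}
    (hγ : scaledPicard X ((t, z), γ) = 0) (s : SymmInterval) :
    scaledPicard X ((s * t, z), γ.comp (symmScale s)) = 0 := by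
  rw [scaledPicard_eq_zero_iff] at hγ ⊢
  intro σ
  have hscale : EqOn (fun τ => X (extendSymm (γ.comp (symmScale s)) τ))
      (fun τ => X (extendSymm γ (s * τ))) (uIcc 0 (σ : ℝ)) := by
    intro τ hτ
    have hτ' : τ ∈ Icc (-1 : ℝ) 1 :=
      uIcc_subset_Icc (by norm_num : (0 : ℝ) ∈ Icc (-1 : ℝ) 1) σ.2 hτ
    simp only [extendSymm_of_mem _ hτ', ContinuousMap.comp_apply]
    rw [show (s : ℝ) * τ = (symmScale s ⟨τ, hτ'⟩ : ℝ) from rfl,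
      extendSymm_of_mem γ (symmScale s ⟨τ, hτ'⟩).2]
  rw [integral_congr hscale, mul_comm, mul_smul,
    smul_integral_comp_mul_left (fun τ => X (extendSymm γ τ)), mul_zero]
  exact hγ (symmScale s σ)

lemma hasDerivAt_of_scaledPicard_eq_zero [CompleteSpace F] {t : ℝ} {z : F}
    {γ : C(SymmInterval, F)} (hγ : scaledPicard X ((t, z), γ) = 0) {s : ℝ}
    (hs : s ∈ Ioo (-1 : ℝ) 1) :
    HasDerivAt (extendSymm γ) (t • X (extendSymm γ s)) s := by
  have hint : HasDerivAt (fun s => z + t • ∫ σ in (0 : ℝ)..s, X (extendSymm γ σ))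
      (t • X (extendSymm γ s)) s :=
    ((integral_hasDerivAt_right
      ((X.continuous.comp (continuous_extendSymm γ)).intervalIntegrable _ _)
      ((X.continuous.comp (continuous_extendSymm γ)).stronglyMeasurableAtFilter _ _)
      (X.continuous.comp (continuous_extendSymm γ)).continuousAt).const_smul t).const_add z
  refine hint.congr_of_eventuallyEq ?_
  filter_upwards [Ioo_mem_nhds hs.1 hs.2] with σ hσ
  rw [extendSymm_of_mem γ (Ioo_subset_Icc_self hσ)]
  exact scaledPicard_eq_zero_iff.1 hγ _

/-- The implicit function theorem solves for the rescaled integral curves; its local uniqueness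
makes all of them reparametrizations of the same flow. -/
theorem exists_scaled_integralCurves [CompleteSpace F] {n : ℕ∞} (hn : 1 ≤ n)
    (hX : ContDiff ℝ n X) (z₀ : F) :
    ∃ ψ : ℝ × F → C(SymmInterval, F), ∀ᶠ p in 𝓝 ((0 : ℝ), z₀),
      ContDiffAt ℝ n ψ p ∧ scaledPicard X (p, ψ p) = 0 ∧
        ∀ s : SymmInterval, ψ (s * p.1, p.2) = (ψ p).comp (symmScale s) := by
  set u : (ℝ × F) × C(SymmInterval, F) := ((0, z₀), ContinuousMap.const _ z₀)
  obtain ⟨ψ, hψu, hψ, hunique⟩ := exists_implicitFunction_eventually_contDiffAt hn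
    (contDiff_scaledPicard hX) (u := u) (by ext; simp [scaledPicard, u])
    (by
      rw [fderiv_scaledPicard_zero_comp_inr (hX.of_le (by exact_mod_cast hn))]
      exact ContinuousLinearMap.isInvertible_equiv (f := .refl ℝ _))
  obtain ⟨η, hη, hball⟩ := Metric.eventually_nhds_iff_ball.1 hunique
  have hclose : ∀ᶠ p in 𝓝 ((0 : ℝ), z₀), ψ p ∈ Metric.ball (ContinuousMap.const _ z₀) η :=
    hψ.self_of_nhds.1.continuousAt.eventually_mem
      (by rw [hψu]; exact Metric.ball_mem_nhds _ hη)
  refine ⟨ψ, ?_⟩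
  filter_upwards [hψ, hclose, Metric.ball_mem_nhds ((0 : ℝ), z₀) hη]
    with p ⟨hsmooth, hzero⟩ hpψ hp
  refine ⟨hsmooth, hzero, fun s => hball ((s * p.1, p.2), (ψ p).comp (symmScale s)) ?_
    (scaledPicard_comp_symmScale hzero s)⟩
  have hcurve : dist ((ψ p).comp (symmScale s)) (ContinuousMap.const _ z₀) < η :=
    ((ContinuousMap.dist_le dist_nonneg).2 fun σ =>
      ContinuousMap.dist_apply_le_dist (f := ψ p) (g := .const _ z₀) (symmScale s σ)).trans_lt hpψ
  have htime : |(s : ℝ) * p.1| ≤ |p.1| := by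
    rw [abs_mul]
    exact mul_le_of_le_one_left (abs_nonneg _) (abs_le.2 s.2)
  simp only [u, Metric.mem_ball, Prod.dist_eq, max_lt_iff, Real.dist_0_eq_abs] at hp ⊢
  exact ⟨⟨htime.trans_lt hp.1, hp.2⟩, hcurve⟩

theorem exists_contDiffAt_flow [CompleteSpace F] {n : ℕ∞} (hn : 1 ≤ n) {X : F → F}
    (hX : ContDiff ℝ n X) (z₀ : F) :
    ∃ φ : ℝ × F → F, ∀ᶠ p in 𝓝 ((0 : ℝ), z₀), ContDiffAt ℝ n φ p ∧ φ (0, p.2) = p.2 ∧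
      HasDerivAt (fun t => φ (t, p.2)) (X (φ p)) p.1 := by
  obtain ⟨ψ, hψ⟩ := exists_scaled_integralCurves (X := ⟨X, hX.continuous⟩) hn hX z₀
  obtain ⟨ε, hε, hball⟩ := Metric.eventually_nhds_iff_ball.1 hψ
  let φ : ℝ × F → F := fun p => ψ p ⟨1, by norm_num⟩
  have hφψ : ∀ p ∈ Metric.ball ((0 : ℝ), z₀) ε, ∀ s : SymmInterval,
      φ (s * p.1, p.2) = ψ p s := by
    intro p hp s
    change ψ (s * p.1, p.2) _ = _
    rw [(hball p hp).2.2 s, ContinuousMap.comp_apply]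
    exact congrArg (ψ p) (Subtype.ext (mul_one _))
  refine ⟨φ, ?_⟩
  filter_upwards [Metric.ball_mem_nhds ((0 : ℝ), z₀) (half_pos hε)] with ⟨t, z⟩ hp
  rw [Metric.mem_ball, Prod.dist_eq, max_lt_iff, Real.dist_0_eq_abs] at hp
  obtain ⟨ht : |t| < ε / 2, hz : dist z z₀ < ε / 2⟩ := hp
  have hp : (ε / 2, z) ∈ Metric.ball ((0 : ℝ), z₀) ε := by
    rw [Metric.mem_ball, Prod.dist_eq, max_lt_iff, Real.dist_0_eq_abs, abs_of_pos (half_pos hε)]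
    exact ⟨half_lt_self hε, hz.trans (half_lt_self hε)⟩
  have hscaled : ∀ τ, |τ| < ε / 2 → τ / (ε / 2) ∈ Ioo (-1 : ℝ) 1 := fun τ hτ => by
    rwa [mem_Ioo, ← abs_lt, abs_div, abs_of_pos (half_pos hε), div_lt_one (half_pos hε)]
  have hφ : ∀ τ, |τ| < ε / 2 → φ (τ, z) = extendSymm (ψ (ε / 2, z)) (τ / (ε / 2)) := by
    intro τ hτ
    rw [extendSymm_of_mem _ (Ioo_subset_Icc_self (hscaled τ hτ)), ← hφψ _ hp]
    simp only [div_mul_cancel₀ _ (half_pos hε).ne']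
  refine ⟨?_, ?_, ?_⟩
  · have hmem : (t, z) ∈ Metric.ball ((0 : ℝ), z₀) ε := by
      rw [Metric.mem_ball, Prod.dist_eq, max_lt_iff, Real.dist_0_eq_abs]
      exact ⟨ht.trans (half_lt_self hε), hz.trans (half_lt_self hε)⟩
    exact (ContinuousMap.evalCLM ℝ (⟨1, by norm_num⟩ : SymmInterval)).contDiff.contDiffAt.comp _
      (hball _ hmem).1
  · have hzero := scaledPicard_eq_zero_iff.1 (hball _ hp).2.1 ⟨0, by norm_num⟩
    simpa [← hφψ _ hp] using hzero
  · have hcurve := (hasDerivAt_of_scaledPicard_eq_zero (hball _ hp).2.1 (hscaled t ht)).scomp t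
      ((hasDerivAt_id' t).div_const (ε / 2))
    rw [smul_smul, one_div_mul_cancel (half_pos hε).ne', one_smul] at hcurve
    simp only [hφ t ht]
    refine hcurve.congr_of_eventuallyEq ?_
    filter_upwards [(continuous_abs.tendsto t).eventually_lt_const ht] with τ hτ
    exact hφ τ hτ

end Flow

section Evolution

variable {F : Type u} [NormedAddCommGroup F] [NormedSpace ℝ F]

lemma exists_contDiff_eventuallyEq [FiniteDimensional ℝ F] {G : Type*}
    [NormedAddCommGroup G] [NormedSpace ℝ G] {n : ℕ∞} {X : F → G} {z₀ : F}
    (hX : ∀ᶠ z in 𝓝 z₀, ContDiffAt ℝ n X z) :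
    ∃ Y : F → G, ContDiff ℝ n Y ∧ Y =ᶠ[𝓝 z₀] X := by
  obtain ⟨R, hR, hball⟩ := Metric.eventually_nhds_iff_ball.1 hX
  let χ : ContDiffBump z₀ := ⟨R / 4, R / 2, by positivity, by linarith⟩
  refine ⟨fun z => χ z • X z, contDiff_iff_contDiffAt.2 fun z => ?_, ?_⟩
  · by_cases hz : z ∈ Metric.ball z₀ R
    · exact χ.contDiff.contDiffAt.smul (hball z hz)
    · have hsupp : z ∉ tsupport χ := fun h => hz <|
        Metric.closedBall_subset_ball (half_lt_self hR) (χ.tsupport_eq ▸ h)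
      refine contDiffAt_const (c := (0 : G)) |>.congr_of_eventuallyEq ?_
      filter_upwards [notMem_tsupport_iff_eventuallyEq.1 hsupp] with w hw
      simp [hw]
  · filter_upwards [χ.eventuallyEq_one] with z hz
    simp [hz]

lemma eq_add_of_hasDerivAt_one {c : ℝ → ℝ} {ε : ℝ}
    (hc : ∀ σ ∈ Metric.ball (0 : ℝ) ε, HasDerivAt c 1 σ) {τ : ℝ} (hτ : τ ∈ Metric.ball (0 : ℝ) ε) :
    c τ = c 0 + τ := by
  have hderiv : ∀ σ ∈ Metric.ball (0 : ℝ) ε, HasDerivAt (fun σ => c σ - σ) 0 σ := fun σ hσ =>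
    ((hc σ hσ).sub (hasDerivAt_id' σ)).congr_deriv (sub_self 1)
  have hconst := Metric.isOpen_ball.is_const_of_deriv_eq_zero
    (convex_ball (0 : ℝ) ε).isPreconnected
    (fun σ hσ => (hderiv σ hσ).differentiableAt.differentiableWithinAt)
    (fun σ hσ => (hderiv σ hσ).deriv) hτ (Metric.mem_ball_self (Metric.pos_of_mem_ball hτ))
  rwa [sub_zero, sub_eq_iff_eq_add] at hconst

theorem exists_contDiffAt_evolution [FiniteDimensional ℝ F] {n : ℕ∞} (hn : 1 ≤ n)
    {f : ℝ × F → F} {t₀ : ℝ} {x₀ : F} (hf : ∀ᶠ z in 𝓝 (t₀, x₀), ContDiffAt ℝ n f z) :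
    ∃ φ : ℝ × ℝ × F → F, ∀ᶠ p in 𝓝 (t₀, t₀, x₀), ContDiffAt ℝ n φ p ∧
      φ (p.2.1, p.2) = p.2.2 ∧ HasDerivAt (fun s => φ (s, p.2)) (f (p.1, φ p)) p.1 := by
  have hcomplete := FiniteDimensional.complete ℝ F
  obtain ⟨g, hg, hgf⟩ := exists_contDiff_eventuallyEq hf
  obtain ⟨Φ, hΦ⟩ := exists_contDiffAt_flow hn
    (X := fun z : ℝ × F => ((1 : ℝ), g z)) (contDiff_const.prodMk hg) (t₀, x₀)
  obtain ⟨ε, hε, hball⟩ := Metric.eventually_nhds_iff_ball.1 hΦ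
  have htime : ∀ p ∈ Metric.ball ((0 : ℝ), t₀, x₀) ε, (Φ p).1 = p.2.1 + p.1 := by
    rintro ⟨τ, z⟩ hp
    rw [← ball_prod_same] at hp
    have hz : ∀ σ ∈ Metric.ball (0 : ℝ) ε, (σ, z) ∈ Metric.ball ((0 : ℝ), t₀, x₀) ε := by
      rw [← ball_prod_same]
      exact fun σ hσ => ⟨hσ, hp.2⟩
    have hclock := eq_add_of_hasDerivAt_one (c := fun σ => (Φ (σ, z)).1) (fun σ hσ =>
      (ContinuousLinearMap.fst ℝ ℝ F).hasFDerivAt.comp_hasDerivAt σ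
        (hball _ (hz σ hσ)).2.2) hp.1
    simpa only [(hball _ (hz 0 (Metric.mem_ball_self hε))).2.1] using hclock
  let shift : ℝ × ℝ × F → ℝ × ℝ × F := fun p => (p.1 - p.2.1, p.2)
  have hshift : ContDiff ℝ n shift := by fun_prop
  have hshift_tendsto : Tendsto shift (𝓝 (t₀, t₀, x₀)) (𝓝 (0, t₀, x₀)) := by
    simpa [shift] using hshift.continuous.tendsto (t₀, t₀, x₀)
  have hbase : Φ (0, t₀, x₀) = (t₀, x₀) := (hball _ (Metric.mem_ball_self hε)).2.1
  have hΦ_tendsto : Tendsto (Φ ∘ shift) (𝓝 (t₀, t₀, x₀)) (𝓝 (t₀, x₀)) := by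
    have hcont := (hball _ (Metric.mem_ball_self hε)).1.continuousAt
    rw [ContinuousAt, hbase] at hcont
    exact hcont.comp hshift_tendsto
  refine ⟨fun p => (Φ (shift p)).2, ?_⟩
  filter_upwards [hshift_tendsto.eventually (Metric.ball_mem_nhds _ hε),
    hshift_tendsto.eventually hΦ, hΦ_tendsto.eventually hgf] with p hp ⟨hsmooth, hinit, hderiv⟩ hfp
  have hgraph : Φ (shift p) = (p.1, (Φ (shift p)).2) :=
    Prod.ext ((htime _ hp).trans (add_sub_cancel _ _)) rfl
  refine ⟨(hsmooth.comp p hshift.contDiffAt).snd, ?_, ?_⟩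
  · simp only [shift, sub_self]
    exact congrArg Prod.snd hinit
  · rw [← hgraph]
    refine ((ContinuousLinearMap.snd ℝ ℝ F).hasFDerivAt.comp_hasDerivAt p.1
      (hderiv.comp_sub_const p.1 p.2.1)).congr_deriv ?_
    exact hfp

end Evolution

section MixedDerivatives

variable {E G : Type*} [NormedAddCommGroup E] [NormedSpace ℝ E] [NormedAddCommGroup G]
  [NormedSpace ℝ G]

lemma tendstoUniformlyOnFilter_slope_of_hasStrictFDerivAt {g : E → G} {g' : E →L[ℝ] G} {z₀ : E}
    (hg : HasStrictFDerivAt g g' z₀) (ξ : E) :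
    TendstoUniformlyOnFilter (fun (l : ℝ) z => l⁻¹ • (g (z + l • ξ) - g z)) (fun _ => g' ξ)
      (𝓝[≠] 0) (𝓝 z₀) := by
  rw [Metric.tendstoUniformlyOnFilter_iff]
  intro ε hε
  have hpair : Tendsto (fun w : ℝ × E => (w.2 + w.1 • ξ, w.2)) (𝓝[≠] 0 ×ˢ 𝓝 z₀) (𝓝 (z₀, z₀)) := by
    have hcont : Continuous fun w : ℝ × E => (w.2 + w.1 • ξ, w.2) := by fun_prop
    refine Tendsto.mono_left ?_ (Filter.prod_mono nhdsWithin_le_nhds le_rfl)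
    simpa [nhds_prod_eq] using hcont.tendsto ((0 : ℝ), z₀)
  have hclose := (hg.isLittleO.comp_tendsto hpair).def
    (show (0 : ℝ) < ε / (‖ξ‖ + 1) by positivity)
  filter_upwards [hclose, tendsto_fst.eventually self_mem_nhdsWithin] with ⟨l, z⟩ hlz hl
  simp only [Function.comp_apply, add_sub_cancel_left, map_smul, norm_smul] at hlz
  have hl_pos : 0 < ‖l‖ := norm_pos_iff.2 hl
  have hsplit : l⁻¹ • (g (z + l • ξ) - g z) - g' ξ =
      l⁻¹ • (g (z + l • ξ) - g z - l • g' ξ) := by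
    rw [smul_sub l⁻¹ (_ - _), inv_smul_smul₀ hl]
  rw [dist_comm, dist_eq_norm, hsplit, norm_smul, norm_inv, inv_mul_lt_iff₀ hl_pos]
  refine hlz.trans_lt ?_
  have hε_bound : ε / (‖ξ‖ + 1) * ‖ξ‖ < ε := by
    rw [div_mul_eq_mul_div, div_lt_iff₀ (by positivity)]
    nlinarith
  nlinarith

lemma hasDerivAt_fderiv_apply_snd {y h : ℝ × E → G} {t : ℝ} {x : E}
    (hy : ∀ᶠ z in 𝓝 (t, x), DifferentiableAt ℝ y z)
    (hyh : ∀ᶠ z in 𝓝 (t, x), HasDerivAt (fun s => y (s, z.2)) (h z) z.1)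
    (hh : ContDiffAt ℝ 1 h (t, x)) (ξ : E) :
    HasDerivAt (fun s => fderiv ℝ y (s, x) (0, ξ)) (fderiv ℝ h (t, x) (0, ξ)) t := by
  have hslice : Tendsto (fun s : ℝ => (s, x)) (𝓝 t) (𝓝 (t, x)) :=
    (by fun_prop : Continuous fun s : ℝ => (s, x)).tendsto t
  refine hasDerivAt_of_tendstoUniformlyOnFilter (l := 𝓝[≠] (0 : ℝ))
    (f := fun l s => l⁻¹ • (y ((s, x) + l • (0, ξ)) - y (s, x)))
    (f' := fun l s => l⁻¹ • (h ((s, x) + l • (0, ξ)) - h (s, x)))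
    (g' := fun _ => fderiv ℝ h (t, x) (0, ξ)) ?_ ?_ ?_
  · exact ((tendstoUniformlyOnFilter_slope_of_hasStrictFDerivAt
      (hh.hasStrictFDerivAt one_ne_zero) (0, ξ)).comp fun s : ℝ => (s, x)).mono_right
        (map_le_iff_le_comap.1 hslice)
  · have hshift : Tendsto (fun w : ℝ × ℝ => ((w.2, x) : ℝ × E) + w.1 • (0, ξ))
        (𝓝[≠] 0 ×ˢ 𝓝 t) (𝓝 (t, x)) := by
      have hcont : Continuous fun w : ℝ × ℝ => ((w.2, x) : ℝ × E) + w.1 • ((0 : ℝ), ξ) := by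
        fun_prop
      refine Tendsto.mono_left ?_ (Filter.prod_mono nhdsWithin_le_nhds le_rfl)
      simpa [nhds_prod_eq] using hcont.tendsto ((0 : ℝ), t)
    filter_upwards [hshift.eventually hyh, (hslice.comp tendsto_snd).eventually hyh]
      with w hw_shift hw
    simp only [Prod.smul_mk, Prod.mk_add_mk, smul_zero, add_zero] at hw_shift ⊢
    exact (hw_shift.sub hw).const_smul w.1⁻¹
  · filter_upwards [hslice.eventually hy] with s hs
    exact (hs.hasFDerivAt.hasLineDerivAt (0, ξ)).tendsto_slope_zero

end MixedDerivatives

/-! ### The method of characteristics -/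

section HamiltonJacobi

variable {E : Type u} [NormedAddCommGroup E] [NormedSpace ℝ E]

/-- The canonical 1-form `p dq - h dt` on `ℝ × E`. -/
noncomputable def canonicalForm (p : E →L[ℝ] ℝ) (h : ℝ) : ℝ × E →L[ℝ] ℝ :=
  p ∘L .snd ℝ ℝ E - h • .fst ℝ ℝ E

lemma canonicalForm_apply (p : E →L[ℝ] ℝ) (h : ℝ) (v : ℝ × E) :
    canonicalForm p h v = p v.2 - h * v.1 := by simp [canonicalForm]

lemma fderiv_apply_one_zero {G : Type*} [NormedAddCommGroup G] [NormedSpace ℝ G]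
    {g : ℝ × E → G} {g' : G} {z : ℝ × E} (hg : DifferentiableAt ℝ g z)
    (hg' : HasDerivAt (fun s => g (s, z.2)) g' z.1) : fderiv ℝ g z (1, 0) = g' :=
  (hg.hasFDerivAt.comp_hasDerivAt z.1
    ((hasDerivAt_id z.1).prodMk (hasDerivAt_const z.1 z.2))).unique hg'

lemma fderiv_apply_zero_prodMk {G : Type*} [NormedAddCommGroup G] [NormedSpace ℝ G]
    {g : ℝ × E → G} {g₀ : E → G} {g₀' : E →L[ℝ] G} {t : ℝ} {x : E}
    (hg : DifferentiableAt ℝ g (t, x)) (hg₀ : (fun y => g (t, y)) =ᶠ[𝓝 x] g₀)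
    (hg₀' : HasFDerivAt g₀ g₀' x) (ξ : E) : fderiv ℝ g (t, x) (0, ξ) = g₀' ξ := by
  have hslice := hg.hasFDerivAt.comp x (hasFDerivAt_prodMk_right (𝕜 := ℝ) t x)
  exact congrArg (fun L => L ξ) (hslice.unique (hg₀'.congr_of_eventuallyEq hg₀))

lemma map_prodMk_eq_smul_add {G : Type*} [NormedAddCommGroup G] [NormedSpace ℝ G]
    (L : ℝ × E →L[ℝ] G) (τ : ℝ) (ξ : E) : L (τ, ξ) = τ • L (1, 0) + L (0, ξ) := by
  rw [← map_smul, ← map_add]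
  simp

/-- The derivative of a function on phase space `ℝ × E × E*` in the position variable. -/
noncomputable def positionDeriv (H : ℝ × E × (E →L[ℝ] ℝ) → ℝ) (w : ℝ × E × (E →L[ℝ] ℝ)) :
    E →L[ℝ] ℝ :=
  fderiv ℝ H w ∘L .inr ℝ ℝ _ ∘L .inl ℝ E _

/-- `H` is a time dependent Hamiltonian of class `C^(m+1)` on the open subset `W` of phase space
and `v` is its derivative in the momentum, seen as a vector rather than as a covector on `E*`. -/
structure IsHamiltonianOn (m : ℕ∞) (W : Set (ℝ × E × (E →L[ℝ] ℝ)))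
    (H : ℝ × E × (E →L[ℝ] ℝ) → ℝ) (v : ℝ × E × (E →L[ℝ] ℝ) → E) : Prop where
  isOpen : IsOpen W
  contDiffOn : ContDiffOn ℝ (m + 1) H W
  contDiffOn_velocity : ContDiffOn ℝ m v W
  fderiv_momentum : ∀ w ∈ W, ∀ π, fderiv ℝ H w (0, 0, π) = π (v w)

/-- The graph of the family of curves `(q, p)` in phase space. -/
def phaseLift (q : ℝ × E → E) (p : ℝ × E → E →L[ℝ] ℝ) (z : ℝ × E) : ℝ × E × (E →L[ℝ] ℝ) :=
  (z.1, q z, p z)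

/-- The curves `s ↦ (q (s, x), p (s, x))`, for `x` near `x₀`, solve Hamilton's equations and leave
the zero section at time `t₀`; `U (s, x)` is the action along them. -/
structure IsHamiltonianFamily (m : ℕ∞) (W : Set (ℝ × E × (E →L[ℝ] ℝ)))
    (H : ℝ × E × (E →L[ℝ] ℝ) → ℝ) (v : ℝ × E × (E →L[ℝ] ℝ) → E) (t₀ : ℝ) (x₀ : E) (ε : ℝ)
    (q : ℝ × E → E) (p : ℝ × E → E →L[ℝ] ℝ) (U : ℝ × E → ℝ) : Prop where
  contDiffAt_q : ∀ z ∈ Metric.ball (t₀, x₀) ε, ContDiffAt ℝ m q z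
  contDiffAt_p : ∀ z ∈ Metric.ball (t₀, x₀) ε, ContDiffAt ℝ m p z
  contDiffAt_U : ∀ z ∈ Metric.ball (t₀, x₀) ε, ContDiffAt ℝ m U z
  phaseLift_mem : ∀ z ∈ Metric.ball (t₀, x₀) ε, phaseLift q p z ∈ W
  q_initial : ∀ x ∈ Metric.ball x₀ ε, q (t₀, x) = x
  p_initial : ∀ x ∈ Metric.ball x₀ ε, p (t₀, x) = 0
  U_initial : ∀ x ∈ Metric.ball x₀ ε, U (t₀, x) = 0
  hasDerivAt_q : ∀ z ∈ Metric.ball (t₀, x₀) ε,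
    HasDerivAt (fun s => q (s, z.2)) (v (phaseLift q p z)) z.1
  hasDerivAt_p : ∀ z ∈ Metric.ball (t₀, x₀) ε,
    HasDerivAt (fun s => p (s, z.2)) (-positionDeriv H (phaseLift q p z)) z.1
  hasDerivAt_U : ∀ z ∈ Metric.ball (t₀, x₀) ε,
    HasDerivAt (fun s => U (s, z.2)) (p z (v (phaseLift q p z)) - H (phaseLift q p z)) z.1

/-- Hamilton's equations together with the evolution of the action. -/
noncomputable def hamiltonActionField (H : ℝ × E × (E →L[ℝ] ℝ) → ℝ)
    (v : ℝ × E × (E →L[ℝ] ℝ) → E) (w : ℝ × E × (E →L[ℝ] ℝ) × ℝ) : E × (E →L[ℝ] ℝ) × ℝ :=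
  (v (w.1, w.2.1, w.2.2.1), -positionDeriv H (w.1, w.2.1, w.2.2.1),
    w.2.2.1 (v (w.1, w.2.1, w.2.2.1)) - H (w.1, w.2.1, w.2.2.1))

variable {m : ℕ∞} {W : Set (ℝ × E × (E →L[ℝ] ℝ))} {H : ℝ × E × (E →L[ℝ] ℝ) → ℝ}
  {v : ℝ × E × (E →L[ℝ] ℝ) → E} {t₀ : ℝ} {x₀ : E}

lemma IsHamiltonianOn.contDiffAt_hamiltonActionField (hH : IsHamiltonianOn m W H v)
    {w : ℝ × E × (E →L[ℝ] ℝ) × ℝ} (hw : (w.1, w.2.1, w.2.2.1) ∈ W) :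
    ContDiffAt ℝ m (hamiltonActionField H v) w := by
  have hproj : ContDiffAt ℝ m
      (fun w : ℝ × E × (E →L[ℝ] ℝ) × ℝ => (w.1, w.2.1, w.2.2.1)) w := by fun_prop
  have hmomentum : ContDiffAt ℝ m (fun w : ℝ × E × (E →L[ℝ] ℝ) × ℝ => w.2.2.1) w := by fun_prop
  have hWw := hH.isOpen.mem_nhds hw
  have hH_at := hH.contDiffOn.contDiffAt hWw
  have hv := (hH.contDiffOn_velocity.contDiffAt hWw).comp w hproj
  have hforce : ContDiffAt ℝ m (positionDeriv H) (w.1, w.2.1, w.2.2.1) :=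
    (hH_at.fderiv_right le_rfl).clm_comp contDiffAt_const
  exact hv.prodMk ((hforce.comp w hproj).neg.prodMk ((hmomentum.clm_apply hv).sub
    ((hH_at.of_le (by exact_mod_cast le_self_add)).comp w hproj)))

theorem IsHamiltonianOn.exists_isHamiltonianFamily [FiniteDimensional ℝ E] (hm : 1 ≤ m)
    (hH : IsHamiltonianOn m W H v) (h₀ : (t₀, x₀, 0) ∈ W) :
    ∃ ε > 0, ∃ q p U, IsHamiltonianFamily m W H v t₀ x₀ ε q p U := by
  have hW_near : ∀ᶠ w : ℝ × E × (E →L[ℝ] ℝ) × ℝ in 𝓝 (t₀, x₀, 0, 0),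
      (w.1, w.2.1, w.2.2.1) ∈ W :=
    (by fun_prop : Continuous fun w : ℝ × E × (E →L[ℝ] ℝ) × ℝ =>
      (w.1, w.2.1, w.2.2.1)).continuousAt.eventually_mem (hH.isOpen.mem_nhds h₀)
  obtain ⟨φ, hφ⟩ := exists_contDiffAt_evolution hm
    (hW_near.mono fun w hw => hH.contDiffAt_hamiltonActionField hw)
  let ι : ℝ × E → ℝ × ℝ × E × (E →L[ℝ] ℝ) × ℝ := fun z => (z.1, t₀, z.2, 0, 0)
  have hι : ContDiff ℝ m ι := by fun_prop
  have hι_tendsto : Tendsto ι (𝓝 (t₀, x₀)) (𝓝 (t₀, t₀, x₀, 0, 0)) :=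
    hι.continuous.tendsto (t₀, x₀)
  have hW_along : ∀ᶠ z in 𝓝 (t₀, x₀), (z.1, (φ (ι z)).1, (φ (ι z)).2.1) ∈ W := by
    have hcont := hφ.self_of_nhds.1.continuousAt
    rw [ContinuousAt, hφ.self_of_nhds.2.1] at hcont
    exact (continuousAt_fst.tendsto.prodMk_nhds (hcont.comp hι_tendsto)).eventually hW_near
  obtain ⟨ε, hε, hball⟩ := Metric.eventually_nhds_iff_ball.1
    ((hι_tendsto.eventually hφ).and hW_along)
  have hinit : ∀ x ∈ Metric.ball x₀ ε, φ (ι (t₀, x)) = (x, 0, 0) := fun x hx =>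
    (hball (t₀, x) (by rw [← ball_prod_same]; exact ⟨Metric.mem_ball_self hε, hx⟩)).1.2.1
  have hsmooth : ∀ z ∈ Metric.ball (t₀, x₀) ε, ContDiffAt ℝ m (fun z => φ (ι z)) z :=
    fun z hz => (hball z hz).1.1.comp z hι.contDiffAt
  have hderiv : ∀ z ∈ Metric.ball (t₀, x₀) ε, HasDerivAt (fun s => φ (ι (s, z.2)))
      (hamiltonActionField H v (z.1, φ (ι z))) z.1 := fun z hz => (hball z hz).1.2.2
  exact ⟨ε, hε, fun z => (φ (ι z)).1, fun z => (φ (ι z)).2.1, fun z => (φ (ι z)).2.2,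
    { contDiffAt_q := fun z hz => (hsmooth z hz).fst
      contDiffAt_p := fun z hz => (hsmooth z hz).snd.fst
      contDiffAt_U := fun z hz => (hsmooth z hz).snd.snd
      phaseLift_mem := fun z hz => (hball z hz).2
      q_initial := fun x hx => by simp [hinit x hx]
      p_initial := fun x hx => by simp [hinit x hx]
      U_initial := fun x hx => by simp [hinit x hx]
      hasDerivAt_q := fun z hz => (ContinuousLinearMap.fst ℝ E
        ((E →L[ℝ] ℝ) × ℝ)).hasFDerivAt.comp_hasDerivAt z.1 (hderiv z hz)
      hasDerivAt_p := fun z hz => (ContinuousLinearMap.fst ℝ (E →L[ℝ] ℝ) ℝ ∘L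
        ContinuousLinearMap.snd ℝ E _).hasFDerivAt.comp_hasDerivAt z.1 (hderiv z hz)
      hasDerivAt_U := fun z hz => (ContinuousLinearMap.snd ℝ (E →L[ℝ] ℝ) ℝ ∘L
        ContinuousLinearMap.snd ℝ E _).hasFDerivAt.comp_hasDerivAt z.1 (hderiv z hz) }⟩

namespace IsHamiltonianFamily

variable {ε : ℝ} {q : ℝ × E → E} {p : ℝ × E → E →L[ℝ] ℝ} {U : ℝ × E → ℝ}

lemma contDiffAt_phaseLift (hF : IsHamiltonianFamily m W H v t₀ x₀ ε q p U) {z : ℝ × E}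
    (hz : z ∈ Metric.ball (t₀, x₀) ε) : ContDiffAt ℝ m (phaseLift q p) z :=
  contDiffAt_fst.prodMk ((hF.contDiffAt_q z hz).prodMk (hF.contDiffAt_p z hz))

lemma contDiffAt_velocity (hF : IsHamiltonianFamily m W H v t₀ x₀ ε q p U)
    (hH : IsHamiltonianOn m W H v) {z : ℝ × E} (hz : z ∈ Metric.ball (t₀, x₀) ε) :
    ContDiffAt ℝ m (fun z => v (phaseLift q p z)) z :=
  (hH.contDiffOn_velocity.contDiffAt (hH.isOpen.mem_nhds (hF.phaseLift_mem z hz))).comp z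
    (hF.contDiffAt_phaseLift hz)

lemma contDiffAt_lagrangian (hF : IsHamiltonianFamily m W H v t₀ x₀ ε q p U)
    (hH : IsHamiltonianOn m W H v) {z : ℝ × E} (hz : z ∈ Metric.ball (t₀, x₀) ε) :
    ContDiffAt ℝ m (fun z => p z (v (phaseLift q p z)) - H (phaseLift q p z)) z :=
  ((hF.contDiffAt_p z hz).clm_apply (hF.contDiffAt_velocity hH hz)).sub
    (((hH.contDiffOn.contDiffAt (hH.isOpen.mem_nhds (hF.phaseLift_mem z hz))).of_le
      (by exact_mod_cast le_self_add)).comp z (hF.contDiffAt_phaseLift hz))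

/-- The terms with the derivative of the momentum cancel, because `v` is the derivative of `H` in
the momentum. -/
lemma fderiv_lagrangian_apply (hF : IsHamiltonianFamily m W H v t₀ x₀ ε q p U) (hm : 1 ≤ m)
    (hH : IsHamiltonianOn m W H v) {z : ℝ × E} (hz : z ∈ Metric.ball (t₀, x₀) ε) (ξ : E) :
    fderiv ℝ (fun z => p z (v (phaseLift q p z)) - H (phaseLift q p z)) z (0, ξ) =
      p z (fderiv ℝ (fun z => v (phaseLift q p z)) z (0, ξ)) -
        positionDeriv H (phaseLift q p z) (fderiv ℝ q z (0, ξ)) := by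
  have hm₀ : (m : WithTop ℕ∞) ≠ 0 := by exact_mod_cast (zero_lt_one.trans_le hm).ne'
  have hq := ((hF.contDiffAt_q z hz).differentiableAt hm₀).hasFDerivAt
  have hp := ((hF.contDiffAt_p z hz).differentiableAt hm₀).hasFDerivAt
  have hv := ((hF.contDiffAt_velocity hH hz).differentiableAt hm₀).hasFDerivAt
  have hHd := ((hH.contDiffOn.contDiffAt (hH.isOpen.mem_nhds
    (hF.phaseLift_mem z hz))).differentiableAt (by simp)).hasFDerivAt
  have hL : HasFDerivAt (fun z => p z (v (phaseLift q p z)) - H (phaseLift q p z)) _ z :=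
    (hp.clm_apply hv).sub (hHd.comp z (hasFDerivAt_fst.prodMk (hq.prodMk hp)))
  have hH_split : fderiv ℝ H (phaseLift q p z) (0, fderiv ℝ q z (0, ξ), fderiv ℝ p z (0, ξ)) =
      positionDeriv H (phaseLift q p z) (fderiv ℝ q z (0, ξ)) +
        fderiv ℝ p z (0, ξ) (v (phaseLift q p z)) := by
    rw [← hH.fderiv_momentum _ (hF.phaseLift_mem z hz), positionDeriv,
      ContinuousLinearMap.comp_apply, ContinuousLinearMap.comp_apply, ← map_add]
    simp
  rw [hL.fderiv]
  simp only [sub_apply, add_apply, ContinuousLinearMap.comp_apply,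
    ContinuousLinearMap.flip_apply, ContinuousLinearMap.prod_apply, ContinuousLinearMap.coe_fst']
  rw [hH_split]
  ring

lemma hasDerivAt_fderiv_action_sub (hF : IsHamiltonianFamily m W H v t₀ x₀ ε q p U) (hm : 1 ≤ m)
    (hH : IsHamiltonianOn m W H v) {z : ℝ × E} (hz : z ∈ Metric.ball (t₀, x₀) ε) (ξ : E) :
    HasDerivAt (fun s => fderiv ℝ U (s, z.2) (0, ξ) - p (s, z.2) (fderiv ℝ q (s, z.2) (0, ξ)))
      0 z.1 := by
  have hm₁ : (1 : WithTop ℕ∞) ≤ m := by exact_mod_cast hm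
  have hnear : ∀ᶠ w in 𝓝 (z.1, z.2), w ∈ Metric.ball (t₀, x₀) ε :=
    Metric.isOpen_ball.mem_nhds hz
  have hU := hasDerivAt_fderiv_apply_snd
    (hnear.mono fun w hw => ((hF.contDiffAt_U w hw).of_le hm₁).differentiableAt one_ne_zero)
    (hnear.mono hF.hasDerivAt_U) ((hF.contDiffAt_lagrangian hH hz).of_le hm₁) ξ
  have hq := hasDerivAt_fderiv_apply_snd
    (hnear.mono fun w hw => ((hF.contDiffAt_q w hw).of_le hm₁).differentiableAt one_ne_zero)
    (hnear.mono hF.hasDerivAt_q) ((hF.contDiffAt_velocity hH hz).of_le hm₁) ξ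
  refine (hU.sub ((hF.hasDerivAt_p z hz).clm_apply hq)).congr_deriv ?_
  rw [hF.fderiv_lagrangian_apply hm hH hz, neg_apply]
  ring

lemma fderiv_action_apply_zero_prodMk (hF : IsHamiltonianFamily m W H v t₀ x₀ ε q p U)
    (hm : 1 ≤ m) (hH : IsHamiltonianOn m W H v) {z : ℝ × E} (hz : z ∈ Metric.ball (t₀, x₀) ε)
    (ξ : E) : fderiv ℝ U z (0, ξ) = p z (fderiv ℝ q z (0, ξ)) := by
  have hm₀ : (m : WithTop ℕ∞) ≠ 0 := by exact_mod_cast (zero_lt_one.trans_le hm).ne'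
  obtain ⟨t, x⟩ := z
  obtain ⟨ht, hx⟩ : t ∈ Metric.ball t₀ ε ∧ x ∈ Metric.ball x₀ ε := by
    rwa [← ball_prod_same] at hz
  have hslice : ∀ s ∈ Metric.ball t₀ ε, (s, x) ∈ Metric.ball (t₀, x₀) ε := by
    rw [← ball_prod_same]
    exact fun s hs => ⟨hs, hx⟩
  have ht₀ : t₀ ∈ Metric.ball t₀ ε := Metric.mem_ball_self (Metric.pos_of_mem_ball hz)
  have hderiv : ∀ s ∈ Metric.ball t₀ ε, HasDerivAt
      (fun s => fderiv ℝ U (s, x) (0, ξ) - p (s, x) (fderiv ℝ q (s, x) (0, ξ))) 0 s :=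
    fun s hs => hF.hasDerivAt_fderiv_action_sub hm hH (hslice s hs) ξ
  have hconst := Metric.isOpen_ball.is_const_of_deriv_eq_zero (convex_ball t₀ ε).isPreconnected
    (fun s hs => (hderiv s hs).differentiableAt.differentiableWithinAt)
    (fun s hs => (hderiv s hs).deriv) ht ht₀
  have hU_init : fderiv ℝ U (t₀, x) (0, ξ) = (0 : E →L[ℝ] ℝ) ξ :=
    fderiv_apply_zero_prodMk ((hF.contDiffAt_U _ (hslice _ ht₀)).differentiableAt hm₀)
      (by filter_upwards [Metric.isOpen_ball.mem_nhds hx] with y hy using hF.U_initial y hy)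
      (hasFDerivAt_const 0 x) ξ
  simp only [hF.p_initial x hx, hU_init, zero_apply, sub_zero] at hconst
  exact sub_eq_zero.1 hconst

lemma hasFDerivAt_action (hF : IsHamiltonianFamily m W H v t₀ x₀ ε q p U) (hm : 1 ≤ m)
    (hH : IsHamiltonianOn m W H v) {z : ℝ × E} (hz : z ∈ Metric.ball (t₀, x₀) ε) :
    HasFDerivAt U (canonicalForm (p z) (H (phaseLift q p z)) ∘L
      (ContinuousLinearMap.fst ℝ ℝ E).prod (fderiv ℝ q z)) z := by
  have hm₀ : (m : WithTop ℕ∞) ≠ 0 := by exact_mod_cast (zero_lt_one.trans_le hm).ne'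
  have hU := (hF.contDiffAt_U z hz).differentiableAt hm₀
  have hq := (hF.contDiffAt_q z hz).differentiableAt hm₀
  refine hU.hasFDerivAt.congr_fderiv (ContinuousLinearMap.ext fun ⟨τ, ξ⟩ => ?_)
  rw [map_prodMk_eq_smul_add (fderiv ℝ U z), hF.fderiv_action_apply_zero_prodMk hm hH hz,
    fderiv_apply_one_zero hU (hF.hasDerivAt_U z hz)]
  simp only [ContinuousLinearMap.comp_apply, ContinuousLinearMap.prod_apply,
    ContinuousLinearMap.coe_fst', canonicalForm_apply]
  rw [map_prodMk_eq_smul_add (fderiv ℝ q z) τ ξ, fderiv_apply_one_zero hq (hF.hasDerivAt_q z hz),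
    map_add, map_smul, smul_eq_mul, smul_eq_mul]
  ring

/-- The map `(t, x) ↦ (t, q (t, x))` whose inverse straightens the characteristics. -/
def characteristicMap (q : ℝ × E → E) (z : ℝ × E) : ℝ × E := (z.1, q z)

lemma contDiffOn_characteristicMap (hF : IsHamiltonianFamily m W H v t₀ x₀ ε q p U) :
    ContDiffOn ℝ m (characteristicMap q) (Metric.ball (t₀, x₀) ε) := fun z hz =>
  (contDiffAt_fst.prodMk (hF.contDiffAt_q z hz)).contDiffWithinAt

lemma hasFDerivAt_characteristicMap (hF : IsHamiltonianFamily m W H v t₀ x₀ ε q p U)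
    (hm : 1 ≤ m) {z : ℝ × E} (hz : z ∈ Metric.ball (t₀, x₀) ε) :
    HasFDerivAt (characteristicMap q) ((ContinuousLinearMap.fst ℝ ℝ E).prod (fderiv ℝ q z)) z :=
  hasFDerivAt_fst.prodMk ((hF.contDiffAt_q z hz).differentiableAt
    (by exact_mod_cast (zero_lt_one.trans_le hm).ne')).hasFDerivAt

lemma fderiv_characteristicMap_apply_one_zero (hF : IsHamiltonianFamily m W H v t₀ x₀ ε q p U)
    (hm : 1 ≤ m) {z : ℝ × E} (hz : z ∈ Metric.ball (t₀, x₀) ε) :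
    fderiv ℝ (characteristicMap q) z (1, 0) = (1, v (phaseLift q p z)) :=
  fderiv_apply_one_zero (hF.hasFDerivAt_characteristicMap hm hz).differentiableAt
    ((hasDerivAt_id z.1).prodMk (hF.hasDerivAt_q z hz))

lemma exists_equiv_hasFDerivAt_characteristicMap
    (hF : IsHamiltonianFamily m W H v t₀ x₀ ε q p U) (hm : 1 ≤ m) (hε : 0 < ε) :
    ∃ e : (ℝ × E) ≃L[ℝ] (ℝ × E),
      HasFDerivAt (characteristicMap q) (e : ℝ × E →L[ℝ] ℝ × E) (t₀, x₀) := by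
  have hz₀ : (t₀, x₀) ∈ Metric.ball (t₀, x₀) ε := Metric.mem_ball_self hε
  set v₀ := v (phaseLift q p (t₀, x₀))
  refine ⟨.equivOfInverse
    ((ContinuousLinearMap.fst ℝ ℝ E).prod
      ((ContinuousLinearMap.fst ℝ ℝ E).smulRight v₀ + ContinuousLinearMap.snd ℝ ℝ E))
    ((ContinuousLinearMap.fst ℝ ℝ E).prod
      (ContinuousLinearMap.snd ℝ ℝ E - (ContinuousLinearMap.fst ℝ ℝ E).smulRight v₀))
    (fun z => by ext <;> simp) (fun z => by ext <;> simp),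
    (hF.hasFDerivAt_characteristicMap hm hz₀).congr_fderiv
      (ContinuousLinearMap.ext fun ⟨τ, ξ⟩ => Prod.ext rfl ?_)⟩
  have hq : DifferentiableAt ℝ q (t₀, x₀) := (hF.contDiffAt_q _ hz₀).differentiableAt
    (by exact_mod_cast (zero_lt_one.trans_le hm).ne')
  change fderiv ℝ q (t₀, x₀) (τ, ξ) = τ • v₀ + ξ
  rw [map_prodMk_eq_smul_add, fderiv_apply_one_zero hq (hF.hasDerivAt_q _ hz₀),
    fderiv_apply_zero_prodMk hq
      (by filter_upwards [Metric.ball_mem_nhds x₀ hε] with y hy using hF.q_initial y hy)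
      (hasFDerivAt_id x₀)]
  rfl

end IsHamiltonianFamily

lemma exists_openPartialHomeomorph_of_contDiffOn {F : Type*} [NormedAddCommGroup F]
    [NormedSpace ℝ F] [CompleteSpace F] {n : WithTop ℕ∞} (hn : 1 ≤ n) {G : F → F} {O : Set F}
    (hO : IsOpen O) (hG : ContDiffOn ℝ n G O) {z₀ : F} (hz₀ : z₀ ∈ O) {e : F ≃L[ℝ] F}
    (he : HasFDerivAt G (e : F →L[ℝ] F) z₀) :
    ∃ Θ : OpenPartialHomeomorph F F, z₀ ∈ Θ.source ∧ Θ.source ⊆ O ∧ ⇑Θ = G ∧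
      ContDiffOn ℝ n Θ.symm Θ.target := by
  have hn₀ : n ≠ 0 := (one_pos.trans_le hn).ne'
  have hG₀ := hG.contDiffAt (hO.mem_nhds hz₀)
  have hO' : IsOpen (O ∩ fderiv ℝ G ⁻¹' range ((↑) : (F ≃L[ℝ] F) → F →L[ℝ] F)) :=
    (hG.continuousOn_fderiv_of_isOpen hO hn).isOpen_inter_preimage hO
      ContinuousLinearEquiv.isOpen
  refine ⟨(hG₀.toOpenPartialHomeomorph G he hn₀).restrOpen _ hO',
    ⟨hG₀.mem_toOpenPartialHomeomorph_source he hn₀, hz₀, e, he.fderiv.symm⟩,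
    fun z hz => hz.2.1, rfl, fun w hw => ContDiffAt.contDiffWithinAt ?_⟩
  obtain ⟨hwO, f, hf⟩ := (OpenPartialHomeomorph.map_target _ hw).2
  have hGw := hG.contDiffAt (hO.mem_nhds hwO)
  exact OpenPartialHomeomorph.contDiffAt_symm _ (f₀' := f) hw
    (hf ▸ (hGw.differentiableAt hn₀).hasFDerivAt) hGw

lemma fderiv_symm_fderiv_apply {F G : Type*} [NormedAddCommGroup F] [NormedSpace ℝ F]
    [NormedAddCommGroup G] [NormedSpace ℝ G] {Θ : OpenPartialHomeomorph F G} {z : F}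
    (hz : z ∈ Θ.source) (hΘ : DifferentiableAt ℝ Θ z)
    (hsymm : DifferentiableAt ℝ Θ.symm (Θ z)) (ξ : F) :
    fderiv ℝ Θ.symm (Θ z) (fderiv ℝ Θ z ξ) = ξ :=
  congrArg (fun L => L ξ) ((hsymm.hasFDerivAt.comp z hΘ.hasFDerivAt).unique
    ((hasFDerivAt_id z).congr_of_eventuallyEq (Θ.eventually_left_inverse hz)))

/-- `u` is, near each point of the source of `Ψ`, a solution of class `C^(m+1)` of the
Hamilton-Jacobi equation with spatial differential `P`, and the space coordinate of the local
coordinates `Ψ` of class `C^m` is constant along the characteristics of `u`. -/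
structure IsCharacteristicChart (m : ℕ∞) (W : Set (ℝ × E × (E →L[ℝ] ℝ)))
    (H : ℝ × E × (E →L[ℝ] ℝ) → ℝ) (v : ℝ × E × (E →L[ℝ] ℝ) → E)
    (Ψ : OpenPartialHomeomorph (ℝ × E) (ℝ × E)) (u : ℝ × E → ℝ) (P : ℝ × E → E →L[ℝ] ℝ) :
    Prop where
  contDiffOn : ContDiffOn ℝ m Ψ Ψ.source
  contDiffOn_symm : ContDiffOn ℝ m Ψ.symm Ψ.target
  contDiffOn_solution : ContDiffOn ℝ (m + 1) u Ψ.source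
  time : ∀ z ∈ Ψ.source, (Ψ z).1 = z.1
  mem : ∀ z ∈ Ψ.source, (z.1, z.2, P z) ∈ W
  hasFDerivAt : ∀ z ∈ Ψ.source,
    HasFDerivAt u (canonicalForm (P z) (H (z.1, z.2, P z))) z
  fderiv_velocity : ∀ z ∈ Ψ.source, fderiv ℝ Ψ z (1, v (z.1, z.2, P z)) = (1, 0)

lemma contDiffOn_succ_of_hasFDerivAt_canonicalForm {S : Set (ℝ × E)} (hS : IsOpen S)
    {u h : ℝ × E → ℝ} {P : ℝ × E → E →L[ℝ] ℝ} (hP : ContDiffOn ℝ m P S)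
    (hh : ContDiffOn ℝ m h S) (hu : ∀ z ∈ S, HasFDerivAt u (canonicalForm (P z) (h z)) z) :
    ContDiffOn ℝ (m + 1) u S := by
  refine (contDiffOn_succ_iff_fderiv_of_isOpen hS).2
    ⟨fun z hz => (hu z hz).differentiableAt.differentiableWithinAt, by simp, ?_⟩
  have hform : ContDiffOn ℝ m (fun z => canonicalForm (P z) (h z)) S :=
    (hP.clm_comp contDiffOn_const).sub (hh.smul contDiffOn_const)
  exact hform.congr fun z hz => (hu z hz).fderiv

lemma IsHamiltonianFamily.isCharacteristicChart_symm {ε : ℝ} {q : ℝ × E → E}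
    {p : ℝ × E → E →L[ℝ] ℝ} {U : ℝ × E → ℝ}
    (hF : IsHamiltonianFamily m W H v t₀ x₀ ε q p U) (hm : 1 ≤ m) (hH : IsHamiltonianOn m W H v)
    {Θ : OpenPartialHomeomorph (ℝ × E) (ℝ × E)} (hsource : Θ.source ⊆ Metric.ball (t₀, x₀) ε)
    (hΘ : ⇑Θ = characteristicMap q) (hsymm : ContDiffOn ℝ m Θ.symm Θ.target) :
    IsCharacteristicChart m W H v Θ.symm (fun w => U (Θ.symm w)) (fun w => p (Θ.symm w)) := by
  have hm₀ : (m : WithTop ℕ∞) ≠ 0 := by exact_mod_cast (zero_lt_one.trans_le hm).ne'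
  have hmaps : MapsTo Θ.symm Θ.target (Metric.ball (t₀, x₀) ε) := fun w hw =>
    hsource (Θ.map_target hw)
  have hinv : ∀ w ∈ Θ.target, ((Θ.symm w).1, q (Θ.symm w)) = w := fun w hw => by
    simpa [hΘ, characteristicMap] using Θ.right_inv hw
  have hphase : ∀ w ∈ Θ.target, phaseLift q p (Θ.symm w) = (w.1, w.2, p (Θ.symm w)) :=
    fun w hw => by simpa [phaseLift] using Prod.ext_iff.1 (hinv w hw)
  have hmem : ∀ w ∈ Θ.target, (w.1, w.2, p (Θ.symm w)) ∈ W := fun w hw =>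
    hphase w hw ▸ hF.phaseLift_mem _ (hmaps hw)
  have hsymm_diff : ∀ w ∈ Θ.target, DifferentiableAt ℝ Θ.symm w := fun w hw =>
    (hsymm.contDiffAt (Θ.open_target.mem_nhds hw)).differentiableAt hm₀
  have hΘ_deriv : ∀ w ∈ Θ.target, HasFDerivAt Θ
      ((ContinuousLinearMap.fst ℝ ℝ E).prod (fderiv ℝ q (Θ.symm w))) (Θ.symm w) :=
    fun w hw => hΘ ▸ hF.hasFDerivAt_characteristicMap hm (hmaps hw)
  have hu : ∀ w ∈ Θ.target, HasFDerivAt (fun w => U (Θ.symm w))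
      (canonicalForm (p (Θ.symm w)) (H (w.1, w.2, p (Θ.symm w)))) w := fun w hw => by
    refine ((hF.hasFDerivAt_action hm hH (hmaps hw)).comp w
      (hsymm_diff w hw).hasFDerivAt).congr_fderiv (ContinuousLinearMap.ext fun ξ => ?_)
    have hξ := fderiv_symm_fderiv_apply (Θ := Θ.symm) hw (hsymm_diff w hw)
      (hΘ_deriv w hw).differentiableAt ξ
    rw [Θ.symm_symm, (hΘ_deriv w hw).fderiv] at hξ
    rw [← hphase w hw, ContinuousLinearMap.comp_apply, ContinuousLinearMap.comp_apply, hξ]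
  have hp : ContDiffOn ℝ m (fun w => p (Θ.symm w)) Θ.target :=
    ContDiffOn.comp (fun z hz => (hF.contDiffAt_p z hz).contDiffWithinAt) hsymm hmaps
  refine ⟨hsymm, ?_, ?_, fun w hw => (Prod.ext_iff.1 (hinv w hw)).1, hmem, hu, fun w hw => ?_⟩
  · exact hΘ ▸ hF.contDiffOn_characteristicMap.mono hsource
  · exact contDiffOn_succ_of_hasFDerivAt_canonicalForm Θ.open_target hp
      ((hH.contDiffOn.of_le (by exact_mod_cast le_self_add)).comp
        (contDiffOn_fst.prodMk (contDiffOn_snd.prodMk hp)) hmem) hu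
  · have hvelocity := fderiv_symm_fderiv_apply (Θ.map_target hw) (hΘ_deriv w hw).differentiableAt
      ((Θ.right_inv hw).symm ▸ hsymm_diff w hw) (1, 0)
    rwa [hΘ, hF.fderiv_characteristicMap_apply_one_zero hm (hmaps hw), ← hΘ, Θ.right_inv hw,
      hphase w hw] at hvelocity

theorem IsHamiltonianOn.exists_isCharacteristicChart [FiniteDimensional ℝ E] (hm : 1 ≤ m)
    (hH : IsHamiltonianOn m W H v) (h₀ : (t₀, x₀, 0) ∈ W) :
    ∃ Ψ u P, (t₀, x₀) ∈ Ψ.source ∧ IsCharacteristicChart m W H v Ψ u P := by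
  have := FiniteDimensional.complete ℝ E
  obtain ⟨ε, hε, q, p, U, hF⟩ := hH.exists_isHamiltonianFamily hm h₀
  obtain ⟨e, he⟩ := hF.exists_equiv_hasFDerivAt_characteristicMap hm hε
  obtain ⟨Θ, hmem, hsource, hΘ, hsymm⟩ := exists_openPartialHomeomorph_of_contDiffOn
    (by exact_mod_cast hm) Metric.isOpen_ball hF.contDiffOn_characteristicMap
    (Metric.mem_ball_self hε) he
  refine ⟨Θ.symm, _, _, ?_, hF.isCharacteristicChart_symm hm hH hsource hΘ hsymm⟩
  have htarget := Θ.map_source hmem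
  rwa [hΘ, IsHamiltonianFamily.characteristicMap,
    hF.q_initial x₀ (Metric.mem_ball_self hε)] at htarget

end HamiltonJacobi

/-! ### From Rosen coordinates to solutions of the Hamilton–Jacobi equation -/

section ManifoldCalculus

variable {E : Type*} [NormedAddCommGroup E] [NormedSpace ℝ E] {H : Type*} [TopologicalSpace H]
  {I : ModelWithCorners ℝ E H} {M : Type*} [TopologicalSpace M] [ChartedSpace H M]

lemma hasMFDerivAt_fst_comp {E' : Type*} [NormedAddCommGroup E'] [NormedSpace ℝ E'] {H' : Type*}
    [TopologicalSpace H'] {I' : ModelWithCorners ℝ E' H'} {M' : Type*} [TopologicalSpace M']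
    [ChartedSpace H' M'] {F : Type*} [NormedAddCommGroup F] [NormedSpace ℝ F] {G : Type*}
    [TopologicalSpace G] {J : ModelWithCorners ℝ F G} {N : Type*} [TopologicalSpace N]
    [ChartedSpace G N] {f : N → M × M'} {x : N} {f' : F →L[ℝ] E × E'}
    (hf : HasMFDerivAt J (I.prod I') f x f') :
    HasMFDerivAt J I (fun x => (f x).1) x (ContinuousLinearMap.fst ℝ E E' ∘L f') :=
  (hasMFDerivAt_fst (f x)).comp x hf

lemma hasMFDerivAt_snd_comp {E' : Type*} [NormedAddCommGroup E'] [NormedSpace ℝ E'] {H' : Type*}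
    [TopologicalSpace H'] {I' : ModelWithCorners ℝ E' H'} {M' : Type*} [TopologicalSpace M']
    [ChartedSpace H' M'] {F : Type*} [NormedAddCommGroup F] [NormedSpace ℝ F] {G : Type*}
    [TopologicalSpace G] {J : ModelWithCorners ℝ F G} {N : Type*} [TopologicalSpace N]
    [ChartedSpace G N] {f : N → M × M'} {x : N} {f' : F →L[ℝ] E × E'}
    (hf : HasMFDerivAt J (I.prod I') f x f') :
    HasMFDerivAt J I' (fun x => (f x).2) x (ContinuousLinearMap.snd ℝ E E' ∘L f') :=
  (hasMFDerivAt_snd (f x)).comp x hf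

variable [IsManifold I 1 M] {F : Type*} [NormedAddCommGroup F] [NormedSpace ℝ F] {γ : F → M}

lemma eventuallyEq_const_of_hasMFDerivAt_zero {x : F}
    (hγ : ∀ᶠ y in 𝓝 x, HasMFDerivAt 𝓘(ℝ, F) I γ y 0) : γ =ᶠ[𝓝 x] fun _ => γ x := by
  have hchart : ∀ᶠ y in 𝓝 x, γ y ∈ (chartAt H (γ x)).source :=
    hγ.self_of_nhds.continuousAt.eventually
      ((chartAt H (γ x)).open_source.eventually_mem (mem_chart_source H (γ x)))
  obtain ⟨ε, hε, hball⟩ := Metric.eventually_nhds_iff_ball.1 (hγ.and hchart)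
  have hderiv : ∀ y ∈ Metric.ball x ε, HasFDerivAt (extChartAt I (γ x) ∘ γ) (0 : F →L[ℝ] E) y := by
    intro y hy
    exact ((hasMFDerivAt_extChartAt (I := I) (hball y hy).2).comp y
      (hball y hy).1).hasFDerivAt.congr_fderiv (ContinuousLinearMap.comp_zero _)
  filter_upwards [Metric.ball_mem_nhds x hε] with y hy
  refine (extChartAt I (γ x)).injOn ?_ (mem_extChartAt_source _) ?_
  · rw [extChartAt_source]
    exact (hball y hy).2
  · exact Metric.isOpen_ball.is_const_of_fderiv_eq_zero (convex_ball x ε).isPreconnected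
      (fun z hz => (hderiv z hz).differentiableAt.differentiableWithinAt)
      (fun z hz => (hderiv z hz).fderiv) hy (Metric.mem_ball_self hε)

lemma eq_of_hasMFDerivAt_zero {S : Set F} (hS : IsOpen S) (hS' : IsPreconnected S)
    (hγ : ∀ x ∈ S, HasMFDerivAt 𝓘(ℝ, F) I γ x 0) {x y : F} (hx : x ∈ S) (hy : y ∈ S) :
    γ x = γ y := by
  have hlocal : IsLocallyConstant (S.domRestrict γ) := IsLocallyConstant.iff_eventually_eq _ |>.2
    fun z => continuous_subtype_val.continuousAt.eventually
      (eventuallyEq_const_of_hasMFDerivAt_zero ((hS.eventually_mem z.2).mono hγ))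
  have : PreconnectedSpace S := isPreconnected_iff_preconnectedSpace.1 hS'
  exact hlocal.apply_eq_of_preconnectedSpace ⟨x, hx⟩ ⟨y, hy⟩

end ManifoldCalculus

lemma isInvertible_of_apply_self_pos {E : Type*} [NormedAddCommGroup E] [NormedSpace ℝ E]
    [FiniteDimensional ℝ E] {B : E →L[ℝ] E →L[ℝ] ℝ} (hB : ∀ v, v ≠ 0 → 0 < B v v) :
    B.IsInvertible := by
  have hinj : Function.Injective B := (injective_iff_map_eq_zero B).2 fun v hv => by
    by_contra hne
    simpa [hv] using hB v hne
  have hfinrank : Module.finrank ℝ E = Module.finrank ℝ (E →L[ℝ] ℝ) := by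
    rw [← (LinearMap.toContinuousLinearMap (𝕜 := ℝ) (E := E) (F' := ℝ)).finrank_eq]
    exact Subspace.dual_finrank_eq.symm
  exact ⟨(LinearEquiv.ofInjectiveOfFinrankEq B.toLinearMap hinj hfinrank).toContinuousLinearEquiv,
    rfl⟩

/-- The model with corners of the manifold `ℝ × Q` of events `(t, q)`. -/
noncomputable abbrev eventModel (d : ℕ) := 𝓘(ℝ, ℝ).prod (𝓡 d)

section Differentials

variable {d : ℕ} {Q : Type*} [TopologicalSpace Q] [ChartedSpace (EuclideanSpace ℝ (Fin d)) Q]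
  {Q' : Type*} [TopologicalSpace Q'] [ChartedSpace (EuclideanSpace ℝ (Fin d)) Q']

local notation "𝔼" => EuclideanSpace ℝ (Fin d)

/-- The differential of a map between manifolds of events. Its type forgets the base points, so
that tangent vectors can be written in components. -/
noncomputable def eventDeriv (f : ℝ × Q → ℝ × Q') (z : ℝ × Q) : ℝ × 𝔼 →L[ℝ] ℝ × 𝔼 :=
  mfderiv (eventModel d) (eventModel d) f z

/-- The differential of a map between spacetimes, with the same convention as `eventDeriv`. -/
noncomputable def spacetimeDeriv (f : ℝ × Q × ℝ → ℝ × Q' × ℝ) (x : ℝ × Q × ℝ) :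
    ℝ × 𝔼 × ℝ →L[ℝ] ℝ × 𝔼 × ℝ :=
  mfderiv (spacetimeModel d) (spacetimeModel d) f x

/-- The differential of `u` as a function of the event `(t, q)`. -/
noncomputable def eventDifferential (u : ℝ → Q → ℝ) (z : ℝ × Q) : ℝ × 𝔼 →L[ℝ] ℝ :=
  mfderiv (eventModel d) 𝓘(ℝ, ℝ) (fun z : ℝ × Q => u z.1 z.2) z

lemma deriv_eq_eventDifferential {u : ℝ → Q → ℝ} {t : ℝ} {q : Q}
    (hu : MDifferentiableAt (eventModel d) 𝓘(ℝ, ℝ) (fun z : ℝ × Q => u z.1 z.2) (t, q)) :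
    deriv (fun s => u s q) t = eventDifferential (d := d) u (t, q) (1, 0) := by
  have hslice : HasMFDerivAt 𝓘(ℝ, ℝ) (eventModel d) (fun s : ℝ => (s, q)) t
      ((ContinuousLinearMap.id ℝ ℝ).prod (0 : ℝ →L[ℝ] 𝔼)) :=
    (hasMFDerivAt_id t).prodMk (hasMFDerivAt_const q t)
  have hcomp := hu.hasMFDerivAt.comp t hslice
  have hfderiv : HasFDerivAt (fun s => u s q)
      (eventDifferential u (t, q) ∘L (ContinuousLinearMap.id ℝ ℝ).prod (0 : ℝ →L[ℝ] 𝔼)) t :=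
    hcomp.hasFDerivAt
  exact hfderiv.hasDerivAt.deriv

lemma dq_apply_eq_eventDifferential {u : ℝ → Q → ℝ} {t : ℝ} {q : Q}
    (hu : MDifferentiableAt (eventModel d) 𝓘(ℝ, ℝ) (fun z : ℝ × Q => u z.1 z.2) (t, q))
    (v : 𝔼) : BrinkmannData.dq (d := d) u t q v = eventDifferential u (t, q) (0, v) := by
  have hslice : HasMFDerivAt (𝓡 d) (eventModel d) (fun q : Q => (t, q)) q
      ((0 : 𝔼 →L[ℝ] ℝ).prod (ContinuousLinearMap.id ℝ 𝔼)) :=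
    (hasMFDerivAt_const t q).prodMk (hasMFDerivAt_id q)
  exact congrArg (fun L : 𝔼 →L[ℝ] ℝ => L v) (hu.hasMFDerivAt.comp q hslice).mfderiv

lemma hasMFDerivAt_event (z : ℝ × Q × ℝ) :
    HasMFDerivAt (spacetimeModel d) (eventModel d) (fun x : ℝ × Q × ℝ => (x.1, x.2.1)) z
      ((ContinuousLinearMap.fst ℝ ℝ (𝔼 × ℝ)).prod
        (ContinuousLinearMap.fst ℝ 𝔼 ℝ ∘L ContinuousLinearMap.snd ℝ ℝ (𝔼 × ℝ))) :=
  (hasMFDerivAt_fst z).prodMk (hasMFDerivAt_fst_comp (hasMFDerivAt_snd z))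

lemma hasMFDerivAt_sub_event {u : ℝ → Q → ℝ} {x : ℝ × Q × ℝ}
    (hu : MDifferentiableAt (eventModel d) 𝓘(ℝ, ℝ) (fun z : ℝ × Q => u z.1 z.2) (x.1, x.2.1)) :
    HasMFDerivAt (spacetimeModel d) 𝓘(ℝ, ℝ) (fun x : ℝ × Q × ℝ => x.2.2 - u x.1 x.2.1) x
      (ContinuousLinearMap.snd ℝ 𝔼 ℝ ∘L ContinuousLinearMap.snd ℝ ℝ (𝔼 × ℝ) -
        eventDifferential u (x.1, x.2.1) ∘L (ContinuousLinearMap.fst ℝ ℝ (𝔼 × ℝ)).prod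
          (ContinuousLinearMap.fst ℝ 𝔼 ℝ ∘L ContinuousLinearMap.snd ℝ ℝ (𝔼 × ℝ))) :=
  (hasMFDerivAt_snd_comp (hasMFDerivAt_snd x)).sub
    (hu.hasMFDerivAt.comp x (hasMFDerivAt_event x))

end Differentials

section RosenToHamiltonJacobi

variable {d : ℕ} {Q : Type*} [TopologicalSpace Q] [ChartedSpace (EuclideanSpace ℝ (Fin d)) Q]
  {Q' : Type*} [TopologicalSpace Q'] [ChartedSpace (EuclideanSpace ℝ (Fin d)) Q'] {r : ℕ∞}

local notation "𝔼" => EuclideanSpace ℝ (Fin d)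

local notation "𝕋" => ℝ × EuclideanSpace ℝ (Fin d) × ℝ

lemma rosenMetric_one_zero_zero (a' : TimeBilin d Q') (x : ℝ × Q' × ℝ) (Y : 𝕋) :
    rosenMetric a' x ((1, 0, 0) : 𝕋) Y = -Y.2.2 := by
  have hzero : a' x.1 x.2.1 (0 : 𝔼) Y.2.1 = 0 :=
    congrArg (fun L : 𝔼 →L[ℝ] ℝ => L Y.2.1) (map_zero (a' x.1 x.2.1))
  change a' x.1 x.2.1 (0 : 𝔼) Y.2.1 - 1 * Y.2.2 - 0 * Y.1 = _
  rw [hzero]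
  ring

namespace BrinkmannData

variable [IsManifold (𝓡 d) 1 Q] [IsManifold (𝓡 d) 1 Q'] (D : BrinkmannData d Q r)

lemma isInvertible_a (t : ℝ) (q : Q) : (D.a t q).IsInvertible :=
  isInvertible_of_apply_self_pos (E := 𝔼) (D.isMetric.pos t q trivial)

lemma a_sharp (t : ℝ) (q : Q) (p : TangentSpace (𝓡 d) q →L[ℝ] ℝ) :
    D.a t q (D.sharp t q p) = p :=
  (D.isInvertible_a t q).self_apply_inverse p

variable {D}

lemma eq_sharp_iff {t : ℝ} {q : Q} {p : TangentSpace (𝓡 d) q →L[ℝ] ℝ}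
    {v : TangentSpace (𝓡 d) q} : v = D.sharp t q p ↔ D.a t q v = p := by
  refine ⟨fun h => h ▸ D.a_sharp t q p, fun h => ?_⟩
  rw [← h]
  exact ((D.isInvertible_a t q).inverse_apply_self v).symm

section NullGradient

variable {t : ℝ} {q : Q} {y : ℝ} {N : ℝ × EuclideanSpace ℝ (Fin d) × ℝ}
  {U : ℝ × EuclideanSpace ℝ (Fin d) →L[ℝ] ℝ} {p : TangentSpace (𝓡 d) q →L[ℝ] ℝ}

lemma eq_sharp_of_metric_eq (hN : N.1 = 1)
    (hmetric : ∀ Y : 𝕋, D.metric (t, q, y) N Y = U (Y.1, Y.2.1) - Y.2.2)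
    (hp : ∀ v : 𝔼, p v = U (0, v)) : N.2.1 = D.sharp t q (p - D.b t q) := by
  refine eq_sharp_iff.2 (ContinuousLinearMap.ext fun v => ?_)
  have hv : D.a t q N.2.1 v - N.1 * (0 - D.b t q v) - (N.2.2 - D.b t q N.2.1) * 0
      - 2 * D.V t q * (N.1 * 0) = U (0, v) - 0 := hmetric (0, v, 0)
  have hsub : (p - D.b t q) v = U (0, v) - D.b t q v := congrArg (· - D.b t q v) (hp v)
  rw [hsub]
  rw [hN] at hv
  linarith

lemma hamiltonJacobi_of_metric_eq (hN : N.1 = 1) (hnull : N.2.2 = U (1, N.2.1))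
    (hmetric : ∀ Y : 𝕋, D.metric (t, q, y) N Y = U (Y.1, Y.2.1) - Y.2.2)
    (hp : ∀ v : 𝔼, p v = U (0, v)) : U (1, 0) + D.hamiltonian t q p = 0 := by
  have htime : D.a t q N.2.1 (0 : 𝔼) - N.1 * (0 - D.b t q (0 : 𝔼))
      - (N.2.2 - D.b t q N.2.1) * 1 - 2 * D.V t q * (N.1 * 1) = U (1, 0) - 0 :=
    hmetric (1, 0, 0)
  have ha : D.a t q N.2.1 (0 : 𝔼) = 0 := map_zero (D.a t q N.2.1)
  have hb : D.b t q (0 : 𝔼) = 0 := map_zero (D.b t q)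
  have hsub : (p - D.b t q) N.2.1 = U (0, N.2.1) - D.b t q N.2.1 :=
    congrArg (· - D.b t q N.2.1) (hp N.2.1)
  rw [hamiltonian, ← eq_sharp_of_metric_eq hN hmetric hp, hsub]
  rw [ha, hb, hN, hnull, map_prodMk_eq_smul_add U 1, one_smul] at htime
  linarith

end NullGradient

variable {k l : ℕ∞} {Φ : OpenPartialHomeomorph (ℝ × Q × ℝ) (ℝ × Q' × ℝ)} {a' : TimeBilin d Q'}
  {I : Set ℝ}

/-- The velocity of the curves of constant `(q', y')`, that is, the vector field `∂/∂t` of the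
Rosen coordinates. -/
noncomputable def rosenTime (Φ : OpenPartialHomeomorph (ℝ × Q × ℝ) (ℝ × Q' × ℝ))
    (x : ℝ × Q × ℝ) : 𝕋 :=
  spacetimeDeriv Φ.symm (Φ x) (1, 0, 0)

/-- The function `u` such that `y' = y - u(t, q)`. -/
def rosenAction (Φ : OpenPartialHomeomorph (ℝ × Q × ℝ) (ℝ × Q' × ℝ)) (t : ℝ) (q : Q) : ℝ :=
  -(Φ (t, q, 0)).2.2

/-- The projection to `Q` of the curve of constant `(q', y')` through `(t, q, 0)`. -/
def rosenCurve (Φ : OpenPartialHomeomorph (ℝ × Q × ℝ) (ℝ × Q' × ℝ)) (t : ℝ) (q : Q) (s : ℝ) : Q :=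
  (Φ.symm (s, (Φ (t, q, 0)).2)).2.1

namespace IsRosen

variable (h : D.IsRosen k l Φ a') (hk : 1 ≤ k)

include h hk

lemma mdifferentiable : Φ.MDifferentiable (spacetimeModel d) (spacetimeModel d) := by
  have hk' : (k : WithTop ℕ∞) ≠ 0 := by
    exact_mod_cast (zero_lt_one.trans_le hk).ne'
  exact ⟨h.contMDiffOn.mdifferentiableOn hk', h.contMDiffOn_symm.mdifferentiableOn hk'⟩

lemma hasMFDerivAt {x : ℝ × Q × ℝ} (hx : x ∈ Φ.source) :
    HasMFDerivAt (spacetimeModel d) (spacetimeModel d) Φ x (spacetimeDeriv Φ x) :=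
  ((h.mdifferentiable hk).mdifferentiableAt hx).hasMFDerivAt

lemma spacetimeDeriv_rosenTime {x : ℝ × Q × ℝ} (hx : x ∈ Φ.source) :
    spacetimeDeriv (d := d) Φ x (rosenTime Φ x) = (1, 0, 0) := by
  have hcomp := (h.mdifferentiable hk).comp_symm_deriv (Φ.map_source hx)
  rw [Φ.left_inv hx] at hcomp
  exact congrArg (fun L : 𝕋 →L[ℝ] 𝕋 => L (1, 0, 0)) hcomp

lemma hasMFDerivAt_fibre {t : ℝ} {q : Q} {y : ℝ} (hx : (t, q, y) ∈ Φ.source) :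
    HasMFDerivAt 𝓘(ℝ, ℝ) (spacetimeModel d) (fun y => Φ (t, q, y)) y
      (ContinuousLinearMap.toSpanSingleton ℝ ((0, 0, 1) : 𝕋)) := by
  have hline : HasMFDerivAt 𝓘(ℝ, ℝ) (spacetimeModel d) (fun y : ℝ => (t, q, y)) y
      ((0 : ℝ →L[ℝ] ℝ).prod ((0 : ℝ →L[ℝ] 𝔼).prod (.id ℝ ℝ))) :=
    (hasMFDerivAt_const t y).prodMk ((hasMFDerivAt_const q y).prodMk (hasMFDerivAt_id y))
  refine ((h.hasMFDerivAt hk hx).comp y hline).congr_mfderiv (ContinuousLinearMap.ext_ring ?_)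
  exact (h.killing _ hx).trans (one_smul ℝ ((0, 0, 1) : 𝕋)).symm

lemma spacetimeDeriv_fst {x : ℝ × Q × ℝ} (hx : x ∈ Φ.source) (Y : 𝕋) :
    (spacetimeDeriv (d := d) Φ x Y).1 = Y.1 := by
  have htime := (hasMFDerivAt_fst (I := 𝓘(ℝ, ℝ)) (I' := (𝓡 d).prod 𝓘(ℝ, ℝ))
    x).congr_of_eventuallyEq (f₁ := fun x => (Φ x).1)
      ((Φ.open_source.eventually_mem hx).mono h.time)
  exact congrArg (fun L : 𝕋 →L[ℝ] ℝ => L Y)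
    (hasMFDerivAt_unique (hasMFDerivAt_fst_comp (h.hasMFDerivAt hk hx)) htime)

lemma rosenTime_fst {x : ℝ × Q × ℝ} (hx : x ∈ Φ.source) : (rosenTime (d := d) Φ x).1 = 1 := by
  rw [← h.spacetimeDeriv_fst hk hx, h.spacetimeDeriv_rosenTime hk hx]

variable (hs : Φ.source = {x | x.1 ∈ I})

include hs

lemma apply_eq {t : ℝ} (ht : t ∈ I) (q : Q) (y : ℝ) :
    Φ (t, q, y) = (t, (Φ (t, q, 0)).2.1, y - rosenAction Φ t q) := by
  have hx (y : ℝ) : (t, q, y) ∈ Φ.source := hs.superset ht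
  have hposition : (Φ (t, q, y)).2.1 = (Φ (t, q, 0)).2.1 := by
    refine eq_of_hasMFDerivAt_zero (I := 𝓡 d) (γ := fun y => (Φ (t, q, y)).2.1) isOpen_univ
      isPreconnected_univ (fun s _ => ?_) (mem_univ y) (mem_univ 0)
    exact (hasMFDerivAt_fst_comp (hasMFDerivAt_snd_comp
      (h.hasMFDerivAt_fibre hk (hx s)))).congr_mfderiv
        (ContinuousLinearMap.ext_ring (smul_zero (1 : ℝ)))
  have hheight : ∀ s, HasDerivAt (fun y => (Φ (t, q, y)).2.2 - y) 0 s := by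
    intro s
    have hsnd : HasFDerivAt (fun y => (Φ (t, q, y)).2.2) (.id ℝ ℝ) s :=
      ((hasMFDerivAt_snd_comp (hasMFDerivAt_snd_comp
        (h.hasMFDerivAt_fibre hk (hx s)))).congr_mfderiv
          (f₁' := .id ℝ ℝ) (ContinuousLinearMap.ext_ring (mul_one (1 : ℝ)))).hasFDerivAt
    exact (hsnd.hasDerivAt.sub (hasDerivAt_id' s)).congr_deriv (sub_self 1)
  have hconst := is_const_of_deriv_eq_zero (fun s => (hheight s).differentiableAt)
    (fun s => (hheight s).deriv) y 0
  refine Prod.ext (h.time _ (hx y)) (Prod.ext hposition ?_)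
  simp only [rosenAction]
  linarith

lemma mdifferentiableAt_rosenAction {t : ℝ} (ht : t ∈ I) (q : Q) :
    MDifferentiableAt (eventModel d) 𝓘(ℝ, ℝ) (fun z : ℝ × Q => rosenAction Φ z.1 z.2) (t, q) := by
  have hzero : HasMFDerivAt (eventModel d) (spacetimeModel d)
      (fun z : ℝ × Q => (z.1, z.2, (0 : ℝ))) (t, q) ((ContinuousLinearMap.fst ℝ ℝ 𝔼).prod
        ((ContinuousLinearMap.snd ℝ ℝ 𝔼).prod 0)) :=
    (hasMFDerivAt_fst _).prodMk ((hasMFDerivAt_snd _).prodMk (hasMFDerivAt_const _ _))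
  exact (hasMFDerivAt_snd_comp (hasMFDerivAt_snd_comp
    ((h.hasMFDerivAt hk (hs.superset ht)).comp (t, q) hzero))).neg.mdifferentiableAt

lemma spacetimeDeriv_snd_snd {t : ℝ} (ht : t ∈ I) (q : Q) (y : ℝ) (Y : 𝕋) :
    (spacetimeDeriv (d := d) Φ (t, q, y) Y).2.2 =
      Y.2.2 - eventDifferential (rosenAction Φ) (t, q) (Y.1, Y.2.1) := by
  have hx : (t, q, y) ∈ Φ.source := hs.superset ht
  have hheight := (hasMFDerivAt_sub_event (x := (t, q, y))
    (h.mdifferentiableAt_rosenAction hk hs ht q)).congr_of_eventuallyEq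
      (f₁ := fun x => (Φ x).2.2) ((Φ.open_source.eventually_mem hx).mono fun x hx => by
        simp [h.apply_eq hk hs (hs.subset hx) x.2.1 x.2.2])
  exact congrArg (fun L : 𝕋 →L[ℝ] ℝ => L Y) (hasMFDerivAt_unique
    (hasMFDerivAt_snd_comp (hasMFDerivAt_snd_comp (h.hasMFDerivAt hk hx))) hheight)

lemma metric_rosenTime {t : ℝ} (ht : t ∈ I) (q : Q) (y : ℝ) (Y : 𝕋) :
    D.metric (t, q, y) (rosenTime Φ (t, q, y)) Y =
      eventDifferential (rosenAction Φ) (t, q) (Y.1, Y.2.1) - Y.2.2 := by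
  have hx : (t, q, y) ∈ Φ.source := hs.superset ht
  have hmetric : D.metric (t, q, y) (rosenTime Φ (t, q, y)) Y = rosenMetric a' (Φ (t, q, y))
      (spacetimeDeriv Φ (t, q, y) (rosenTime Φ (t, q, y))) (spacetimeDeriv Φ (t, q, y) Y) :=
    h.metric_eq _ hx _ _
  rw [hmetric, h.spacetimeDeriv_rosenTime hk hx, rosenMetric_one_zero_zero,
    h.spacetimeDeriv_snd_snd hk hs ht, neg_sub]

lemma rosenTime_snd_fst {t : ℝ} (ht : t ∈ I) (q : Q) (y : ℝ) :
    (rosenTime (d := d) Φ (t, q, y)).2.1 = D.sharp t q (dq (rosenAction Φ) t q - D.b t q) :=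
  eq_sharp_of_metric_eq (p := dq (rosenAction Φ) t q)
    (h.rosenTime_fst hk (hs.superset ht)) (h.metric_rosenTime hk hs ht q y)
    (dq_apply_eq_eventDifferential (h.mdifferentiableAt_rosenAction hk hs ht q))

lemma hamiltonJacobi_rosenAction {t : ℝ} (ht : t ∈ I) (q : Q) :
    deriv (fun s => rosenAction Φ s q) t + D.hamiltonian t q (dq (rosenAction Φ) t q) = 0 := by
  have hx : (t, q, (0 : ℝ)) ∈ Φ.source := hs.superset ht
  have hu := h.mdifferentiableAt_rosenAction hk hs ht q
  have hfst := h.rosenTime_fst hk hx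
  have hnull := h.spacetimeDeriv_snd_snd hk hs ht q 0 (rosenTime Φ (t, q, 0))
  rw [h.spacetimeDeriv_rosenTime hk hx, hfst] at hnull
  rw [deriv_eq_eventDifferential hu]
  exact hamiltonJacobi_of_metric_eq (p := dq (rosenAction Φ) t q) hfst
    (sub_eq_zero.1 hnull.symm) (h.metric_rosenTime hk hs ht q 0)
    (dq_apply_eq_eventDifferential hu)

lemma isHJSolutionOn : D.IsHJSolutionOn l I (rosenAction Φ) where
  contMDiffOn := by
    have hzero : ContMDiff (eventModel d) (spacetimeModel d) (l : WithTop ℕ∞)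
        (fun z : ℝ × Q => (z.1, z.2, (0 : ℝ))) :=
      contMDiff_fst.prodMk (contMDiff_snd.prodMk contMDiff_const)
    exact (h.contMDiffOn_y.comp hzero.contMDiffOn fun z hz => hs.superset hz.1).neg
  equation _ ht q := h.hamiltonJacobi_rosenAction hk hs ht q

lemma hasMFDerivAt_apply_baseCharacteristic {J : Set ℝ} (hJI : J ⊆ I) {γ : ℝ → Q}
    (hγ : D.IsBaseCharacteristicOn (rosenAction Φ) J γ) {s : ℝ} (hsJ : s ∈ J) :
    HasMFDerivAt 𝓘(ℝ, ℝ) (𝓡 d) (fun s => (Φ (s, γ s, 0)).2.1) s 0 := by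
  have hx : (s, γ s, (0 : ℝ)) ∈ Φ.source := hs.superset (hJI hsJ)
  set N : 𝕋 := rosenTime Φ (s, γ s, 0) with hN
  have hcurve : HasMFDerivAt 𝓘(ℝ, ℝ) (spacetimeModel d) (fun s : ℝ => (s, γ s, (0 : ℝ))) s
      ((ContinuousLinearMap.id ℝ ℝ).prod
        ((ContinuousLinearMap.toSpanSingleton ℝ N.2.1 : ℝ →L[ℝ] 𝔼).prod (0 : ℝ →L[ℝ] ℝ))) := by
    rw [hN, h.rosenTime_snd_fst hk hs (hJI hsJ)]
    exact (hasMFDerivAt_id s).prodMk ((hγ s hsJ).prodMk (hasMFDerivAt_const 0 s))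
  have hvelocity : ((1, (1 : ℝ) • N.2.1, 0) : 𝕋) = N - N.2.2 • (0, 0, 1) := by
    ext <;> simp [hN, h.rosenTime_fst hk hx]
  have hkilling : spacetimeDeriv Φ (s, γ s, 0) ((0, 0, 1) : 𝕋) = (0, 0, 1) := h.killing _ hx
  refine (hasMFDerivAt_fst_comp (hasMFDerivAt_snd_comp
    ((h.hasMFDerivAt hk hx).comp s hcurve))).congr_mfderiv (ContinuousLinearMap.ext_ring ?_)
  change (spacetimeDeriv Φ (s, γ s, 0) ((1, (1 : ℝ) • N.2.1, 0) : 𝕋)).2.1 = 0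
  rw [hvelocity, map_sub, map_smul, hkilling, h.spacetimeDeriv_rosenTime hk hx]
  simp

lemma eqOn_rosenCurve {J : Set ℝ} (hJI : J ⊆ I) (hJ : IsOpen J) (hJ' : J.OrdConnected)
    {γ : ℝ → Q} (hγ : D.IsBaseCharacteristicOn (rosenAction Φ) J γ) {t : ℝ} (ht : t ∈ J) :
    EqOn (rosenCurve Φ t (γ t)) γ J := by
  intro s hsJ
  have hposition : (Φ (s, γ s, 0)).2.1 = (Φ (t, γ t, 0)).2.1 :=
    eq_of_hasMFDerivAt_zero (I := 𝓡 d) (γ := fun s => (Φ (s, γ s, 0)).2.1) hJ hJ'.isPreconnected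
      (fun _ hs' => h.hasMFDerivAt_apply_baseCharacteristic hk hs hJI hγ hs') hsJ ht
  have hΦ : Φ (s, γ s, (Φ (t, γ t, 0)).2.2 + rosenAction Φ s (γ s)) = (s, (Φ (t, γ t, 0)).2) := by
    rw [h.apply_eq hk hs (hJI hsJ), hposition, add_sub_cancel_right]
  rw [rosenCurve, ← hΦ, Φ.left_inv (hs.superset (hJI hsJ))]

variable (ht : Φ.target = {x | x.1 ∈ I})

include ht

lemma isBaseCharacteristicOn_rosenCurve (t : ℝ) (q : Q) :
    D.IsBaseCharacteristicOn (rosenAction Φ) I (rosenCurve Φ t q) := by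
  intro s hsI
  set c := (Φ (t, q, 0)).2
  have hmem : (s, c) ∈ Φ.target := by
    rw [ht]
    exact hsI
  have htime : (Φ.symm (s, c)).1 = s := by
    rw [← h.time _ (Φ.map_target hmem), Φ.right_inv hmem]
  have hx : Φ.symm (s, c) = (s, rosenCurve Φ t q s, (Φ.symm (s, c)).2.2) := Prod.ext htime rfl
  have hline : HasMFDerivAt 𝓘(ℝ, ℝ) (spacetimeModel d) (fun s : ℝ => (s, c)) s
      ((ContinuousLinearMap.id ℝ ℝ).prod (0 : ℝ →L[ℝ] 𝔼 × ℝ)) :=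
    (hasMFDerivAt_id s).prodMk (hasMFDerivAt_const c s)
  have hcurve := hasMFDerivAt_fst_comp (hasMFDerivAt_snd_comp
    (((h.mdifferentiable hk).mdifferentiableAt_symm hmem).hasMFDerivAt.comp s hline))
  have hvelocity := h.rosenTime_snd_fst hk hs hsI (rosenCurve Φ t q s) (Φ.symm (s, c)).2.2
  rw [← hx, rosenTime, Φ.right_inv hmem] at hvelocity
  exact hcurve.congr_mfderiv
    (ContinuousLinearMap.ext_ring (hvelocity.trans (one_smul ℝ _).symm))

lemma characteristicsDefinedOn : D.CharacteristicsDefinedOn I (rosenAction Φ) := by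
  refine ⟨fun t htI q => ⟨rosenCurve Φ t q, h.isBaseCharacteristicOn_rosenCurve hk hs ht t q, ?_⟩,
    fun J hJI hJ hJ' γ hγ => ?_⟩
  · have hx : (t, q, (0 : ℝ)) ∈ Φ.source := hs.superset htI
    have hΦ : (t, (Φ (t, q, 0)).2) = Φ (t, q, 0) := Prod.ext (h.time _ hx).symm rfl
    rw [rosenCurve, hΦ, Φ.left_inv hx]
  · rcases J.eq_empty_or_nonempty with rfl | ⟨t, htJ⟩
    · exact ⟨_, h.isBaseCharacteristicOn_rosenCurve hk hs ht 0 (γ 0), eqOn_empty _ _⟩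
    · exact ⟨_, h.isBaseCharacteristicOn_rosenCurve hk hs ht t (γ t),
        h.eqOn_rosenCurve hk hs hJI hJ hJ' hγ htJ⟩

end IsRosen

theorem HasRosen.hasHJSolution {Q : Type u} [TopologicalSpace Q] [ChartedSpace 𝔼 Q]
    [IsManifold (𝓡 d) 1 Q] {D : BrinkmannData d Q r} (hk : 1 ≤ k) (h : D.HasRosen k l I) :
    D.HasHJSolution l I := by
  obtain ⟨Q', _, _, _, _, Φ, a', hs, ht, hΦ⟩ := h
  exact ⟨rosenAction Φ, hΦ.isHJSolutionOn hk hs, hΦ.characteristicsDefinedOn hk hs ht⟩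

end BrinkmannData

end RosenToHamiltonJacobi

/-! ### From straightened characteristics to Rosen coordinates -/

section FibreDerivative

variable {E : Type*} [NormedAddCommGroup E] [NormedSpace ℝ E] {H : Type*} [TopologicalSpace H]
  {I : ModelWithCorners ℝ E H} {M : Type*} [TopologicalSpace M] [ChartedSpace H M]
  [IsManifold I 1 M] {E' : Type*} [NormedAddCommGroup E'] [NormedSpace ℝ E'] {H' : Type*}
  [TopologicalSpace H'] {I' : ModelWithCorners ℝ E' H'} {M' : Type*} [TopologicalSpace M']
  [ChartedSpace H' M'] [IsManifold I' 1 M'] {F : Type*} [NormedAddCommGroup F] [NormedSpace ℝ F]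

lemma contMDiffOn_fibreDerivative {f : F × M' → M} {m n : WithTop ℕ∞} {O : Set (F × M')}
    (hO : IsOpen O) (hf : ContMDiffOn (𝓘(ℝ, F).prod I') I n f O) (hmn : m + 1 ≤ n) :
    ContMDiffOn (𝓘(ℝ, F).prod I'.tangent) I.tangent m
      (fun p : F × TangentBundle I' M' => (⟨f (p.1, p.2.proj),
        (mfderiv (𝓘(ℝ, F).prod I') I f (p.1, p.2.proj) : F × E' →L[ℝ] E) (0, p.2.snd)⟩ :
          TangentBundle I M))
      {p | (p.1, p.2.proj) ∈ O} := by
  have hzero : ContMDiff (𝓘(ℝ, F).prod I'.tangent) (𝓘(ℝ, F).tangent.prod I'.tangent) m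
      (fun p : F × TangentBundle I' M' => ((⟨p.1, 0⟩ : TangentBundle 𝓘(ℝ, F) F), p.2)) :=
    ((Bundle.contMDiff_zeroSection ℝ (TangentSpace 𝓘(ℝ, F) : F → Type _)).comp
      contMDiff_fst).prodMk contMDiff_snd
  have hinclusion := (contMDiff_equivTangentBundleProd_symm (I := 𝓘(ℝ, F)) (M := F) (I' := I')
    (M' := M') (n := m)).comp hzero
  refine ((hf.contMDiffOn_tangentMapWithin hmn hO.uniqueMDiffOn).comp hinclusion.contMDiffOn
    (fun p hp => hp)).congr fun p hp => ?_
  have hwithin : mfderivWithin (𝓘(ℝ, F).prod I') I f O (p.1, p.2.proj) =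
      mfderiv (𝓘(ℝ, F).prod I') I f (p.1, p.2.proj) := mfderivWithin_of_isOpen hO hp
  exact congrArg (fun L : F × E' →L[ℝ] E =>
    (⟨f (p.1, p.2.proj), L (0, p.2.snd)⟩ : TangentBundle I M)) hwithin.symm

end FibreDerivative

section RosenOfSolution

variable {d : ℕ} {Q : Type*} [TopologicalSpace Q] [ChartedSpace (EuclideanSpace ℝ (Fin d)) Q]
  {Q' : Type*} [TopologicalSpace Q'] [ChartedSpace (EuclideanSpace ℝ (Fin d)) Q']

local notation "𝔼" => EuclideanSpace ℝ (Fin d)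

local notation "𝕋" => ℝ × EuclideanSpace ℝ (Fin d) × ℝ

lemma contMDiff_event {n : WithTop ℕ∞} :
    ContMDiff (spacetimeModel d) (eventModel d) n (fun x : ℝ × Q × ℝ => (x.1, x.2.1)) :=
  contMDiff_fst.prodMk (contMDiff_fst.comp contMDiff_snd)

lemma eventDeriv_fst {f : ℝ × Q → ℝ × Q'} {z : ℝ × Q}
    (hf : MDifferentiableAt (eventModel d) (eventModel d) f z)
    (htime : ∀ᶠ w in 𝓝 z, (f w).1 = w.1) (X : ℝ × 𝔼) : (eventDeriv (d := d) f z X).1 = X.1 :=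
  congrArg (fun L : ℝ × 𝔼 →L[ℝ] ℝ => L X) (hasMFDerivAt_unique
    (hasMFDerivAt_fst_comp hf.hasMFDerivAt) ((hasMFDerivAt_fst z).congr_of_eventuallyEq htime))

/-- The derivative at constant time of the map `(t, q') ↦ q` inverse to `Ψ`. -/
noncomputable def spaceInverseDeriv (Ψ : OpenPartialHomeomorph (ℝ × Q) (ℝ × Q'))
    (z : ℝ × Q') : 𝔼 →L[ℝ] 𝔼 :=
  ContinuousLinearMap.snd ℝ ℝ 𝔼 ∘L eventDeriv Ψ.symm z ∘L ContinuousLinearMap.inr ℝ ℝ 𝔼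

/-- The change of coordinates `(t, q, y) ↦ (t, q', y - u)`. -/
def rosenCoordinates (Ψ : OpenPartialHomeomorph (ℝ × Q) (ℝ × Q')) (u : ℝ → Q → ℝ)
    (hu : ContinuousOn (fun z : ℝ × Q => u z.1 z.2) Ψ.source) :
    OpenPartialHomeomorph (ℝ × Q × ℝ) (ℝ × Q' × ℝ) where
  toFun x := ((Ψ (x.1, x.2.1)).1, (Ψ (x.1, x.2.1)).2, x.2.2 - u x.1 x.2.1)
  invFun x := ((Ψ.symm (x.1, x.2.1)).1, (Ψ.symm (x.1, x.2.1)).2,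
    x.2.2 + u (Ψ.symm (x.1, x.2.1)).1 (Ψ.symm (x.1, x.2.1)).2)
  source := {x | (x.1, x.2.1) ∈ Ψ.source}
  target := {x | (x.1, x.2.1) ∈ Ψ.target}
  map_source' x hx := Ψ.map_source hx
  map_target' x hx := Ψ.map_target hx
  left_inv' x hx := by simp [Ψ.left_inv (mem_ofPred.1 hx)]
  right_inv' x hx := by simp [Ψ.right_inv (mem_ofPred.1 hx)]
  open_source := Ψ.open_source.preimage (by fun_prop)
  open_target := Ψ.open_target.preimage (by fun_prop)
  continuousOn_toFun := by
    have hevent : ContinuousOn (fun x : ℝ × Q × ℝ => (x.1, x.2.1))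
        {x | (x.1, x.2.1) ∈ Ψ.source} := by fun_prop
    have hΨ := Ψ.continuousOn.comp hevent (fun x hx => hx)
    exact hΨ.fst.prodMk (hΨ.snd.prodMk
      ((by fun_prop : Continuous fun x : ℝ × Q × ℝ => x.2.2).continuousOn.sub
        (hu.comp hevent (fun x hx => hx))))
  continuousOn_invFun := by
    have hevent : ContinuousOn (fun x : ℝ × Q' × ℝ => (x.1, x.2.1))
        {x | (x.1, x.2.1) ∈ Ψ.target} := by fun_prop
    have hΨ := Ψ.symm.continuousOn.comp hevent (fun x hx => hx)
    exact hΨ.fst.prodMk (hΨ.snd.prodMk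
      ((by fun_prop : Continuous fun x : ℝ × Q' × ℝ => x.2.2).continuousOn.add
        (hu.comp hΨ fun x hx => Ψ.map_target hx)))

lemma spacetimeDeriv_rosenCoordinates {Ψ : OpenPartialHomeomorph (ℝ × Q) (ℝ × Q')}
    {u : ℝ → Q → ℝ} {hu : ContinuousOn (fun z : ℝ × Q => u z.1 z.2) Ψ.source}
    {x : ℝ × Q × ℝ} (hΨ : MDifferentiableAt (eventModel d) (eventModel d) Ψ (x.1, x.2.1))
    (hux : MDifferentiableAt (eventModel d) 𝓘(ℝ, ℝ) (fun z : ℝ × Q => u z.1 z.2) (x.1, x.2.1))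
    (X : 𝕋) :
    spacetimeDeriv (rosenCoordinates Ψ u hu) x X =
      ((eventDeriv (d := d) Ψ (x.1, x.2.1) (X.1, X.2.1)).1,
        (eventDeriv (d := d) Ψ (x.1, x.2.1) (X.1, X.2.1)).2,
        X.2.2 - eventDifferential (d := d) u (x.1, x.2.1) (X.1, X.2.1)) := by
  have hΨ' := hΨ.hasMFDerivAt.comp x (hasMFDerivAt_event x)
  exact congrArg (fun L : 𝕋 →L[ℝ] 𝕋 => L X) ((hasMFDerivAt_fst_comp hΨ').prodMk
    ((hasMFDerivAt_snd_comp hΨ').prodMk (hasMFDerivAt_sub_event hux))).mfderiv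

lemma image_event_rosenCoordinates_target {Ψ : OpenPartialHomeomorph (ℝ × Q) (ℝ × Q')}
    {u : ℝ → Q → ℝ} (hu : ContinuousOn (fun z : ℝ × Q => u z.1 z.2) Ψ.source) :
    (fun x : ℝ × Q' × ℝ => (x.1, x.2.1)) '' (rosenCoordinates Ψ u hu).target = Ψ.target :=
  Subset.antisymm (image_subset_iff.2 fun _ hx => hx) fun z hz => ⟨(z.1, z.2, 0), hz, rfl⟩

/-- The Brinkmann metric is a Rosen metric in the moving frame of velocity `Z`, the gradient of a
solution: the Hamilton-Jacobi equation completes the square. -/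
lemma brinkmann_eq_rosen_of_hamiltonJacobi {E : Type*} [NormedAddCommGroup E] [NormedSpace ℝ E]
    {a : E →L[ℝ] E →L[ℝ] ℝ} {b : E →L[ℝ] ℝ} {V : ℝ} {U : ℝ × E →L[ℝ] ℝ} {Z : E}
    (hsymm : ∀ v w, a v w = a w v) (hZ : ∀ v, a Z v = U (0, v) - b v)
    (heq : U (1, 0) + (1 / 2 * (U (0, Z) - b Z) + V) = 0) (X Y : ℝ × E × ℝ) :
    a X.2.1 Y.2.1 - X.1 * (Y.2.2 - b Y.2.1) - (X.2.2 - b X.2.1) * Y.1 - 2 * V * (X.1 * Y.1) =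
      a (X.2.1 - X.1 • Z) (Y.2.1 - Y.1 • Z)
        - X.1 * (Y.2.2 - U (Y.1, Y.2.1)) - (X.2.2 - U (X.1, X.2.1)) * Y.1 := by
  rw [map_prodMk_eq_smul_add U X.1, map_prodMk_eq_smul_add U Y.1]
  simp only [map_sub, map_smul, sub_apply, smul_apply, smul_eq_mul]
  rw [hsymm X.2.1 Z, hZ, hZ, hZ]
  linear_combination (-(2 * X.1 * Y.1)) * heq

namespace BrinkmannData

variable [IsManifold (𝓡 d) 1 Q] {r : ℕ∞}

/-- The velocity of the base characteristic of `u` through `z`. -/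
noncomputable def characteristicVelocity (D : BrinkmannData d Q r) (u : ℝ → Q → ℝ) (z : ℝ × Q) :
    𝔼 :=
  D.sharp z.1 z.2 (dq u z.1 z.2 - D.b z.1 z.2)

/-- The space metric `a_t` in the coordinates `(t, q')`. -/
noncomputable def pulledBackMetric (D : BrinkmannData d Q r)
    (Ψ : OpenPartialHomeomorph (ℝ × Q) (ℝ × Q')) : TimeBilin d Q' := fun t q' =>
  ContinuousLinearMap.bilinearComp (D.a t (Ψ.symm (t, q')).2 : 𝔼 →L[ℝ] 𝔼 →L[ℝ] ℝ)
    (spaceInverseDeriv (d := d) Ψ (t, q')) (spaceInverseDeriv (d := d) Ψ (t, q'))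

section CharacteristicVelocity

variable {D : BrinkmannData d Q r} {u : ℝ → Q → ℝ} {z : ℝ × Q}
  (hu : MDifferentiableAt (eventModel d) 𝓘(ℝ, ℝ) (fun z : ℝ × Q => u z.1 z.2) z)

include hu

lemma dq_sub_apply (v : 𝔼) :
    (dq u z.1 z.2 - D.b z.1 z.2 : TangentSpace (𝓡 d) z.2 →L[ℝ] ℝ) v =
      eventDifferential (d := d) u z (0, v) - D.b z.1 z.2 v :=
  congrArg (· - D.b z.1 z.2 v) (dq_apply_eq_eventDifferential hu v)

lemma a_characteristicVelocity (v : 𝔼) :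
    (D.a z.1 z.2 : 𝔼 →L[ℝ] 𝔼 →L[ℝ] ℝ) (D.characteristicVelocity u z) v =
      eventDifferential (d := d) u z (0, v) - D.b z.1 z.2 v :=
  (congrArg (fun L : 𝔼 →L[ℝ] ℝ => L v) (D.a_sharp z.1 z.2 _)).trans (dq_sub_apply hu v)

lemma hamiltonian_dq :
    D.hamiltonian z.1 z.2 (dq u z.1 z.2) =
      1 / 2 * (eventDifferential (d := d) u z (0, D.characteristicVelocity u z) -
        D.b z.1 z.2 (D.characteristicVelocity u z)) + D.V z.1 z.2 :=
  congrArg (1 / 2 * · + D.V z.1 z.2) (dq_sub_apply hu (D.characteristicVelocity u z))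

end CharacteristicVelocity

/-- The coordinates `(t, q')` of class `C^j` straighten the base characteristics of the `C^l`
solution `u`, which become the curves of constant `q'`. -/
structure IsCharacteristicCoordinates (D : BrinkmannData d Q r) (j l : ℕ∞)
    (Ψ : OpenPartialHomeomorph (ℝ × Q) (ℝ × Q')) (u : ℝ → Q → ℝ) : Prop where
  contMDiffOn : ContMDiffOn (eventModel d) (eventModel d) (j : WithTop ℕ∞) Ψ Ψ.source
  contMDiffOn_symm : ContMDiffOn (eventModel d) (eventModel d) (j : WithTop ℕ∞) Ψ.symm Ψ.target
  time : ∀ z ∈ Ψ.source, (Ψ z).1 = z.1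
  contMDiffOn_solution : ContMDiffOn (eventModel d) 𝓘(ℝ, ℝ) (l : WithTop ℕ∞)
    (fun z : ℝ × Q => u z.1 z.2) Ψ.source
  equation : ∀ z ∈ Ψ.source,
    deriv (fun s => u s z.2) z.1 + D.hamiltonian z.1 z.2 (dq u z.1 z.2) = 0
  eventDeriv_characteristic : ∀ z ∈ Ψ.source,
    eventDeriv (d := d) Ψ z (1, D.characteristicVelocity u z) = (1, 0)

namespace IsCharacteristicCoordinates

variable {D : BrinkmannData d Q r} {j l : ℕ∞} {Ψ : OpenPartialHomeomorph (ℝ × Q) (ℝ × Q')}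
  {u : ℝ → Q → ℝ} (h : D.IsCharacteristicCoordinates j l Ψ u) (hj : 1 ≤ j)

include h hj

lemma mdifferentiable : Ψ.MDifferentiable (eventModel d) (eventModel d) := by
  have hj' : (j : WithTop ℕ∞) ≠ 0 := by exact_mod_cast (zero_lt_one.trans_le hj).ne'
  exact ⟨h.contMDiffOn.mdifferentiableOn hj', h.contMDiffOn_symm.mdifferentiableOn hj'⟩

lemma eventDeriv_symm_zero_prodMk {z : ℝ × Q'} (hz : z ∈ Ψ.target) (v : 𝔼) :
    eventDeriv Ψ.symm z (0, v) = (0, spaceInverseDeriv (d := d) Ψ z v) := by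
  refine Prod.ext (eventDeriv_fst ((h.mdifferentiable hj).mdifferentiableAt_symm hz) ?_ _) rfl
  filter_upwards [Ψ.open_target.mem_nhds hz] with w hw
  rw [← h.time _ (Ψ.map_target hw), Ψ.right_inv hw]

lemma spaceInverseDeriv_injective {z : ℝ × Q'} (hz : z ∈ Ψ.target) :
    Function.Injective (spaceInverseDeriv (d := d) Ψ z) := by
  intro v w hvw
  have hinj : Function.Injective (eventDeriv (d := d) Ψ.symm z) :=
    (h.mdifferentiable hj).symm.mfderiv_injective hz
  have heq : ((0 : ℝ), v) = (0, w) := hinj <| by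
    rw [h.eventDeriv_symm_zero_prodMk hj hz, h.eventDeriv_symm_zero_prodMk hj hz, hvw]
  exact congrArg Prod.snd heq

lemma contMDiffOn_spaceInverseDeriv [IsManifold (𝓡 d) 1 Q'] :
    ContMDiffOn (𝓘(ℝ, ℝ).prod (𝓡 d).tangent) (𝓡 d).tangent ((j - 1 : ℕ∞) : WithTop ℕ∞)
      (fun p : ℝ × TangentBundle (𝓡 d) Q' => (⟨(Ψ.symm (p.1, p.2.proj)).2,
        spaceInverseDeriv (d := d) Ψ (p.1, p.2.proj) p.2.snd⟩ : TangentBundle (𝓡 d) Q))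
      {p | (p.1, p.2.proj) ∈ Ψ.target} := by
  refine (contMDiffOn_fibreDerivative Ψ.open_target
    (contMDiff_snd.comp_contMDiffOn h.contMDiffOn_symm)
    (by exact_mod_cast (tsub_add_cancel_of_le hj).le)).congr fun p hp => ?_
  exact congrArg (fun L : ℝ × 𝔼 →L[ℝ] 𝔼 =>
    (⟨(Ψ.symm (p.1, p.2.proj)).2, L (0, p.2.snd)⟩ : TangentBundle (𝓡 d) Q))
    (hasMFDerivAt_snd_comp
      ((h.mdifferentiable hj).mdifferentiableAt_symm hp).hasMFDerivAt).mfderiv.symm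

lemma isTimeMetricOn_pulledBackMetric [IsManifold (𝓡 d) 1 Q'] (hjr : j ≤ r + 1) :
    IsTimeMetricOn (j - 1) (D.pulledBackMetric Ψ) Ψ.target where
  symm t q' _ v w := D.isMetric.symm t (Ψ.symm (t, q')).2 trivial
    (spaceInverseDeriv (d := d) Ψ (t, q') v) (spaceInverseDeriv (d := d) Ψ (t, q') w)
  pos t q' hq' v hv := by
    have hne : spaceInverseDeriv (d := d) Ψ (t, q') v ≠ 0 := fun hzero =>
      hv (h.spaceInverseDeriv_injective hj hq' (hzero.trans (map_zero _).symm))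
    exact D.isMetric.pos t (Ψ.symm (t, q')).2 trivial
      (spaceInverseDeriv (d := d) Ψ (t, q') v) hne
  contMDiffOn := by
    have ha := D.isMetric.contMDiffOn.of_le
      (m := ((j - 1 : ℕ∞) : WithTop ℕ∞)) (by exact_mod_cast tsub_le_iff_right.2 hjr)
    have hcomp := ha.comp (contMDiffOn_fst.prodMk (h.contMDiffOn_spaceInverseDeriv hj))
      (fun _ _ => trivial)
    exact hcomp

lemma spaceInverseDeriv_eventDeriv {z : ℝ × Q} (hz : z ∈ Ψ.source) (X : ℝ × 𝔼) :
    spaceInverseDeriv Ψ (Ψ z) (eventDeriv (d := d) Ψ z X).2 =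
      X.2 - X.1 • D.characteristicVelocity u z := by
  set A := eventDeriv (d := d) Ψ z
  set Z := D.characteristicVelocity u z
  have htime : (A X).1 = X.1 := eventDeriv_fst ((h.mdifferentiable hj).mdifferentiableAt hz)
    (eventually_of_mem (Ψ.open_source.mem_nhds hz) h.time) X
  have hsplit : ((0 : ℝ), X.2 - X.1 • Z) = X - X.1 • ((1 : ℝ), Z) := by ext <;> simp
  have hA : A (0, X.2 - X.1 • Z) = (0, (A X).2) := by
    rw [hsplit, map_sub, map_smul, h.eventDeriv_characteristic z hz]
    ext <;> simp [htime]
  have hinverse : eventDeriv Ψ.symm (Ψ z) (A (0, X.2 - X.1 • Z)) = (0, X.2 - X.1 • Z) :=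
    congrArg (fun L : ℝ × 𝔼 →L[ℝ] ℝ × 𝔼 => L (0, X.2 - X.1 • Z))
      ((h.mdifferentiable hj).symm_comp_deriv hz)
  rw [hA, h.eventDeriv_symm_zero_prodMk hj (Ψ.map_source hz)] at hinverse
  exact congrArg Prod.snd hinverse

lemma pulledBackMetric_eventDeriv {z : ℝ × Q} (hz : z ∈ Ψ.source) (X Y : ℝ × 𝔼) :
    D.pulledBackMetric Ψ (Ψ z).1 (Ψ z).2 (eventDeriv (d := d) Ψ z X).2
      (eventDeriv (d := d) Ψ z Y).2 =
      (D.a z.1 z.2 : 𝔼 →L[ℝ] 𝔼 →L[ℝ] ℝ) (X.2 - X.1 • D.characteristicVelocity u z)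
        (Y.2 - Y.1 • D.characteristicVelocity u z) := by
  have hpoint : ((Ψ z).1, (Ψ.symm (Ψ z)).2) = z := by rw [Ψ.left_inv hz, h.time z hz]
  exact (congrArg₂ (fun v w : 𝔼 =>
      (D.a (Ψ z).1 (Ψ.symm (Ψ z)).2 : 𝔼 →L[ℝ] 𝔼 →L[ℝ] ℝ) v w)
      (h.spaceInverseDeriv_eventDeriv hj hz X) (h.spaceInverseDeriv_eventDeriv hj hz Y)).trans
    (congrArg (fun z' : ℝ × Q => (D.a z'.1 z'.2 : 𝔼 →L[ℝ] 𝔼 →L[ℝ] ℝ)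
      (X.2 - X.1 • D.characteristicVelocity u z) (Y.2 - Y.1 • D.characteristicVelocity u z)) hpoint)

variable (hjl : j ≤ l)

include hjl

lemma mdifferentiableAt_solution {z : ℝ × Q} (hz : z ∈ Ψ.source) :
    MDifferentiableAt (eventModel d) 𝓘(ℝ, ℝ) (fun z : ℝ × Q => u z.1 z.2) z :=
  (h.contMDiffOn_solution.contMDiffAt (Ψ.open_source.mem_nhds hz)).mdifferentiableAt
    (by exact_mod_cast (zero_lt_one.trans_le (hj.trans hjl)).ne')

omit hj in
lemma contMDiffOn_rosenCoordinates (hu : ContinuousOn (fun z : ℝ × Q => u z.1 z.2) Ψ.source) :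
    ContMDiffOn (spacetimeModel d) (spacetimeModel d) (j : WithTop ℕ∞)
      (rosenCoordinates Ψ u hu) (rosenCoordinates Ψ u hu).source := by
  have hevent := (contMDiff_event (d := d) (Q := Q)).contMDiffOn
    (s := (rosenCoordinates Ψ u hu).source) (n := j)
  have hΨ := h.contMDiffOn.comp hevent (fun x hx => hx)
  have hu' := h.contMDiffOn_solution.of_le (m := j) (by exact_mod_cast hjl)
  exact (contMDiff_fst.comp_contMDiffOn hΨ).prodMk ((contMDiff_snd.comp_contMDiffOn hΨ).prodMk
    ((contMDiff_snd.comp contMDiff_snd).contMDiffOn.sub (hu'.comp hevent (fun x hx => hx))))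

omit hj in
lemma contMDiffOn_rosenCoordinates_symm
    (hu : ContinuousOn (fun z : ℝ × Q => u z.1 z.2) Ψ.source) :
    ContMDiffOn (spacetimeModel d) (spacetimeModel d) (j : WithTop ℕ∞)
      (rosenCoordinates Ψ u hu).symm (rosenCoordinates Ψ u hu).target := by
  have hevent := (contMDiff_event (d := d) (Q := Q')).contMDiffOn
    (s := (rosenCoordinates Ψ u hu).target) (n := j)
  have hΨ := h.contMDiffOn_symm.comp hevent (fun x hx => hx)
  have hu' := h.contMDiffOn_solution.of_le (m := j) (by exact_mod_cast hjl)
  exact (contMDiff_fst.comp_contMDiffOn hΨ).prodMk ((contMDiff_snd.comp_contMDiffOn hΨ).prodMk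
    ((contMDiff_snd.comp contMDiff_snd).contMDiffOn.add
      (hu'.comp hΨ (fun x hx => Ψ.map_target hx))))

lemma metric_eq_rosenMetric (hu : ContinuousOn (fun z : ℝ × Q => u z.1 z.2) Ψ.source)
    {x : ℝ × Q × ℝ} (hx : (x.1, x.2.1) ∈ Ψ.source) (X Y : 𝕋) :
    D.metric x X Y = rosenMetric (D.pulledBackMetric Ψ) (rosenCoordinates Ψ u hu x)
      (spacetimeDeriv (rosenCoordinates Ψ u hu) x X)
      (spacetimeDeriv (rosenCoordinates Ψ u hu) x Y) := by
  set z := (x.1, x.2.1)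
  have hΨ := (h.mdifferentiable hj).mdifferentiableAt hx
  have huz := h.mdifferentiableAt_solution hj hjl hx
  have htime : ∀ X : ℝ × 𝔼, (eventDeriv (d := d) Ψ z X).1 = X.1 :=
    eventDeriv_fst hΨ (eventually_of_mem (Ψ.open_source.mem_nhds hx) h.time)
  have hHJ := h.equation z hx
  rw [deriv_eq_eventDifferential huz, hamiltonian_dq huz] at hHJ
  rw [spacetimeDeriv_rosenCoordinates hΨ huz, spacetimeDeriv_rosenCoordinates hΨ huz]
  change _ = D.pulledBackMetric Ψ (Ψ z).1 (Ψ z).2 (eventDeriv (d := d) Ψ z (X.1, X.2.1)).2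
    (eventDeriv (d := d) Ψ z (Y.1, Y.2.1)).2 -
    (eventDeriv (d := d) Ψ z (X.1, X.2.1)).1 * _ - _ * (eventDeriv (d := d) Ψ z (Y.1, Y.2.1)).1
  rw [h.pulledBackMetric_eventDeriv hj hx, htime, htime]
  exact brinkmann_eq_rosen_of_hamiltonJacobi (D.isMetric.symm z.1 z.2 trivial)
    (a_characteristicVelocity huz) hHJ X Y

theorem isRosen [IsManifold (𝓡 d) 1 Q'] (hjr : j ≤ r + 1) :
    D.IsRosen j l (rosenCoordinates Ψ u h.contMDiffOn_solution.continuousOn)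
      (D.pulledBackMetric Ψ) where
  contMDiffOn := h.contMDiffOn_rosenCoordinates hjl _
  contMDiffOn_symm := h.contMDiffOn_rosenCoordinates_symm hjl _
  contMDiffOn_y := (contMDiff_snd.comp contMDiff_snd).contMDiffOn.sub
    (h.contMDiffOn_solution.comp contMDiff_event.contMDiffOn (fun _ hx => hx))
  time _ hx := h.time _ hx
  killing x hx := by
    refine (spacetimeDeriv_rosenCoordinates ((h.mdifferentiable hj).mdifferentiableAt hx)
      (h.mdifferentiableAt_solution hj hjl hx) (0, 0, 1)).trans ?_
    rw [Prod.mk_zero_zero, map_zero, map_zero, sub_zero]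
    rfl
  isMetric := by
    rw [image_event_rosenCoordinates_target]
    exact h.isTimeMetricOn_pulledBackMetric hj hjr
  metric_eq _ hx X Y := h.metric_eq_rosenMetric hj hjl _ hx X Y

end IsCharacteristicCoordinates

end BrinkmannData

end RosenOfSolution

/-! ### Time dependent vector fields on manifolds -/

section ChartDifferentials

variable {E : Type*} [NormedAddCommGroup E] [NormedSpace ℝ E] {M : Type*} [TopologicalSpace M]
  [ChartedSpace E M]

/-- The differential at `q` of the preferred chart at `q₁`. Its type forgets the base point. -/
noncomputable def chartDeriv (q₁ q : M) : E →L[ℝ] E :=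
  mfderiv 𝓘(ℝ, E) 𝓘(ℝ, E) (chartAt E q₁) q

/-- The differential of the inverse of the preferred chart at `q₁`. Its type forgets the base
point. -/
noncomputable def chartSymmDeriv (q₁ : M) (x : E) : E →L[ℝ] E :=
  mfderiv 𝓘(ℝ, E) 𝓘(ℝ, E) (chartAt E q₁).symm x

variable [IsManifold 𝓘(ℝ, E) 1 M] {q₁ : M} {x : E}

lemma hasMFDerivAt_chart {q : M} (hq : q ∈ (chartAt E q₁).source) :
    HasMFDerivAt 𝓘(ℝ, E) 𝓘(ℝ, E) (chartAt E q₁) q (chartDeriv (E := E) q₁ q) :=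
  ((mdifferentiable_chart q₁).mdifferentiableAt hq).hasMFDerivAt

lemma hasMFDerivAt_chart_symm (hx : x ∈ (chartAt E q₁).target) :
    HasMFDerivAt 𝓘(ℝ, E) 𝓘(ℝ, E) (chartAt E q₁).symm x
      (chartSymmDeriv q₁ x : E →L[ℝ] E) :=
  ((mdifferentiable_chart q₁).mdifferentiableAt_symm hx).hasMFDerivAt

lemma chartDeriv_chartSymmDeriv (hx : x ∈ (chartAt E q₁).target) (v : E) :
    chartDeriv q₁ ((chartAt E q₁).symm x) (chartSymmDeriv q₁ x v) = v :=
  congrArg (fun L : E →L[ℝ] E => L v) ((mdifferentiable_chart q₁).comp_symm_deriv hx)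

lemma chartSymmDeriv_chartDeriv (hx : x ∈ (chartAt E q₁).target) (v : E) :
    chartSymmDeriv q₁ x (chartDeriv q₁ ((chartAt E q₁).symm x) v) = v := by
  have hinverse := (mdifferentiable_chart (I := 𝓘(ℝ, E)) q₁).symm_comp_deriv
    ((chartAt E q₁).map_target hx)
  rw [(chartAt E q₁).right_inv hx] at hinverse
  exact congrArg (fun L : E →L[ℝ] E => L v) hinverse

lemma bijective_chartSymmDeriv (hx : x ∈ (chartAt E q₁).target) :
    Function.Bijective (chartSymmDeriv q₁ x) :=
  Function.bijective_iff_has_inverse.2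
    ⟨_, chartDeriv_chartSymmDeriv hx, chartSymmDeriv_chartDeriv hx⟩

end ChartDifferentials

section Evolution

variable {E : Type*} [NormedAddCommGroup E] [NormedSpace ℝ E] {M : Type*} [TopologicalSpace M]
  [ChartedSpace E M]

/-- `γ` is, over the set of times `J`, an integral curve of the time dependent vector field `X`. -/
def IsEvolutionCurveOn (X : ℝ → (q : M) → TangentSpace 𝓘(ℝ, E) q) (J : Set ℝ) (γ : ℝ → M) : Prop :=
  ∀ t ∈ J, HasMFDerivAt 𝓘(ℝ, ℝ) 𝓘(ℝ, E) γ t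
    (ContinuousLinearMap.toSpanSingleton ℝ (X t (γ t)))

/-- The time dependent vector field `X` is of class `C^n` over `I × M`: its components in each of
the preferred charts are `C^n`. Charts rather than sections of the tangent bundle are used because
the components are `C^n` functions even on a manifold which is only `C^n`. -/
def IsTimeFieldOn (n : ℕ∞) (X : ℝ → (q : M) → TangentSpace 𝓘(ℝ, E) q) (I : Set ℝ) : Prop :=
  ∀ q₁ : M, ∃ f : ℝ × E → E, ContDiffOn ℝ n f (I ×ˢ (chartAt E q₁).target) ∧
    ∀ t ∈ I, ∀ x ∈ (chartAt E q₁).target,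
      chartSymmDeriv q₁ x (f (t, x)) = X t ((chartAt E q₁).symm x)

/-- `ψ s t q` is the position at time `s` of the integral curve of `X` that is at `q` at time `t`,
for `s` and `t` in `I`. -/
def IsEvolutionOn (X : ℝ → (q : M) → TangentSpace 𝓘(ℝ, E) q) (I : Set ℝ) (ψ : ℝ → ℝ → M → M) :
    Prop :=
  ∀ t ∈ I, ∀ q, IsEvolutionCurveOn X I (fun s => ψ s t q) ∧ ψ t t q = q

variable [IsManifold 𝓘(ℝ, E) 1 M] {X : ℝ → (q : M) → TangentSpace 𝓘(ℝ, E) q} {I J : Set ℝ} {n : ℕ∞}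

lemma hasDerivAt_chart_of_hasMFDerivAt {γ : ℝ → M} {t : ℝ} {q₁ : M}
    {w : TangentSpace 𝓘(ℝ, E) (γ t)}
    (hγ : HasMFDerivAt 𝓘(ℝ, ℝ) 𝓘(ℝ, E) γ t (ContinuousLinearMap.toSpanSingleton ℝ w))
    (hs : γ t ∈ (chartAt E q₁).source) :
    HasDerivAt (fun s => chartAt E q₁ (γ s)) (chartDeriv q₁ (γ t) w) t := by
  have hcomp := (hasMFDerivAt_chart hs).comp t hγ
  have hderiv : HasFDerivAt (fun s => chartAt E q₁ (γ s))
      (chartDeriv q₁ (γ t) ∘L ContinuousLinearMap.toSpanSingleton ℝ (w : E)) t := hcomp.hasFDerivAt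
  refine hderiv.hasDerivAt.congr_deriv ?_
  exact congrArg (chartDeriv q₁ (γ t)) (one_smul ℝ (w : E))

lemma hasMFDerivAt_chart_symm_of_hasDerivAt {x : ℝ → E} {t : ℝ} {q₁ : M} {v : E}
    (hx : HasDerivAt x v t) (hs : x t ∈ (chartAt E q₁).target) :
    HasMFDerivAt 𝓘(ℝ, ℝ) 𝓘(ℝ, E) (fun s => (chartAt E q₁).symm (x s)) t
      (ContinuousLinearMap.toSpanSingleton ℝ (chartSymmDeriv q₁ (x t) v)) :=
  ((hasMFDerivAt_chart_symm hs).comp t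
    (hasMFDerivAt_iff_hasFDerivAt.2 hx.hasFDerivAt)).congr_mfderiv
      (ContinuousLinearMap.ext_ring (map_smul (chartSymmDeriv q₁ (x t)) (1 : ℝ) v))

namespace IsEvolutionCurveOn

variable {γ γ' : ℝ → M} {t : ℝ}

omit [IsManifold 𝓘(ℝ, E) 1 M] in
lemma mono (hγ : IsEvolutionCurveOn X I γ) (hJ : J ⊆ I) : IsEvolutionCurveOn X J γ :=
  fun t ht => hγ t (hJ ht)

lemma hasDerivAt_chart (hγ : IsEvolutionCurveOn X J γ) (ht : t ∈ J) {q₁ : M} {f : ℝ × E → E}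
    (hf : ∀ x ∈ (chartAt E q₁).target,
      chartSymmDeriv q₁ x (f (t, x)) = X t ((chartAt E q₁).symm x))
    (hs : γ t ∈ (chartAt E q₁).source) :
    HasDerivAt (fun s => chartAt E q₁ (γ s)) (f (t, chartAt E q₁ (γ t))) t := by
  have hmap := (chartAt E q₁).map_source hs
  have hvelocity := chartDeriv_chartSymmDeriv hmap (f (t, chartAt E q₁ (γ t)))
  rw [hf _ hmap, (chartAt E q₁).left_inv hs] at hvelocity
  exact (hasDerivAt_chart_of_hasMFDerivAt (hγ t ht) hs).congr_deriv hvelocity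

lemma eventuallyEq (hI : IsOpen I) (hn : 1 ≤ n) (hX : IsTimeFieldOn n X I)
    (hγ : IsEvolutionCurveOn X J γ) (hγ' : IsEvolutionCurveOn X J γ') (hJ : IsOpen J)
    (hJI : J ⊆ I) (ht : t ∈ J) (h : γ t = γ' t) : γ =ᶠ[𝓝 t] γ' := by
  obtain ⟨f, hf, hfX⟩ := hX (γ t)
  set c := chartAt E (γ t)
  have hct : γ t ∈ c.source := mem_chart_source E (γ t)
  have hnhds : I ×ˢ c.target ∈ 𝓝 (t, c (γ t)) :=
    (hI.prod c.open_target).mem_nhds ⟨hJI ht, c.map_source hct⟩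
  obtain ⟨K, N, hN, hK⟩ := ((hf.contDiffAt hnhds).of_le
    (by exact_mod_cast hn)).exists_lipschitzOnWith
  obtain ⟨N₁, hN₁, N₂, hN₂, hNN⟩ := mem_nhds_prod_iff.1 hN
  have hsource {γ'' : ℝ → M} (hγ'' : IsEvolutionCurveOn X J γ'') (heq : γ'' t = γ t) :
      ∀ᶠ s in 𝓝 t, γ'' s ∈ c.source :=
    (hγ'' t ht).continuousAt.eventually_mem (c.open_source.mem_nhds (heq ▸ hct))
  have hode {γ'' : ℝ → M} (hγ'' : IsEvolutionCurveOn X J γ'') (heq : γ'' t = γ t) :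
      ∀ᶠ s in 𝓝 t, HasDerivAt (fun s => c (γ'' s)) (f (s, c (γ'' s))) s ∧ c (γ'' s) ∈ N₂ := by
    have hcont : ContinuousAt (fun s => c (γ'' s)) t :=
      ContinuousAt.comp (c.continuousAt (heq ▸ hct)) (hγ'' t ht).continuousAt
    filter_upwards [hsource hγ'' heq, hJ.mem_nhds ht, hcont.eventually_mem (heq ▸ hN₂)]
      with s hs hsJ hsN using ⟨hγ''.hasDerivAt_chart hsJ (hfX s (hJI hsJ)) hs, hsN⟩
  have hLipschitz : ∀ᶠ s in 𝓝 t, LipschitzOnWith K (fun x => f (s, x)) N₂ := by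
    filter_upwards [hN₁] with s hs
    exact mul_one K ▸ hK.comp (LipschitzWith.prodMk_left s).lipschitzOnWith
      (fun x hx => hNN ⟨hs, hx⟩)
  filter_upwards [ODE_solution_unique_of_eventually hLipschitz (hode hγ rfl) (hode hγ' h.symm)
    (congrArg c h), hsource hγ rfl, hsource hγ' h.symm] with s hs hsγ hsγ'
  exact c.injOn hsγ hsγ' hs

lemma eqOn [T2Space M] (hI : IsOpen I) (hn : 1 ≤ n) (hX : IsTimeFieldOn n X I)
    (hγ : IsEvolutionCurveOn X J γ) (hγ' : IsEvolutionCurveOn X J γ') (hJ : IsOpen J)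
    (hJc : J.OrdConnected) (hJI : J ⊆ I) (ht : t ∈ J) (h : γ t = γ' t) : EqOn γ γ' J := by
  intro s hs
  refine (hJc.isPreconnected.induction₂ (fun x y => γ x = γ' x ↔ γ y = γ' y) (fun x hx => ?_)
    (fun _ _ _ _ _ _ => Iff.trans) (fun _ _ _ _ => Iff.symm) ht hs).1 h
  refine mem_nhdsWithin_of_mem_nhds ?_
  by_cases hxx : γ x = γ' x
  · filter_upwards [hγ.eventuallyEq hI hn hX hγ' hJ hJI hx hxx] with y hy
    exact iff_of_true hxx hy
  · filter_upwards [((hγ x hx).continuousAt.ne_iff_eventually_ne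
      (hγ' x hx).continuousAt).1 hxx] with y hy
    exact iff_of_false hxx hy

end IsEvolutionCurveOn

local notation "𝓔" => ModelWithCorners.prod 𝓘(ℝ, ℝ) (ModelWithCorners.prod 𝓘(ℝ, ℝ) 𝓘(ℝ, E))

lemma IsTimeFieldOn.exists_localEvolution [FiniteDimensional ℝ E] [IsManifold 𝓘(ℝ, E) n M]
    (hI : IsOpen I) (hn : 1 ≤ n) (hX : IsTimeFieldOn n X I) {t₁ : ℝ} (ht₁ : t₁ ∈ I) (q₁ : M) :
    ∃ θ : ℝ × ℝ × M → M, ∀ᶠ p in 𝓝 (t₁, t₁, q₁),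
      ContMDiffAt 𝓔 𝓘(ℝ, E) n θ p ∧ θ (p.2.1, p.2) = p.2.2 ∧
      HasMFDerivAt 𝓘(ℝ, ℝ) 𝓘(ℝ, E) (fun s => θ (s, p.2)) p.1
        (ContinuousLinearMap.toSpanSingleton ℝ (X p.1 (θ p))) := by
  obtain ⟨f, hf, hfX⟩ := hX q₁
  set c := chartAt E q₁
  have hq₁ : q₁ ∈ c.source := mem_chart_source E q₁
  have hmem : I ×ˢ c.target ∈ 𝓝 (t₁, c q₁) :=
    (hI.prod c.open_target).mem_nhds ⟨ht₁, c.map_source hq₁⟩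
  obtain ⟨φ, hφ⟩ := exists_contDiffAt_evolution hn (t₀ := t₁) (x₀ := c q₁)
    ((eventually_mem_nhds_iff.2 hmem).mono fun z hz => hf.contDiffAt hz)
  obtain ⟨hφ_smooth, hφ_initial, -⟩ := hφ.self_of_nhds
  have htarget : ∀ᶠ z in 𝓝 (t₁, t₁, c q₁), φ z ∈ c.target :=
    hφ_smooth.continuousAt.eventually_mem
      (c.open_target.mem_nhds (hφ_initial ▸ c.map_source hq₁))
  have hchart : ContinuousAt (fun p : ℝ × ℝ × M => (p.1, p.2.1, c p.2.2)) (t₁, t₁, q₁) :=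
    continuousAt_fst.prodMk ((continuousAt_fst.comp continuousAt_snd).prodMk
      (ContinuousAt.comp (f := fun p : ℝ × ℝ × M => p.2.2) (c.continuousAt hq₁)
        (continuousAt_snd.comp continuousAt_snd)))
  refine ⟨fun p => c.symm (φ (p.1, p.2.1, c p.2.2)), ?_⟩
  have htime : ∀ᶠ p : ℝ × ℝ × M in 𝓝 (t₁, t₁, q₁), p.1 ∈ I :=
    continuousAt_fst.eventually_mem (hI.mem_nhds ht₁)
  have hsource : ∀ᶠ p : ℝ × ℝ × M in 𝓝 (t₁, t₁, q₁), p.2.2 ∈ c.source :=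
    (continuousAt_snd.comp continuousAt_snd).eventually_mem (c.open_source.mem_nhds hq₁)
  filter_upwards [hchart.eventually hφ, hchart.eventually htarget, htime, hsource]
    with p ⟨hsmooth, hinitial, hode⟩ hpt hpI hps
  refine ⟨?_, by simp only [hinitial, c.left_inv hps], ?_⟩
  · have hp : ContMDiffAt 𝓔 𝓘(ℝ, ℝ × ℝ × E) n (fun p : ℝ × ℝ × M => (p.1, p.2.1, c p.2.2)) p :=
      contMDiffAt_fst.prodMk_space ((contMDiffAt_fst.comp p contMDiffAt_snd).prodMk_space
        ((contMDiffOn_chart.contMDiffAt (c.open_source.mem_nhds hps)).comp p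
          (contMDiffAt_snd.comp p contMDiffAt_snd)))
    exact (contMDiffOn_chart_symm.contMDiffAt (c.open_target.mem_nhds hpt)).comp p
      (hsmooth.contMDiffAt.comp p hp)
  · refine (hasMFDerivAt_chart_symm_of_hasDerivAt hode hpt).congr_mfderiv ?_
    exact congrArg (fun w : E => ContinuousLinearMap.toSpanSingleton ℝ w) (hfX _ hpI _ hpt)

namespace IsEvolutionOn

variable [T2Space M] {ψ : ℝ → ℝ → M → M} {s t t' : ℝ}

lemma comp (hI : IsOpen I) (hIc : I.OrdConnected) (hn : 1 ≤ n) (hX : IsTimeFieldOn n X I)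
    (hψ : IsEvolutionOn X I ψ) (hs : s ∈ I) (ht : t ∈ I) (ht' : t' ∈ I) (q : M) :
    ψ s t' (ψ t' t q) = ψ s t q :=
  (hψ t' ht' _).1.eqOn hI hn hX (hψ t ht q).1 hI hIc Subset.rfl ht'
    (hψ t' ht' (ψ t' t q)).2 hs

lemma eventually_contMDiffAt_diagonal [FiniteDimensional ℝ E] [IsManifold 𝓘(ℝ, E) n M]
    (hI : IsOpen I) (hn : 1 ≤ n) (hX : IsTimeFieldOn n X I)
    (hψ : IsEvolutionOn X I ψ) (ht : t ∈ I) (q : M) :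
    ∀ᶠ p in 𝓝 (t, t, q), ContMDiffAt 𝓔 𝓘(ℝ, E) n (fun p => ψ p.1 p.2.1 p.2.2) p := by
  obtain ⟨θ, hθ⟩ := hX.exists_localEvolution hI hn ht q
  obtain ⟨A, hA, B, hB, hAB⟩ := mem_nhds_prod_iff.1 hθ
  obtain ⟨A', hA', U, hU, hAU⟩ := mem_nhds_prod_iff.1 hB
  obtain ⟨ε, hε, hball⟩ := Metric.mem_nhds_iff.1
    (inter_mem (inter_mem hA hA') (hI.mem_nhds ht))
  have hballI : Metric.ball t ε ⊆ I := hball.trans inter_subset_right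
  have hflow {s t' : ℝ} {q' : M} (hs : s ∈ Metric.ball t ε) (ht' : t' ∈ Metric.ball t ε)
      (hq' : q' ∈ U) := hAB (mk_mem_prod (hball hs).1.1 (hAU (mk_mem_prod (hball ht').1.2 hq')))
  have heq : (fun p : ℝ × ℝ × M => ψ p.1 p.2.1 p.2.2) =ᶠ[𝓝 (t, t, q)] θ := by
    filter_upwards [prod_mem_nhds (Metric.ball_mem_nhds t hε)
      (prod_mem_nhds (Metric.ball_mem_nhds t hε) hU)]
    rintro ⟨s, t', q'⟩ ⟨hs, ht', hq'⟩
    have hθ_curve : IsEvolutionCurveOn X (Metric.ball t ε) (fun s => θ (s, t', q')) :=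
      fun s hs => (hflow hs ht' hq').2.2
    exact ((hψ t' (hballI ht') q').1.mono hballI).eqOn hI hn hX hθ_curve Metric.isOpen_ball
      (convex_ball t ε).ordConnected hballI ht'
      ((hψ t' (hballI ht') q').2.trans (hflow hs ht' hq').2.1.symm) hs
  filter_upwards [hθ, heq.eventually_nhds] with p hp hpeq using hp.1.congr_of_eventuallyEq hpeq

lemma contMDiffAt_trans (hI : IsOpen I) (hIc : I.OrdConnected) (hn : 1 ≤ n)
    (hX : IsTimeFieldOn n X I) (hψ : IsEvolutionOn X I ψ) (hs : s ∈ I) (ht : t ∈ I) (ht' : t' ∈ I)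
    {q : M} (hψt' : ContMDiffAt 𝓔 𝓘(ℝ, E) n (fun p => ψ p.1 p.2.1 p.2.2) (t', t, q))
    (hψs : ContMDiffAt 𝓔 𝓘(ℝ, E) n (fun p => ψ p.1 p.2.1 p.2.2) (s, t', ψ t' t q)) :
    ContMDiffAt 𝓔 𝓘(ℝ, E) n (fun p => ψ p.1 p.2.1 p.2.2) (s, t, q) := by
  have hinner : ContMDiffAt 𝓔 𝓘(ℝ, E) n (fun p : ℝ × ℝ × M => ψ t' p.2.1 p.2.2) (s, t, q) :=
    ContMDiffAt.comp (s, t, q) (f := fun p : ℝ × ℝ × M => (t', p.2.1, p.2.2)) hψt'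
      (contMDiffAt_const.prodMk contMDiffAt_snd)
  have hcomp : ContMDiffAt 𝓔 𝓘(ℝ, E) n
      (fun p : ℝ × ℝ × M => ψ p.1 t' (ψ t' p.2.1 p.2.2)) (s, t, q) :=
    ContMDiffAt.comp (s, t, q) (f := fun p : ℝ × ℝ × M => (p.1, t', ψ t' p.2.1 p.2.2)) hψs
      (contMDiffAt_fst.prodMk (contMDiffAt_const.prodMk hinner))
  refine hcomp.congr_of_eventuallyEq ?_
  filter_upwards [prod_mem_nhds (hI.mem_nhds hs) (prod_mem_nhds (hI.mem_nhds ht) univ_mem)]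
    with p hp using (hψ.comp hI hIc hn hX hp.1 hp.2.1 ht' p.2.2).symm

/-- By `contMDiffAt_trans` the set of times `s` at which the conclusion holds is both open and
closed in `I`. -/
theorem contMDiffAt [FiniteDimensional ℝ E] [IsManifold 𝓘(ℝ, E) n M] (hI : IsOpen I)
    (hIc : I.OrdConnected) (hn : 1 ≤ n) (hX : IsTimeFieldOn n X I) (hψ : IsEvolutionOn X I ψ)
    (hs : s ∈ I) (ht : t ∈ I) (q : M) :
    ContMDiffAt 𝓔 𝓘(ℝ, E) n (fun p => ψ p.1 p.2.1 p.2.2) (s, t, q) := by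
  refine hIc.isPreconnected.induction₂ (fun x y =>
    ContMDiffAt 𝓔 𝓘(ℝ, E) n (fun p : ℝ × ℝ × M => ψ p.1 p.2.1 p.2.2) (x, t, q) ↔
      ContMDiffAt 𝓔 𝓘(ℝ, E) n (fun p => ψ p.1 p.2.1 p.2.2) (y, t, q)) (fun x hx => ?_)
    (fun _ _ _ _ _ _ => Iff.trans) (fun _ _ _ _ => Iff.symm) ht hs |>.1
    (hψ.eventually_contMDiffAt_diagonal hI hn hX ht q |>.self_of_nhds |> (by
      simpa only [(hψ t ht q).2] using ·))
  have hdiagonal := hψ.eventually_contMDiffAt_diagonal hI hn hX hx (ψ x t q)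
  have hcurve : ContinuousAt (fun y => ψ y t q) x := ((hψ t ht q).1 x hx).continuousAt
  refine mem_nhdsWithin_of_mem_nhds ?_
  filter_upwards [hI.mem_nhds hx,
    (continuousAt_id.prodMk (continuousAt_const (y := (x, ψ x t q)))).eventually hdiagonal,
    ((continuousAt_const (y := x)).prodMk (continuousAt_id.prodMk hcurve)).eventually hdiagonal]
    with y hy hxy hyx
  exact ⟨fun h => hψ.contMDiffAt_trans hI hIc hn hX hy ht hx h hxy,
    fun h => hψ.contMDiffAt_trans hI hIc hn hX hx ht hy h hyx⟩

end IsEvolutionOn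

end Evolution

/-! ### The Hamiltonian in local coordinates -/

section Legendre

variable {E : Type u} [NormedAddCommGroup E] [NormedSpace ℝ E]

/-- The velocity `A⁻¹(p - b)` that the Legendre transformation of the Lagrangian
`A(v, v) / 2 + b(v) - V` attaches to the momentum `p`, as a function of `(t, x, p)`. -/
noncomputable def legendreVelocity (A : ℝ × E → E →L[ℝ] E →L[ℝ] ℝ) (b : ℝ × E → E →L[ℝ] ℝ)
    (w : ℝ × E × (E →L[ℝ] ℝ)) : E :=
  (A (w.1, w.2.1)).inverse (w.2.2 - b (w.1, w.2.1))

/-- The Hamiltonian `A⁻¹(p - b, p - b) / 2 + V` as a function of `(t, x, p)`. -/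
noncomputable def legendreHamiltonian (A : ℝ × E → E →L[ℝ] E →L[ℝ] ℝ) (b : ℝ × E → E →L[ℝ] ℝ)
    (V : ℝ × E → ℝ) (w : ℝ × E × (E →L[ℝ] ℝ)) : ℝ :=
  1 / 2 * (w.2.2 - b (w.1, w.2.1)) (legendreVelocity A b w) + V (w.1, w.2.1)

lemma apply_inverse_comm {B : E →L[ℝ] E →L[ℝ] ℝ} (hB : B.IsInvertible)
    (hsymm : ∀ v w, B v w = B w v) (α β : E →L[ℝ] ℝ) : α (B.inverse β) = β (B.inverse α) := by
  conv_lhs => rw [← hB.self_apply_inverse α]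
  conv_rhs => rw [← hB.self_apply_inverse β]
  exact hsymm _ _

variable [FiniteDimensional ℝ E] {A : ℝ × E → E →L[ℝ] E →L[ℝ] ℝ} {b : ℝ × E → E →L[ℝ] ℝ}
  {V : ℝ × E → ℝ} {O : Set (ℝ × E)} {n : WithTop ℕ∞} {m : ℕ∞}

lemma contDiffOn_legendreVelocity (hA : ContDiffOn ℝ n A O) (hb : ContDiffOn ℝ n b O)
    (hpos : ∀ z ∈ O, ∀ v, v ≠ 0 → 0 < A z v v) :
    ContDiffOn ℝ n (legendreVelocity A b) {w | (w.1, w.2.1) ∈ O} := by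
  have : CompleteSpace E := FiniteDimensional.complete ℝ E
  have hevent : ContDiff ℝ n (fun w : ℝ × E × (E →L[ℝ] ℝ) => (w.1, w.2.1)) := by fun_prop
  have hmomentum : ContDiff ℝ n (fun w : ℝ × E × (E →L[ℝ] ℝ) => w.2.2) := by fun_prop
  have hinverse : ContDiffOn ℝ n (fun z => (A z).inverse) O := fun z hz =>
    (isInvertible_of_apply_self_pos (hpos z hz)).contDiffAt_map_inverse.comp_contDiffWithinAt
      z (hA z hz)
  exact (hinverse.comp hevent.contDiffOn (fun w hw => hw)).clm_apply
    (hmomentum.contDiffOn.sub (hb.comp hevent.contDiffOn (fun w hw => hw)))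

lemma contDiffOn_legendreHamiltonian (hA : ContDiffOn ℝ n A O) (hb : ContDiffOn ℝ n b O)
    (hV : ContDiffOn ℝ n V O) (hpos : ∀ z ∈ O, ∀ v, v ≠ 0 → 0 < A z v v) :
    ContDiffOn ℝ n (legendreHamiltonian A b V) {w | (w.1, w.2.1) ∈ O} := by
  have hevent : ContDiff ℝ n (fun w : ℝ × E × (E →L[ℝ] ℝ) => (w.1, w.2.1)) := by fun_prop
  have hmomentum : ContDiff ℝ n (fun w : ℝ × E × (E →L[ℝ] ℝ) => w.2.2) := by fun_prop
  exact (contDiffOn_const.mul ((hmomentum.contDiffOn.sub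
    (hb.comp hevent.contDiffOn (fun w hw => hw))).clm_apply
    (contDiffOn_legendreVelocity hA hb hpos))).add (hV.comp hevent.contDiffOn (fun w hw => hw))

omit [FiniteDimensional ℝ E] in
lemma fderiv_legendreHamiltonian {w : ℝ × E × (E →L[ℝ] ℝ)}
    (hH : DifferentiableAt ℝ (legendreHamiltonian A b V) w)
    (hA : (A (w.1, w.2.1)).IsInvertible)
    (hsymm : ∀ v v', A (w.1, w.2.1) v v' = A (w.1, w.2.1) v' v) (π : E →L[ℝ] ℝ) :
    fderiv ℝ (legendreHamiltonian A b V) w (0, 0, π) = π (legendreVelocity A b w) := by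
  obtain ⟨t, x, p⟩ := w
  have hmomentum : HasDerivAt (fun s : ℝ => p + s • π - b (t, x)) π 0 := by
    simpa using (((hasDerivAt_id (0 : ℝ)).smul_const π).const_add p).sub_const (b (t, x))
  have hline : HasDerivAt (fun s : ℝ => ((t, x, p + s • π) : ℝ × E × (E →L[ℝ] ℝ))) (0, 0, π) 0 :=
    (hasDerivAt_const _ _).prodMk ((hasDerivAt_const _ _).prodMk
      (by simpa using ((hasDerivAt_id (0 : ℝ)).smul_const π).const_add p))
  have hHline := HasFDerivAt.comp_hasDerivAt (l := legendreHamiltonian A b V)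
    (l' := fderiv ℝ (legendreHamiltonian A b V) (t, x, p)) 0
    (by simpa using hH.hasFDerivAt) hline
  have hquadratic : HasDerivAt
      (fun s : ℝ => legendreHamiltonian A b V (t, x, p + s • π))
      (π (legendreVelocity A b (t, x, p))) 0 := by
    refine (((hmomentum.clm_apply ((A (t, x)).inverse.hasFDerivAt.comp_hasDerivAt 0
      hmomentum)).const_mul (1 / 2)).add_const (V (t, x))).congr_deriv ?_
    rw [apply_inverse_comm hA hsymm _ π]
    simp only [Function.comp_apply, zero_smul, add_zero, legendreVelocity]
    ring
  exact hHline.unique hquadratic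

lemma isHamiltonianOn_legendreHamiltonian (hO : IsOpen O) (hA : ContDiffOn ℝ (m + 1) A O)
    (hb : ContDiffOn ℝ (m + 1) b O) (hV : ContDiffOn ℝ (m + 1) V O)
    (hsymm : ∀ z ∈ O, ∀ v w, A z v w = A z w v) (hpos : ∀ z ∈ O, ∀ v, v ≠ 0 → 0 < A z v v) :
    IsHamiltonianOn m {w | (w.1, w.2.1) ∈ O} (legendreHamiltonian A b V)
      (legendreVelocity A b) := by
  have hopen : IsOpen {w : ℝ × E × (E →L[ℝ] ℝ) | (w.1, w.2.1) ∈ O} := hO.preimage (by fun_prop)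
  have hH := contDiffOn_legendreHamiltonian hA hb hV hpos
  exact
  { isOpen := hopen
    contDiffOn := hH
    contDiffOn_velocity := (contDiffOn_legendreVelocity hA hb hpos).of_le le_self_add
    fderiv_momentum := fun w hw π => fderiv_legendreHamiltonian
      ((hH.contDiffAt (hopen.mem_nhds hw)).differentiableAt (by simp))
      (isInvertible_of_apply_self_pos (hpos _ hw)) (hsymm _ hw) π }

end Legendre

section EventChart

variable {d : ℕ} {Q : Type*} [TopologicalSpace Q] [ChartedSpace (EuclideanSpace ℝ (Fin d)) Q]

local notation "𝔼" => EuclideanSpace ℝ (Fin d)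

lemma contMDiffOn_eventModel_of_contDiffOn {F : Type*} [NormedAddCommGroup F] [NormedSpace ℝ F]
    {n : WithTop ℕ∞} {f : ℝ × 𝔼 → F} {S : Set (ℝ × 𝔼)} (hf : ContDiffOn ℝ n f S) :
    ContMDiffOn (eventModel d) 𝓘(ℝ, F) n f S := by
  have h := hf.contMDiffOn
  rw [modelWithCornersSelf_prod, ← chartedSpaceSelf_prod] at h
  exact h

lemma contMDiffOn_eventModel_prod {n : WithTop ℕ∞} {f : ℝ × 𝔼 → ℝ × 𝔼} {S : Set (ℝ × 𝔼)}
    (hf : ContDiffOn ℝ n f S) : ContMDiffOn (eventModel d) (eventModel d) n f S :=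
  (contMDiffOn_eventModel_of_contDiffOn hf.fst).prodMk
    (contMDiffOn_eventModel_of_contDiffOn hf.snd)

/-- The chart of `ℝ × Q` which keeps the time and whose space part is the preferred chart of `Q`
at `q₁`. -/
noncomputable def eventChart (q₁ : Q) : OpenPartialHomeomorph (ℝ × Q) (ℝ × 𝔼) :=
  (OpenPartialHomeomorph.refl ℝ).prod (chartAt 𝔼 q₁)

variable {q₁ : Q}

lemma contMDiffOn_eventChart {n : WithTop ℕ∞} [IsManifold (𝓡 d) n Q] :
    ContMDiffOn (eventModel d) (eventModel d) n (eventChart (d := d) q₁)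
      (eventChart (d := d) q₁).source :=
  contMDiffOn_fst.prodMk ((contMDiffOn_chart (I := 𝓡 d)).comp contMDiffOn_snd fun _ hz => hz.2)

lemma contMDiffOn_eventChart_symm {n : WithTop ℕ∞} [IsManifold (𝓡 d) n Q] :
    ContMDiffOn (eventModel d) (eventModel d) n (eventChart (d := d) q₁).symm
      (eventChart (d := d) q₁).target :=
  contMDiffOn_fst.prodMk ((contMDiffOn_chart_symm (I := 𝓡 d)).comp contMDiffOn_snd
    fun _ hz => hz.2)

lemma contDiffOn_comp_eventChart_symm {F : Type*} [NormedAddCommGroup F] [NormedSpace ℝ F]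
    {n : WithTop ℕ∞} [IsManifold (𝓡 d) n Q] {f : ℝ × Q → F} {S : Set (ℝ × Q)} {S' : Set (ℝ × 𝔼)}
    (hf : ContMDiffOn (eventModel d) 𝓘(ℝ, F) n f S) (htarget : S' ⊆ (eventChart q₁).target)
    (hS : MapsTo (eventChart q₁).symm S' S) : ContDiffOn ℝ n (f ∘ (eventChart q₁).symm) S' := by
  have hcomp := hf.comp (contMDiffOn_eventChart_symm.mono htarget) hS
  rw [eventModel, chartedSpaceSelf_prod, ← modelWithCornersSelf_prod] at hcomp
  exact hcomp.contDiffOn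

variable [IsManifold (𝓡 d) 1 Q] {t : ℝ} {x : EuclideanSpace ℝ (Fin d)}

lemma hasMFDerivAt_comp_eventChart {F : Type*} [NormedAddCommGroup F] [NormedSpace ℝ F]
    {f : ℝ × 𝔼 → F} {L : ℝ × 𝔼 →L[ℝ] F} (hx : x ∈ (chartAt 𝔼 q₁).target)
    (hf : HasFDerivAt f L (t, x)) :
    HasMFDerivAt (eventModel d) 𝓘(ℝ, F) (fun z : ℝ × Q => f (eventChart q₁ z))
      (t, (chartAt 𝔼 q₁).symm x)
      (L ∘L (ContinuousLinearMap.fst ℝ ℝ 𝔼).prod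
        (chartDeriv q₁ ((chartAt 𝔼 q₁).symm x) ∘L ContinuousLinearMap.snd ℝ ℝ 𝔼)) := by
  set q := (chartAt 𝔼 q₁).symm x
  have hchart := (hasMFDerivAt_fst (I := 𝓘(ℝ, ℝ)) (I' := 𝓡 d) (t, q)).prodMk
    ((hasMFDerivAt_chart ((chartAt 𝔼 q₁).map_target hx)).comp (t, q)
      (hasMFDerivAt_snd (I := 𝓘(ℝ, ℝ)) (I' := 𝓡 d) (t, q)))
  have hf' : HasFDerivAt f L (t, chartAt 𝔼 q₁ q) := by rwa [(chartAt 𝔼 q₁).right_inv hx]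
  have houter := hasMFDerivAt_iff_hasFDerivAt.2 hf'
  rw [modelWithCornersSelf_prod, ← chartedSpaceSelf_prod] at houter
  exact houter.comp (t, q) hchart

lemma mdifferentiableAt_comp_eventChart {f : ℝ × 𝔼 → ℝ} {L : ℝ × 𝔼 →L[ℝ] ℝ}
    (hx : x ∈ (chartAt 𝔼 q₁).target) (hf : HasFDerivAt f L (t, x)) :
    MDifferentiableAt (eventModel d) 𝓘(ℝ, ℝ) (fun z : ℝ × Q => f (eventChart q₁ z))
      (t, (chartAt 𝔼 q₁).symm x) :=
  (hasMFDerivAt_comp_eventChart hx hf).mdifferentiableAt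

lemma eventDifferential_comp_eventChart {f : ℝ × 𝔼 → ℝ} {L : ℝ × 𝔼 →L[ℝ] ℝ}
    (hx : x ∈ (chartAt 𝔼 q₁).target) (hf : HasFDerivAt f L (t, x)) (τ : ℝ) (v : 𝔼) :
    eventDifferential (d := d) (fun t q => f (eventChart q₁ (t, q))) (t, (chartAt 𝔼 q₁).symm x)
      (τ, chartSymmDeriv q₁ x v) = L (τ, v) :=
  (congrArg (fun L' : ℝ × 𝔼 →L[ℝ] ℝ => L' (τ, chartSymmDeriv q₁ x v))
    (hasMFDerivAt_comp_eventChart hx hf).mfderiv).trans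
    (congrArg (fun w => L (τ, w)) (chartDeriv_chartSymmDeriv hx v))

lemma eventDeriv_comp_eventChart {f : ℝ × 𝔼 → ℝ × 𝔼} {L : ℝ × 𝔼 →L[ℝ] ℝ × 𝔼}
    (hx : x ∈ (chartAt 𝔼 q₁).target) (hf : HasFDerivAt f L (t, x)) (τ : ℝ) (v : 𝔼) :
    eventDeriv (d := d) (fun z : ℝ × Q => f (eventChart q₁ z)) (t, (chartAt 𝔼 q₁).symm x)
      (τ, chartSymmDeriv q₁ x v) = L (τ, v) := by
  have hderiv := (hasMFDerivAt_comp_eventChart hx hf).mfderiv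
  rw [modelWithCornersSelf_prod, ← chartedSpaceSelf_prod] at hderiv
  exact (congrArg (fun L' : ℝ × 𝔼 →L[ℝ] ℝ × 𝔼 => L' (τ, chartSymmDeriv q₁ x v)) hderiv).trans
    (congrArg (fun w => L (τ, w)) (chartDeriv_chartSymmDeriv hx v))

lemma hasFDerivAt_comp_eventChart_symm {u : ℝ → Q → ℝ} (hx : x ∈ (chartAt 𝔼 q₁).target)
    (hu : MDifferentiableAt (eventModel d) 𝓘(ℝ, ℝ) (fun z : ℝ × Q => u z.1 z.2)
      (t, (chartAt 𝔼 q₁).symm x)) :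
    HasFDerivAt ((fun z : ℝ × Q => u z.1 z.2) ∘ (eventChart q₁).symm)
      (eventDifferential (d := d) u (t, (chartAt 𝔼 q₁).symm x) ∘L
        (ContinuousLinearMap.fst ℝ ℝ 𝔼).prod
          (chartSymmDeriv q₁ x ∘L ContinuousLinearMap.snd ℝ ℝ 𝔼)) (t, x) := by
  have hchart := (hasMFDerivAt_fst (I := 𝓘(ℝ, ℝ)) (I' := 𝓡 d) (t, x)).prodMk
    ((hasMFDerivAt_chart_symm hx).comp (t, x)
      (hasMFDerivAt_snd (I := 𝓘(ℝ, ℝ)) (I' := 𝓡 d) (t, x)))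
  have hcomp := hu.hasMFDerivAt.comp (t, x) hchart
  rw [chartedSpaceSelf_prod, ← modelWithCornersSelf_prod] at hcomp
  exact hasMFDerivAt_iff_hasFDerivAt.1 hcomp

lemma dq_chartSymmDeriv {u : ℝ → Q → ℝ} (hx : x ∈ (chartAt 𝔼 q₁).target)
    (hu : MDifferentiableAt (eventModel d) 𝓘(ℝ, ℝ) (fun z : ℝ × Q => u z.1 z.2)
      (t, (chartAt 𝔼 q₁).symm x)) (v : 𝔼) :
    fderiv ℝ ((fun z : ℝ × Q => u z.1 z.2) ∘ (eventChart q₁).symm) (t, x) (0, v) =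
      BrinkmannData.dq u t ((chartAt 𝔼 q₁).symm x) (chartSymmDeriv q₁ x v) := by
  rw [(hasFDerivAt_comp_eventChart_symm hx hu).fderiv]
  exact (dq_apply_eq_eventDifferential hu (chartSymmDeriv q₁ x v)).symm

end EventChart

section ChartData

variable {d : ℕ} {Q : Type*} [TopologicalSpace Q] [ChartedSpace (EuclideanSpace ℝ (Fin d)) Q]

local notation "𝔼" => EuclideanSpace ℝ (Fin d)

lemma contMDiffOn_chartSymmDeriv {n : WithTop ℕ∞} [IsManifold (𝓡 d) 1 Q]
    [IsManifold (𝓡 d) (n + 1) Q] (q₁ : Q) (v : 𝔼) :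
    ContMDiffOn 𝓘(ℝ, ℝ × 𝔼) (𝓘(ℝ, ℝ).prod (𝓡 d).tangent) n
      (fun z : ℝ × 𝔼 => (z.1,
        (⟨(chartAt 𝔼 q₁).symm z.2, chartSymmDeriv q₁ z.2 v⟩ : TangentBundle (𝓡 d) Q)))
      (eventChart q₁).target := by
  have hconst : ContMDiff 𝓘(ℝ, 𝔼) 𝓘(ℝ, 𝔼).tangent n
      (fun x : 𝔼 => (⟨x, v⟩ : TangentBundle 𝓘(ℝ, 𝔼) 𝔼)) :=
    contMDiff_vectorSpace_iff_contDiff (V := fun _ => v).2 contDiff_const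
  have hbundle := ((contMDiffOn_chart_symm (I := 𝓡 d) (x := q₁)
    (n := n + 1)).contMDiffOn_tangentMapWithin le_rfl
    (chartAt 𝔼 q₁).open_target.uniqueMDiffOn).comp
    (hconst.comp (contDiff_snd (𝕜 := ℝ) (E := ℝ)).contMDiff).contMDiffOn
    (s := (eventChart q₁).target) (fun _ hz => hz.2)
  refine (contDiff_fst.contMDiff.contMDiffOn.prodMk hbundle).congr fun z hz => ?_
  exact congrArg (fun L : 𝔼 →L[ℝ] 𝔼 =>
    (z.1, (⟨(chartAt 𝔼 q₁).symm z.2, L v⟩ : TangentBundle (𝓡 d) Q)))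
    (mfderivWithin_of_isOpen (chartAt 𝔼 q₁).open_target hz.2).symm

namespace BrinkmannData

variable {r : ℕ∞} [IsManifold (𝓡 d) 1 Q]

/-- The coordinate expression in the chart at `q₁` of the space metric, as a function of
`(t, x)`. -/
noncomputable def chartMetric (D : BrinkmannData d Q r) (q₁ : Q) (z : ℝ × 𝔼) :
    𝔼 →L[ℝ] 𝔼 →L[ℝ] ℝ :=
  ContinuousLinearMap.bilinearComp (D.a z.1 ((chartAt 𝔼 q₁).symm z.2) : 𝔼 →L[ℝ] 𝔼 →L[ℝ] ℝ)
    (chartSymmDeriv q₁ z.2) (chartSymmDeriv q₁ z.2)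

/-- The coordinate expression in the chart at `q₁` of the 1-form `b`, as a function of
`(t, x)`. -/
noncomputable def chartForm (D : BrinkmannData d Q r) (q₁ : Q) (z : ℝ × 𝔼) : 𝔼 →L[ℝ] ℝ :=
  (D.b z.1 ((chartAt 𝔼 q₁).symm z.2) : 𝔼 →L[ℝ] ℝ) ∘L chartSymmDeriv q₁ z.2

/-- The coordinate expression in the chart at `q₁` of the potential, as a function of
`(t, x)`. -/
noncomputable def chartPotential (D : BrinkmannData d Q r) (q₁ : Q) (z : ℝ × 𝔼) : ℝ :=
  D.V z.1 ((chartAt 𝔼 q₁).symm z.2)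

variable (D : BrinkmannData d Q r) {q₁ : Q}

lemma chartMetric_symm (z : ℝ × 𝔼) (v w : 𝔼) :
    D.chartMetric q₁ z v w = D.chartMetric q₁ z w v :=
  D.isMetric.symm z.1 _ trivial (chartSymmDeriv q₁ z.2 v) (chartSymmDeriv q₁ z.2 w)

lemma chartMetric_pos {z : ℝ × 𝔼} (hz : z ∈ (eventChart q₁).target) (v : 𝔼) (hv : v ≠ 0) :
    0 < D.chartMetric q₁ z v v :=
  D.isMetric.pos z.1 _ trivial (chartSymmDeriv q₁ z.2 v) fun h =>
    hv ((bijective_chartSymmDeriv hz.2).injective (h.trans (map_zero _).symm))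

lemma contDiffOn_chartMetric [IsManifold (𝓡 d) ((r : WithTop ℕ∞) + 1) Q] :
    ContDiffOn ℝ r (D.chartMetric q₁) (eventChart q₁).target := by
  have hquadratic (v : 𝔼) :
      ContDiffOn ℝ r (fun z => D.chartMetric q₁ z v v) (eventChart q₁).target :=
    (D.isMetric.contMDiffOn.comp (contMDiffOn_chartSymmDeriv q₁ v) fun _ _ => trivial).contDiffOn
  refine contDiffOn_clm_apply.2 fun v => contDiffOn_clm_apply.2 fun w => ?_
  -- Only the quadratic form is assumed to be smooth; polarize.
  refine (contDiffOn_const (c := (1 / 2 : ℝ)).mul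
    (((hquadratic (v + w)).sub (hquadratic v)).sub (hquadratic w))).congr fun z _ => ?_
  simp only [map_add, add_apply, D.chartMetric_symm z w v]
  ring

lemma contDiffOn_chartForm [IsManifold (𝓡 d) ((r : WithTop ℕ∞) + 1) Q] :
    ContDiffOn ℝ r (D.chartForm q₁) (eventChart q₁).target :=
  contDiffOn_clm_apply.2 fun v =>
    (D.contMDiff_b.comp_contMDiffOn (contMDiffOn_chartSymmDeriv q₁ v)).contDiffOn

lemma contDiffOn_chartPotential [IsManifold (𝓡 d) (r : WithTop ℕ∞) Q] :
    ContDiffOn ℝ r (D.chartPotential q₁) (eventChart q₁).target :=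
  contDiffOn_comp_eventChart_symm D.contMDiff_V.contMDiffOn subset_rfl (mapsTo_univ _ _)

variable {t : ℝ} {x : EuclideanSpace ℝ (Fin d)}
  {p : TangentSpace (𝓡 d) ((chartAt (EuclideanSpace ℝ (Fin d)) q₁).symm x) →L[ℝ] ℝ}
  {π : EuclideanSpace ℝ (Fin d) →L[ℝ] ℝ}

lemma chartSymmDeriv_legendreVelocity (hx : x ∈ (chartAt 𝔼 q₁).target)
    (hp : ∀ v, π v = p (chartSymmDeriv q₁ x v)) :
    chartSymmDeriv q₁ x (legendreVelocity (D.chartMetric q₁) (D.chartForm q₁) (t, x, π)) =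
      D.sharp t ((chartAt 𝔼 q₁).symm x) (p - D.b t ((chartAt 𝔼 q₁).symm x)) := by
  refine D.eq_sharp_iff.2 (ContinuousLinearMap.ext fun w => ?_)
  obtain ⟨v, rfl⟩ := (bijective_chartSymmDeriv hx).surjective w
  have hself := (isInvertible_of_apply_self_pos
    (D.chartMetric_pos (z := (t, x)) ⟨trivial, hx⟩)).self_apply_inverse (π - D.chartForm q₁ (t, x))
  exact (congrArg (fun L : 𝔼 →L[ℝ] ℝ => L v) hself).trans
    (congrArg (· - D.chartForm q₁ (t, x) v) (hp v))

lemma legendreHamiltonian_chart (hx : x ∈ (chartAt 𝔼 q₁).target)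
    (hp : ∀ v, π v = p (chartSymmDeriv q₁ x v)) :
    legendreHamiltonian (D.chartMetric q₁) (D.chartForm q₁) (D.chartPotential q₁) (t, x, π) =
      D.hamiltonian t ((chartAt 𝔼 q₁).symm x) p := by
  rw [hamiltonian, ← D.chartSymmDeriv_legendreVelocity hx hp]
  exact congrArg (fun s => 1 / 2 * (s - D.chartForm q₁ (t, x)
    (legendreVelocity (D.chartMetric q₁) (D.chartForm q₁) (t, x, π))) + D.chartPotential q₁ (t, x))
    (hp _)

end BrinkmannData

end ChartData

/-! ### Existence of Rosen coordinates -/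

lemma one_le_sub_one {k : ℕ∞} (hk : 2 ≤ k) : 1 ≤ k - 1 :=
  ENat.le_sub_of_add_le_left ENat.one_ne_top (by rwa [one_add_one_eq_two])

section EvolutionCoordinates

variable {E : Type*} [NormedAddCommGroup E] [NormedSpace ℝ E] [FiniteDimensional ℝ E]
  {M : Type*} [TopologicalSpace M] [T2Space M] [ChartedSpace E M] [IsManifold 𝓘(ℝ, E) 1 M]
  {X : ℝ → (q : M) → TangentSpace 𝓘(ℝ, E) q} {I : Set ℝ} {ψ : ℝ → ℝ → M → M} {n : ℕ∞}
  [IsManifold 𝓘(ℝ, E) n M] {t₀ : ℝ} (hI : IsOpen I) (hIc : I.OrdConnected) (hn : 1 ≤ n)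
  (hX : IsTimeFieldOn n X I) (hψ : IsEvolutionOn X I ψ) (ht₀ : t₀ ∈ I)

include hI hIc hn hX hψ ht₀

lemma IsEvolutionOn.contMDiffOn_initial :
    ContMDiffOn (𝓘(ℝ, ℝ).prod 𝓘(ℝ, E)) 𝓘(ℝ, E) n (fun z : ℝ × M => ψ t₀ z.1 z.2)
      (I ×ˢ univ) := fun z hz =>
  (ContMDiffAt.comp z (f := fun z : ℝ × M => (t₀, z.1, z.2))
    (hψ.contMDiffAt hI hIc hn hX ht₀ hz.1 z.2)
    (contMDiffAt_const.prodMk contMDiffAt_id)).contMDiffWithinAt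

lemma IsEvolutionOn.contMDiffOn_final :
    ContMDiffOn (𝓘(ℝ, ℝ).prod 𝓘(ℝ, E)) 𝓘(ℝ, E) n (fun z : ℝ × M => ψ z.1 t₀ z.2)
      (I ×ˢ univ) := fun z hz =>
  (ContMDiffAt.comp z (f := fun z : ℝ × M => (z.1, t₀, z.2))
    (hψ.contMDiffAt hI hIc hn hX hz.1 ht₀ z.2)
    (contMDiffAt_fst.prodMk (contMDiffAt_const.prodMk contMDiffAt_snd))).contMDiffWithinAt

omit t₀ ht₀ [FiniteDimensional ℝ E] [IsManifold 𝓘(ℝ, E) n M] in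
lemma IsEvolutionOn.comp_self {s t : ℝ} (hs : s ∈ I) (ht : t ∈ I) (q : M) :
    ψ t s (ψ s t q) = q :=
  (hψ.comp hI hIc hn hX ht ht hs q).trans (hψ t ht q).2

/-- The coordinates `(t, ψ t₀ t q)` of the event `(t, q)`, which transport `q` to the time `t₀`
along the evolution `ψ`. -/
def evolutionCoordinates : OpenPartialHomeomorph (ℝ × M) (ℝ × M) where
  toFun z := (z.1, ψ t₀ z.1 z.2)
  invFun z := (z.1, ψ z.1 t₀ z.2)
  source := I ×ˢ univ
  target := I ×ˢ univ
  map_source' _ hz := ⟨hz.1, trivial⟩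
  map_target' _ hz := ⟨hz.1, trivial⟩
  left_inv' z hz := Prod.ext rfl (hψ.comp_self hI hIc hn hX ht₀ hz.1 z.2)
  right_inv' z hz := Prod.ext rfl (hψ.comp_self hI hIc hn hX hz.1 ht₀ z.2)
  open_source := hI.prod isOpen_univ
  open_target := hI.prod isOpen_univ
  continuousOn_toFun :=
    continuousOn_fst.prodMk (hψ.contMDiffOn_initial hI hIc hn hX ht₀).continuousOn
  continuousOn_invFun :=
    continuousOn_fst.prodMk (hψ.contMDiffOn_final hI hIc hn hX ht₀).continuousOn

end EvolutionCoordinates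

section RosenOfHamiltonJacobi

variable {d : ℕ} {Q : Type u} [TopologicalSpace Q] [ChartedSpace (EuclideanSpace ℝ (Fin d)) Q]

local notation "𝔼" => EuclideanSpace ℝ (Fin d)

lemma eventDeriv_apply_of_eventually_const {Q' : Type*} [TopologicalSpace Q']
    [ChartedSpace (EuclideanSpace ℝ (Fin d)) Q'] {Ψ : ℝ × Q → ℝ × Q'} {t : ℝ} {γ : ℝ → Q}
    {w : TangentSpace (𝓡 d) (γ t)} {q' : Q'}
    (hΨ : MDifferentiableAt (eventModel d) (eventModel d) Ψ (t, γ t))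
    (hγ : HasMFDerivAt 𝓘(ℝ, ℝ) (𝓡 d) γ t (ContinuousLinearMap.toSpanSingleton ℝ w))
    (hconst : ∀ᶠ s in 𝓝 t, Ψ (s, γ s) = (s, q')) :
    eventDeriv (d := d) Ψ (t, γ t) (1, w) = (1, 0) := by
  have hcomp := hΨ.hasMFDerivAt.comp t ((hasMFDerivAt_id t).prodMk hγ)
  have hline : HasMFDerivAt 𝓘(ℝ, ℝ) (eventModel d) (fun s : ℝ => (s, q')) t
      ((ContinuousLinearMap.id ℝ ℝ).prod (0 : ℝ →L[ℝ] 𝔼)) :=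
    (hasMFDerivAt_id t).prodMk (hasMFDerivAt_const q' t)
  have hvelocity := congrArg (fun L : ℝ →L[ℝ] ℝ × 𝔼 => L 1)
    (hasMFDerivAt_unique hcomp (hline.congr_of_eventuallyEq hconst))
  exact (congrArg (fun w' : 𝔼 => eventDeriv (d := d) Ψ (t, γ t) (1, w'))
    (one_smul ℝ (w : 𝔼))).symm.trans hvelocity

namespace BrinkmannData

variable [IsManifold (𝓡 d) 1 Q] {r k m : ℕ∞} {D : BrinkmannData d Q r} {I : Set ℝ}
  {u : ℝ → Q → ℝ}

lemma isTimeFieldOn_characteristicVelocity [IsManifold (𝓡 d) ((r : WithTop ℕ∞) + 1) Q]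
    (hI : IsOpen I) (hmk : m + 1 ≤ k) (hkr : k ≤ r + 1)
    (hu : ContMDiffOn (eventModel d) 𝓘(ℝ, ℝ) (k : WithTop ℕ∞) (fun z : ℝ × Q => u z.1 z.2)
      (I ×ˢ univ)) :
    IsTimeFieldOn m (fun t q => D.characteristicVelocity u (t, q)) I := by
  intro q₁
  have hmr : (m : WithTop ℕ∞) ≤ r := by
    exact_mod_cast (ENat.add_le_add_iff_right ENat.one_ne_top).1 (hmk.trans hkr)
  have hk₀ : (k : WithTop ℕ∞) ≠ 0 := by
    exact_mod_cast ((zero_lt_one.trans_le le_add_self).trans_le hmk).ne'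
  have : IsManifold (𝓡 d) (k : WithTop ℕ∞) Q :=
    IsManifold.of_le (n := (r : WithTop ℕ∞) + 1) (by exact_mod_cast hkr)
  have hsubset : I ×ˢ (chartAt 𝔼 q₁).target ⊆ (eventChart q₁).target := fun _ hz =>
    ⟨trivial, hz.2⟩
  have huchart := contDiffOn_comp_eventChart_symm hu hsubset fun _ hz => ⟨hz.1, trivial⟩
  have hmomentum := (huchart.fderiv_of_isOpen (m := m) (hI.prod (chartAt 𝔼 q₁).open_target)
    (by exact_mod_cast hmk)).clm_comp
    (contDiffOn_const (c := ContinuousLinearMap.inr ℝ ℝ 𝔼))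
  have hvelocity := contDiffOn_legendreVelocity (D.contDiffOn_chartMetric.of_le hmr)
    (D.contDiffOn_chartForm.of_le hmr) fun _ hz => D.chartMetric_pos (q₁ := q₁) hz
  refine ⟨_, hvelocity.comp (contDiffOn_fst.prodMk (contDiffOn_snd.prodMk hmomentum)) hsubset,
    fun t ht x hx => D.chartSymmDeriv_legendreVelocity hx (dq_chartSymmDeriv hx ?_)⟩
  exact (hu.contMDiffAt ((hI.prod isOpen_univ).mem_nhds ⟨ht, trivial⟩)).mdifferentiableAt hk₀

lemma CharacteristicsDefinedOn.exists_isEvolutionOn (h : D.CharacteristicsDefinedOn I u) :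
    ∃ ψ, IsEvolutionOn (fun t q => D.characteristicVelocity u (t, q)) I ψ := by
  choose! γ hγ using h.1
  exact ⟨fun s t q => γ t q s, hγ⟩

variable [T2Space Q]

lemma IsHJSolutionOn.isCharacteristicCoordinates_evolutionCoordinates
    [IsManifold (𝓡 d) (m : WithTop ℕ∞) Q] (hu : D.IsHJSolutionOn k I u) (hI : IsOpen I)
    (hIc : I.OrdConnected) (hm : 1 ≤ m) {ψ : ℝ → ℝ → Q → Q}
    (hX : IsTimeFieldOn m (fun t q => D.characteristicVelocity u (t, q)) I)
    (hψ : IsEvolutionOn (fun t q => D.characteristicVelocity u (t, q)) I ψ) {t₀ : ℝ}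
    (ht₀ : t₀ ∈ I) :
    D.IsCharacteristicCoordinates m k (evolutionCoordinates hI hIc hm hX hψ ht₀) u where
  contMDiffOn := contMDiffOn_fst.prodMk (hψ.contMDiffOn_initial hI hIc hm hX ht₀)
  contMDiffOn_symm := contMDiffOn_fst.prodMk (hψ.contMDiffOn_final hI hIc hm hX ht₀)
  time _ _ := rfl
  contMDiffOn_solution := hu.contMDiffOn
  equation z hz := hu.equation z.1 hz.1 z.2
  eventDeriv_characteristic := by
    rintro ⟨t, q⟩ ⟨ht, -⟩
    have hm₀ : (m : WithTop ℕ∞) ≠ 0 := by exact_mod_cast (zero_lt_one.trans_le hm).ne'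
    have hdiff : MDifferentiableAt (eventModel d) (eventModel d)
        (evolutionCoordinates hI hIc hm hX hψ ht₀) (t, ψ t t q) :=
      ((contMDiffOn_fst.prodMk (hψ.contMDiffOn_initial hI hIc hm hX ht₀)).contMDiffAt
        ((hI.prod isOpen_univ).mem_nhds (x := (t, ψ t t q)) ⟨ht, trivial⟩)).mdifferentiableAt hm₀
    have hkill := eventDeriv_apply_of_eventually_const (q' := ψ t₀ t q) hdiff
      ((hψ t ht q).1 t ht) (by
        filter_upwards [hI.mem_nhds ht] with s hs
        exact Prod.ext rfl (hψ.comp hI hIc hm hX ht₀ ht hs q))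
    simp only [(hψ t ht q).2] at hkill
    exact hkill

theorem HasHJSolution.hasRosen [IsManifold (𝓡 d) ((r : WithTop ℕ∞) + 1) Q] (hk : 2 ≤ k)
    (hkr : k ≤ r + 1) (hI : IsOpen I) (hIc : I.OrdConnected) (hne : I.Nonempty)
    (h : D.HasHJSolution k I) : D.HasRosen (k - 1) k I := by
  obtain ⟨u, hu, hcomplete⟩ := h
  obtain ⟨ψ, hψ⟩ := hcomplete.exists_isEvolutionOn
  obtain ⟨t₀, ht₀⟩ := hne
  have hk₁ : 1 ≤ k - 1 := one_le_sub_one hk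
  have hkr' : k - 1 ≤ r + 1 := tsub_le_self.trans hkr
  have : IsManifold (𝓡 d) ((k - 1 : ℕ∞) : WithTop ℕ∞) Q :=
    IsManifold.of_le (n := (r : WithTop ℕ∞) + 1) (by exact_mod_cast hkr')
  have hX := D.isTimeFieldOn_characteristicVelocity hI
    (tsub_add_cancel_of_le (one_le_two.trans hk)).le hkr hu.contMDiffOn
  have hΨ := hu.isCharacteristicCoordinates_evolutionCoordinates hI hIc hk₁ hX hψ ht₀
  refine ⟨Q, _, _, inferInstance, inferInstance, _, _, ?_, ?_,
    hΨ.isRosen hk₁ tsub_le_self hkr'⟩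
  · exact Set.ext fun x => ⟨fun hx => hx.1, fun hx => ⟨hx, trivial⟩⟩
  · exact Set.ext fun x => ⟨fun hx => hx.1, fun hx => ⟨hx, trivial⟩⟩

end BrinkmannData

end RosenOfHamiltonJacobi

section LocalRosen

variable {d : ℕ} {Q : Type*} [TopologicalSpace Q] [ChartedSpace (EuclideanSpace ℝ (Fin d)) Q]
  [IsManifold (𝓡 d) 1 Q] {r m : ℕ∞}

local notation "𝔼" => EuclideanSpace ℝ (Fin d)

namespace BrinkmannData

/-- `IsCharacteristicChart` for the coordinate expression of the Hamiltonian in the chart at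
`q₁`. -/
def IsCharacteristicChartAt (D : BrinkmannData d Q r) (q₁ : Q) (m : ℕ∞)
    (Ψ : OpenPartialHomeomorph (ℝ × 𝔼) (ℝ × 𝔼)) (u : ℝ × 𝔼 → ℝ) (P : ℝ × 𝔼 → 𝔼 →L[ℝ] ℝ) : Prop :=
  IsCharacteristicChart m {w | (w.1, w.2.1) ∈ (eventChart q₁).target}
    (legendreHamiltonian (D.chartMetric q₁) (D.chartForm q₁) (D.chartPotential q₁))
    (legendreVelocity (D.chartMetric q₁) (D.chartForm q₁)) Ψ u P

lemma exists_isCharacteristicChartAt [IsManifold (𝓡 d) ((r : WithTop ℕ∞) + 1) Q]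
    (D : BrinkmannData d Q r) (hm : 1 ≤ m) (hmr : m + 1 ≤ r) (t₀ : ℝ) (q₁ : Q) :
    ∃ Ψ u P, (t₀, chartAt 𝔼 q₁ q₁) ∈ Ψ.source ∧ D.IsCharacteristicChartAt q₁ m Ψ u P := by
  have hmr' : (m : WithTop ℕ∞) + 1 ≤ r := by exact_mod_cast hmr
  have : IsManifold (𝓡 d) (r : WithTop ℕ∞) Q :=
    IsManifold.of_le (n := (r : WithTop ℕ∞) + 1) le_self_add
  exact (isHamiltonianOn_legendreHamiltonian (eventChart q₁).open_target
    (D.contDiffOn_chartMetric.of_le hmr') (D.contDiffOn_chartForm.of_le hmr')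
    (D.contDiffOn_chartPotential.of_le hmr') (fun z _ => D.chartMetric_symm z)
    (fun _ hz => D.chartMetric_pos hz)).exists_isCharacteristicChart hm
    ⟨trivial, (chartAt 𝔼 q₁).map_source (mem_chart_source _ _)⟩

namespace IsCharacteristicChartAt

variable {D : BrinkmannData d Q r} {q₁ : Q}
  {Ψ : OpenPartialHomeomorph (ℝ × EuclideanSpace ℝ (Fin d)) (ℝ × EuclideanSpace ℝ (Fin d))}
  {u : ℝ × EuclideanSpace ℝ (Fin d) → ℝ}
  {P : ℝ × EuclideanSpace ℝ (Fin d) → EuclideanSpace ℝ (Fin d) →L[ℝ] ℝ}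
  (h : D.IsCharacteristicChartAt q₁ m Ψ u P)

include h

section Pointwise

variable {t : ℝ} {x : EuclideanSpace ℝ (Fin d)} (hx : (t, x) ∈ Ψ.source)

include hx

lemma momentum_eq_dq (v : 𝔼) :
    P (t, x) v = dq (d := d) (fun t q => u (eventChart q₁ (t, q))) t ((chartAt 𝔼 q₁).symm x)
      (chartSymmDeriv q₁ x v) := by
  have htarget : x ∈ (chartAt 𝔼 q₁).target := (h.mem _ hx).2
  refine .trans ?_ (dq_apply_eq_eventDifferential (t := t) (q := (chartAt 𝔼 q₁).symm x)
    (u := fun t q => u (eventChart q₁ (t, q)))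
    (mdifferentiableAt_comp_eventChart htarget (h.hasFDerivAt _ hx)) _).symm
  refine .trans ?_ (eventDifferential_comp_eventChart htarget (h.hasFDerivAt _ hx) 0 v).symm
  rw [canonicalForm_apply, mul_zero, sub_zero]

lemma deriv_eq_neg_hamiltonian :
    deriv (fun s => u (eventChart q₁ (s, (chartAt 𝔼 q₁).symm x))) t =
      -legendreHamiltonian (D.chartMetric q₁) (D.chartForm q₁) (D.chartPotential q₁)
        (t, x, P (t, x)) := by
  have htarget : x ∈ (chartAt 𝔼 q₁).target := (h.mem _ hx).2
  have hdifferential := eventDifferential_comp_eventChart htarget (h.hasFDerivAt _ hx) 1 0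
  rw [map_zero, canonicalForm_apply, map_zero, mul_one, zero_sub] at hdifferential
  exact (deriv_eq_eventDifferential (t := t) (q := (chartAt 𝔼 q₁).symm x)
    (u := fun t q => u (eventChart q₁ (t, q)))
    (mdifferentiableAt_comp_eventChart htarget (h.hasFDerivAt _ hx))).trans hdifferential

lemma eventDeriv_characteristicVelocity (hm : 1 ≤ m) :
    eventDeriv (d := d) ((eventChart q₁).trans Ψ) (t, (chartAt 𝔼 q₁).symm x)
      (1, D.characteristicVelocity (fun t q => u (eventChart q₁ (t, q)))
        (t, (chartAt 𝔼 q₁).symm x)) = (1, 0) := by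
  have htarget : x ∈ (chartAt 𝔼 q₁).target := (h.mem _ hx).2
  have hm₀ : (m : WithTop ℕ∞) ≠ 0 := by exact_mod_cast (zero_lt_one.trans_le hm).ne'
  have hΨ : HasFDerivAt Ψ (fderiv ℝ Ψ (t, x)) (t, x) :=
    ((h.contDiffOn.contDiffAt (Ψ.open_source.mem_nhds hx)).differentiableAt hm₀).hasFDerivAt
  have hvelocity := D.chartSymmDeriv_legendreVelocity (t := t) htarget (h.momentum_eq_dq hx)
  refine (congrArg (fun w : 𝔼 => eventDeriv (d := d) ((eventChart q₁).trans Ψ)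
    (t, (chartAt 𝔼 q₁).symm x) (1, w)) hvelocity.symm).trans ?_
  exact (eventDeriv_comp_eventChart htarget hΨ 1 _).trans (h.fderiv_velocity _ hx)

end Pointwise

lemma isCharacteristicCoordinates [IsManifold (𝓡 d) ((m : WithTop ℕ∞) + 1) Q] (hm : 1 ≤ m) :
    D.IsCharacteristicCoordinates m (m + 1) ((eventChart q₁).trans Ψ)
      (fun t q => u (eventChart q₁ (t, q))) := by
  have : IsManifold (𝓡 d) (m : WithTop ℕ∞) Q :=
    IsManifold.of_le (n := (m : WithTop ℕ∞) + 1) le_self_add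
  have hpoint : ∀ z ∈ ((eventChart q₁).trans Ψ).source, ∃ t x, (t, x) ∈ Ψ.source ∧
      z = (t, (chartAt 𝔼 q₁).symm x) := fun z hz =>
    ⟨z.1, chartAt 𝔼 q₁ z.2, hz.2, Prod.ext rfl ((chartAt 𝔼 q₁).left_inv hz.1.2).symm⟩
  refine ⟨?_, ?_, fun z hz => h.time _ hz.2, ?_, ?_, ?_⟩
  · exact (contMDiffOn_eventModel_prod h.contDiffOn).comp
      (contMDiffOn_eventChart.mono fun z (hz : z ∈ ((eventChart q₁).trans Ψ).source) => hz.1)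
      fun z hz => hz.2
  · exact contMDiffOn_eventChart_symm.comp ((contMDiffOn_eventModel_prod h.contDiffOn_symm).mono
      fun z (hz : z ∈ ((eventChart q₁).trans Ψ).target) => hz.1) fun z hz => hz.2
  · exact_mod_cast (contMDiffOn_eventModel_of_contDiffOn h.contDiffOn_solution).comp
      (contMDiffOn_eventChart.mono fun z (hz : z ∈ ((eventChart q₁).trans Ψ).source) => hz.1)
      fun z hz => hz.2
  · intro z hz
    obtain ⟨t, x, hx, rfl⟩ := hpoint z hz
    refine (congrArg₂ (· + ·) (h.deriv_eq_neg_hamiltonian hx)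
      (D.legendreHamiltonian_chart (h.mem _ hx).2 (h.momentum_eq_dq hx)).symm).trans ?_
    exact neg_add_cancel _
  · intro z hz
    obtain ⟨t, x, hx, rfl⟩ := hpoint z hz
    exact h.eventDeriv_characteristicVelocity hx hm

end IsCharacteristicChartAt

theorem exists_isRosen [IsManifold (𝓡 d) ((r : WithTop ℕ∞) + 1) Q] (hr : 2 ≤ r)
    (D : BrinkmannData d Q r) (p : ℝ × Q × ℝ) :
    ∃ (Φ : OpenPartialHomeomorph (ℝ × Q × ℝ) (ℝ × 𝔼 × ℝ)) (a' : TimeBilin d 𝔼),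
      p ∈ Φ.source ∧ D.IsRosen (r - 1) r Φ a' := by
  have hr₁ : 1 ≤ r - 1 := one_le_sub_one hr
  have hrr : r - 1 + 1 = r := tsub_add_cancel_of_le (one_le_two.trans hr)
  have hr' : ((r - 1 : ℕ∞) : WithTop ℕ∞) + 1 ≤ (r : WithTop ℕ∞) := by exact_mod_cast hrr.le
  have : IsManifold (𝓡 d) (((r - 1 : ℕ∞) : WithTop ℕ∞) + 1) Q :=
    IsManifold.of_le (n := (r : WithTop ℕ∞) + 1) (hr'.trans le_self_add)
  obtain ⟨Ψ, u, P, hmem, hΨ⟩ := D.exists_isCharacteristicChartAt hr₁ hrr.le p.1 p.2.1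
  have hcoordinates := hΨ.isCharacteristicCoordinates hr₁
  rw [hrr] at hcoordinates
  have hsource : (p.1, p.2.1) ∈ ((eventChart p.2.1).trans Ψ).source :=
    ⟨⟨trivial, mem_chart_source _ _⟩, hmem⟩
  exact ⟨_, _, hsource, hcoordinates.isRosen hr₁ tsub_le_self (tsub_le_self.trans le_self_add)⟩

end BrinkmannData

end LocalRosen

lemma TimeLocally.mono {t₀ : ℝ} {P P' : Set ℝ → Prop} (h : TimeLocally t₀ P)
    (hPP' : ∀ I, IsOpen I → I.OrdConnected → I.Nonempty → P I → P' I) : TimeLocally t₀ P' := by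
  obtain ⟨I, hI, hIc, ht₀, hP⟩ := h
  exact ⟨I, hI, hIc, ht₀, hPP' I hI hIc ⟨t₀, ht₀⟩ hP⟩

theorem mainTheorem7 {d : ℕ} {Q : Type u} [TopologicalSpace Q] [T2Space Q]
    [ChartedSpace (EuclideanSpace ℝ (Fin d)) Q] {r : ℕ∞} (hr : 2 ≤ r)
    [IsManifold (𝓡 d) 1 Q] [IsManifold (𝓡 d) ((r + 1 : ℕ∞) : WithTop ℕ∞) Q]
    (D : BrinkmannData d Q r) :
    -- Rosen coordinates near every point of the spacetime
    (∀ p : ℝ × Q × ℝ,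
      ∃ (Φ : OpenPartialHomeomorph (ℝ × Q × ℝ) (ℝ × EuclideanSpace ℝ (Fin d) × ℝ))
        (a' : TimeBilin d (EuclideanSpace ℝ (Fin d))),
        p ∈ Φ.source ∧ D.IsRosen (r - 1) r Φ a') ∧
    -- global Rosen coordinates
    ((∀ k : ℕ∞, 1 ≤ k → k ≤ r + 1 →
        D.HasRosen k k Set.univ → D.HasHJSolution k Set.univ) ∧
      (∀ k : ℕ∞, 2 ≤ k → k ≤ r + 1 →
        (D.HasRosen (k - 1) k Set.univ ↔ D.HasHJSolution k Set.univ))) ∧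
    -- Rosen coordinates that are local in time
    (∀ t₀ : ℝ,
      (∀ k : ℕ∞, 1 ≤ k → k ≤ r + 1 →
        TimeLocally t₀ (D.HasRosen k k) → TimeLocally t₀ (D.HasHJSolution k)) ∧
      (∀ k : ℕ∞, 2 ≤ k → k ≤ r + 1 →
        (TimeLocally t₀ (D.HasRosen (k - 1) k) ↔ TimeLocally t₀ (D.HasHJSolution k)))) := by
  have : IsManifold (𝓡 d) ((r : WithTop ℕ∞) + 1) Q := by
    exact_mod_cast (inferInstance : IsManifold (𝓡 d) ((r + 1 : ℕ∞) : WithTop ℕ∞) Q)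
  refine ⟨D.exists_isRosen hr, ⟨fun k hk _ hrosen => hrosen.hasHJSolution hk,
    fun k hk hkr => ⟨fun hrosen => hrosen.hasHJSolution (one_le_sub_one hk), fun hsolution =>
      hsolution.hasRosen hk hkr isOpen_univ ordConnected_univ univ_nonempty⟩⟩,
    fun t₀ => ⟨fun k hk _ hrosen => hrosen.mono fun _ _ _ _ h => h.hasHJSolution hk,
      fun k hk hkr => ⟨fun hrosen => hrosen.mono fun _ _ _ _ h =>
          h.hasHJSolution (one_le_sub_one hk),
        fun hsolution => hsolution.mono fun _ hI hIc hne h => h.hasRosen hk hkr hI hIc hne⟩⟩⟩
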